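/- \textbf{Setting.} Fix $E>0$, $\alpha,\beta\in(0,1)$. For $N\ge 2$ let $\Sigma_N=\{0,1\}^{\{1,\dots,N-1\}}$ and let $\{\eta_t=\eta^N_t:t\ge0\}$ be the right-continuous (with left limits) $\Sigma_N$-valued Markov process with generator $$(\mathcal L_Nf)(\eta)=N^2\sum_{j=0}^{N-1}c_{j,j+1}(\eta)\{f(\sigma^{j,j+1}\eta)-f(\eta)\},\qquad c_{j,j+1}(\eta)=\Big(1+\frac EN\Big)\eta(j)[1-\eta(j+1)]+\eta(j+1)[1-\eta(j)],$$ with the convention $\eta(0)=\alpha$, $\eta(N)=\beta$; here $\sigma^{j,j+1}\eta$, $1\le j\le N-2$, is $\eta$ with the values at $j,j+1$ exchanged, and $\sigma^{0,1}\eta$, $\sigma^{N-1,N}\eta$ are $\eta$ with the value at $1$, respectively $N-1$, flipped. $\mathbb P_{\mu_N}$ denotes its law when $\eta_0$ has distribution $\mu_N$. Let $\rho_0:[0,1]\to[0,1]$ be in $C^4([0,1])$ with $\rho_0(0)=\alpha$, $\rho_0(1)=\beta$, and let $(\mu_N)$ be probability measures on $\Sigma_N$ such that, for some finite constant $A_2$,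 $$\sup_{N\ge 2}\max_{1\le k\le N-1}E_{\mu_N}\Big[\Big(\frac1{\sqrt N}\sum_{j=1}^k\{\eta_0(j)-\rho_0(j/N)\}\Big)^4\Big]\le A_2 .$$ For $g:\{0,\dots,N\}\to\mathbb R$ write $(\nabla_N^+g)(j)=N[g(j+1)-g(j)]$, $(\nabla_N^-g)(j)=N[g(j)-g(j-1)]$, $(\Delta_Ng)(j)=N^2[g(j+1)+g(j-1)-2g(j)]$; a function $G:[0,1]\to\mathbb R$ is identified with $g(j)=G(j/N)$. Let $\gamma=\gamma_N$ be defined by $e^{-\gamma/N}=1+E/N$, and let $\lambda_t=\lambda_t^N:\{0,\dots,N-1\}\to\mathbb R$ solve $\partial_t\lambda_t=\Omega\lambda_t$, $\lambda_0(j)=\exp\{-(\gamma/N)\sum_{k=1}^j\rho_0(k/N)\}$, where $(\Omega f)(0)=-\alpha ENf(0)+N(\nabla^+_Nf)(0)$, $(\Omega f)(j)=(\Delta_Nf)(j)-E(\nabla_N^-f)(j)$ for $1\le j\le N-2$, and $(\Omega f)(N-1)=\beta ENf(N-1)-N(1+\frac EN)(\nabla^-_Nf)(N-1)$. Let $W^{j,j+1}_t$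 be the number of particle jumps from $j$ to $j+1$ minus the number of jumps from $j+1$ to $j$ during $[0,t]$ (creations and removals at the boundary being jumps from and to the sites $0$, $N$), and $$\xi_t(j)=\exp\Big\{\frac\gamma N\Big[W_t^{j,j+1}-\sum_{k=1}^j\eta_0(k)\Big]\Big\},\quad 0\le j\le N-1;\qquad r_t(j)=-\frac1\gamma[\nabla_N^-\ln\lambda_t](j),\quad 1\le j\le N-1 .$$ Define the modified density field, the current field and the remainder by $$\tilde Y^N_t(g)=\frac1{\sqrt N}\sum_{j=1}^{N-1}g(j)\{\eta_t(j)-r_t(j)\},\qquad J^N_t(g)=\frac1{\sqrt N}\sum_{j=0}^{N-1}\frac{(\nabla^+_Ng)(j)}{\gamma\lambda_t(j)}(\xi_t(j)-\lambda_t(j)),$$ $$R^N_t(g)=\frac1{\sqrt N}\sum_{j=0}^{N-1}\frac1\gamma(\nabla^+_Ng)(j)\Big[\ln\Big(\frac{\xi_t(j)}{\lambda_t(j)}\Big)+1-\frac{\xi_t(j)}{\lambda_t(j)}\Big].$$ \textbf{Proposition.} Fix $T>0$, and for each $N$ a function $\phi=\phi^N:[0,T]\times\{0,\dots,N\}\to\mathbb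 R$ such that $$\sup_{N\ge 2}\,\sup_{0\le t\le T}\,\max_{0\le j\le N-1}\frac{|(\nabla_N^+\phi^N_t)(j)|}{\lambda^N_t(j)}<\infty .$$ Then, for every $\delta>0$, $$\lim_{N\to\infty}\mathbb P_{\mu_N}\Big[\sup_{0\le t\le T}|R^N_t(\phi^N_t)|>\delta\Big]=0 .$$ If moreover $\phi^N_t(0)=\phi^N_t(N)=0$ for all $N$ and $0\le t\le T$, then for every $\delta>0$ $$\lim_{N\to\infty}\mathbb P_{\mu_N}\Big[\sup_{0\le t\le T}|\tilde Y^N_t(\phi^N_t)-J^N_t(\phi^N_t)|>\delta\Big]=0 .$$ In particular, for every $G\in C^1([0,1])$ with $G(0)=G(1)=0$ and every $\delta>0$, $$\lim_{N\to\infty}\mathbb P_{\mu_N}\Big[\sup_{0\le t\le T}|\tilde Y^N_t(G)-J^N_t(G)|>\delta\Big]=0 .$$ (No measurability of $\phi^N$ in $t$ is required; if an event is not measurable, its probability is understood as outer probability.) -/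

import Mathlib

open Filter Topology MeasureTheory
open scoped NNReal ENNReal

namespace WASEP

noncomputable section

/-! ### Configurations and dynamics -/

/-- The bulk `{1, …, N-1}`. -/
abbrev Site (N : ℕ) : Type := ↥(Finset.Ico 1 N)

/-- The state space `Σ_N = {0,1}^{1, …, N-1}` (`true` means occupied). -/
abbrev Config (N : ℕ) : Type := Site N → Bool

/-- The site `j` belongs to the bulk and is occupied. -/
def Occupied {N : ℕ} (ζ : Config N) (j : ℕ) : Prop :=
  ∃ h : j ∈ Finset.Ico 1 N, ζ ⟨j, h⟩ = true

/-- The site `j` belongs to the bulk and is empty. -/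
def Vacant {N : ℕ} (ζ : Config N) (j : ℕ) : Prop :=
  ∃ h : j ∈ Finset.Ico 1 N, ζ ⟨j, h⟩ = false

/-- The occupation variable `ζ(j) ∈ {0,1}` of a bulk site, as a real number. -/
def particle {N : ℕ} (ζ : Config N) (j : ℕ) : ℝ :=
  if h : j ∈ Finset.Ico 1 N then (if ζ ⟨j, h⟩ = true then 1 else 0) else 0

/-- The occupation variables with the convention `ζ(0) = α`, `ζ(N) = β`. -/
def occ (α β : ℝ) {N : ℕ} (ζ : Config N) (j : ℕ) : ℝ :=
  if j = 0 then α else if j = N then β else particle ζ j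

/-- `σ^j ζ`: flip the occupation variable at `j`. -/
def flipAt {N : ℕ} (j : ℕ) (ζ : Config N) : Config N :=
  fun k => if (k : ℕ) = j then !(ζ k) else ζ k

/-- `σ^{j,j+1} ζ`: exchange the occupation variables at `j` and `j+1` if both are bulk sites;
flip the occupation variable at `1` if `j = 0` and the one at `N-1` if `j = N-1`. -/
def bondMove {N : ℕ} (j : ℕ) (ζ : Config N) : Config N :=
  if h : j ∈ Finset.Ico 1 N ∧ j + 1 ∈ Finset.Ico 1 N then
    fun k => ζ (Equiv.swap (⟨j, h.1⟩ : Site N) ⟨j + 1, h.2⟩ k)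
  else if j = 0 then flipAt 1 ζ else flipAt j ζ

/-- The rate `c_{j,j+1}`. -/
def rate (E α β : ℝ) {N : ℕ} (j : ℕ) (ζ : Config N) : ℝ :=
  (1 + E / N) * occ α β ζ j * (1 - occ α β ζ (j + 1)) + occ α β ζ (j + 1) * (1 - occ α β ζ j)

/-- The generator `𝓛_N`, a linear operator on the finite dimensional space of functions on `Σ_N`. -/
def generator (E α β : ℝ) (N : ℕ) : (Config N → ℝ) →L[ℝ] (Config N → ℝ) :=
  LinearMap.toContinuousLinearMap
    { toFun := fun f ζ =>
        (N : ℝ) ^ 2 * ∑ j ∈ Finset.range N, rate E α β j ζ * (f (bondMove j ζ) - f ζ)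
      map_add' := by
        intro f g
        funext ζ
        simp only [Pi.add_apply, ← mul_add, ← Finset.sum_add_distrib]
        congr 1
        exact Finset.sum_congr rfl fun j _ => by ring
      map_smul' := by
        intro c f
        funext ζ
        simp only [Pi.smul_apply, smul_eq_mul, RingHom.id_apply, Finset.mul_sum]
        exact Finset.sum_congr rfl fun j _ => by ring }

theorem generator_apply (E α β : ℝ) (N : ℕ) (f : Config N → ℝ) (ζ : Config N) :
    generator E α β N f ζ =
      (N : ℝ) ^ 2 * ∑ j ∈ Finset.range N, rate E α β j ζ * (f (bondMove j ζ) - f ζ) := rfl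

/-- The Markov semigroup `e^{t 𝓛_N}`. -/
def semigroup (E α β : ℝ) (N : ℕ) (t : ℝ≥0) : (Config N → ℝ) →L[ℝ] (Config N → ℝ) :=
  NormedSpace.exp ((t : ℝ) • generator E α β N)

/-- `η` is, under `P`, a Markov process (with respect to the filtration `ℱ`) with right-continuous
paths with left limits, with generator `𝓛_N` and with initial distribution `μ`. -/
structure IsExclusionProcess (E α β : ℝ) {N : ℕ} (μ : Measure (Config N))
    {Ω : Type*} {mΩ : MeasurableSpace Ω} (P : Measure Ω) (ℱ : Filtration ℝ≥0 mΩ)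
    (η : ℝ≥0 → Ω → Config N) : Prop where
  adapted : ∀ t, Measurable[ℱ t] (η t)
  right_continuous : ∀ ω t, ContinuousWithinAt (fun s => η s ω) (Set.Ici t) t
  left_limits : ∀ ω t, ∃ ζ, Tendsto (fun s => η s ω) (𝓝[<] t) (𝓝 ζ)
  initial : P.map (η 0) = μ
  markov : ∀ (f : Config N → ℝ) (s t : ℝ≥0), s ≤ t →
    P[fun ω => f (η t ω) | ℱ s] =ᵐ[P] fun ω => semigroup E α β N (t - s) f (η s ω)

/-! ### Currents -/

/-- At time `s` a particle of the trajectory `x` jumps from `j` to `j+1`; for `j = 0` this is the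
creation of a particle at `1`, for `j = N-1` the removal of a particle at `N-1`. -/
def JumpsRight {N : ℕ} (x : ℝ≥0 → Config N) (j : ℕ) (s : ℝ≥0) : Prop :=
  ∃ ζ, Tendsto x (𝓝[<] s) (𝓝 ζ) ∧ x s = bondMove j ζ ∧
    (j = 0 ∨ Occupied ζ j) ∧ (j + 1 = N ∨ Vacant ζ (j + 1))

/-- At time `s` a particle of the trajectory `x` jumps from `j+1` to `j`; for `j = 0` this is the
removal of a particle at `1`, for `j = N-1` the creation of a particle at `N-1`. -/
def JumpsLeft {N : ℕ} (x : ℝ≥0 → Config N) (j : ℕ) (s : ℝ≥0) : Prop :=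
  ∃ ζ, Tendsto x (𝓝[<] s) (𝓝 ζ) ∧ x s = bondMove j ζ ∧
    (j = 0 ∨ Vacant ζ j) ∧ (j + 1 = N ∨ Occupied ζ (j + 1))

/-- The current `W_t^{j,j+1} = J_t^{j,j+1} - J_t^{j+1,j}`: the number of jumps from `j` to `j+1`
minus the number of jumps from `j+1` to `j` in the time interval `[0,t]`. -/
def current {N : ℕ} (x : ℝ≥0 → Config N) (t : ℝ≥0) (j : ℕ) : ℝ :=
  (Set.ncard {s : ℝ≥0 | 0 < s ∧ s ≤ t ∧ JumpsRight x j s} : ℝ)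
    - (Set.ncard {s : ℝ≥0 | 0 < s ∧ s ≤ t ∧ JumpsLeft x j s} : ℝ)

/-! ### Discrete operators -/

/-- `(∇_N^+ g)(j)`. -/
def gradPlus (N : ℕ) (g : ℕ → ℝ) (j : ℕ) : ℝ := N * (g (j + 1) - g j)

/-- `(∇_N^- g)(j)`, for `j ≥ 1`. -/
def gradMinus (N : ℕ) (g : ℕ → ℝ) (j : ℕ) : ℝ := -(N : ℝ) * (g (j - 1) - g j)

/-- `(Δ_N g)(j)`, for `j ≥ 1`. -/
def lap (N : ℕ) (g : ℕ → ℝ) (j : ℕ) : ℝ := (N : ℝ) ^ 2 * (g (j + 1) + g (j - 1) - 2 * g j)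

/-- A function on `Λ_N = {0, …, N-1}`, extended by `0`. -/
def extend {N : ℕ} (f : Fin N → ℝ) (j : ℕ) : ℝ := if h : j < N then f ⟨j, h⟩ else 0

/-- The operator `Ω^N` acting on functions on `Λ_N = {0, …, N-1}`, for `N ≥ 2`. -/
def Omega (E α β : ℝ) (N : ℕ) : (Fin N → ℝ) →L[ℝ] (Fin N → ℝ) :=
  LinearMap.toContinuousLinearMap
    { toFun := fun f j =>
        if (j : ℕ) = 0 then -α * E * N * extend f 0 + N * gradPlus N (extend f) 0
        else if (j : ℕ) + 1 = N then
          β * E * N * extend f (N - 1) - N * (1 + E / N) * gradMinus N (extend f) (N - 1)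
        else lap N (extend f) j - E * gradMinus N (extend f) j
      map_add' := by
        intro f g
        have h : ∀ j, extend (f + g) j = extend f j + extend g j := by
          intro j; unfold extend; split_ifs <;> simp
        funext j
        simp only [Pi.add_apply, gradPlus, gradMinus, lap, h]
        split_ifs <;> ring
      map_smul' := by
        intro c f
        have h : ∀ j, extend (c • f) j = c * extend f j := by
          intro j; unfold extend; split_ifs <;> simp
        funext j
        simp only [Pi.smul_apply, smul_eq_mul, RingHom.id_apply, gradPlus, gradMinus, lap, h]
        split_ifs <;> ring }

/-! ### The Cole-Hopf transformation -/

/-- `γ = γ_N ≤ 0`, the solution of `e^{-γ/N} = 1 + E/N`. -/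
def gam (E : ℝ) (N : ℕ) : ℝ := -(N : ℝ) * Real.log (1 + E / N)

theorem exp_neg_gam {E : ℝ} (hE : 0 < E) {N : ℕ} (hN : 0 < N) :
    Real.exp (-gam E N / N) = 1 + E / N := by
  have hN' : (0 : ℝ) < N := by exact_mod_cast hN
  have h : -gam E N / N = Real.log (1 + E / N) := by
    unfold gam; field_simp
  rw [h, Real.exp_log (by positivity)]

/-- The initial condition `λ_0`. -/
def lamInit (E : ℝ) (ρ₀ : ℝ → ℝ) (N : ℕ) : Fin N → ℝ :=
  fun j => Real.exp (-(gam E N / N) * ∑ k ∈ Finset.Icc 1 (j : ℕ), ρ₀ ((k : ℝ) / N))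

/-- The solution `λ_t` of the linear equation `∂_t λ_t = Ω λ_t` with initial condition `λ_0`. -/
def lamVec (E α β : ℝ) (ρ₀ : ℝ → ℝ) (N : ℕ) (t : ℝ) : Fin N → ℝ :=
  NormedSpace.exp (t • Omega E α β N) (lamInit E ρ₀ N)

theorem lamVec_zero (E α β : ℝ) (ρ₀ : ℝ → ℝ) (N : ℕ) :
    lamVec E α β ρ₀ N 0 = lamInit E ρ₀ N := by
  simp [lamVec]

theorem hasDerivAt_lamVec (E α β : ℝ) (ρ₀ : ℝ → ℝ) (N : ℕ) (t : ℝ) :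
    HasDerivAt (lamVec E α β ρ₀ N) (Omega E α β N (lamVec E α β ρ₀ N t)) t := by
  have h := hasDerivAt_exp_smul_const' (𝕂 := ℝ) (Omega E α β N) t
  have h2 := h.clm_apply (hasDerivAt_const t (lamInit E ρ₀ N))
  rw [map_zero, add_zero] at h2
  exact h2

/-- `λ_t(j)`, for `0 ≤ j ≤ N-1`. -/
def lam (E α β : ℝ) (ρ₀ : ℝ → ℝ) (N : ℕ) (t : ℝ) (j : ℕ) : ℝ :=
  extend (lamVec E α β ρ₀ N t) j

/-- `ξ_t(j)`, for `0 ≤ j ≤ N-1`, as a function of the trajectory `x`. -/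
def xi (E : ℝ) {N : ℕ} (x : ℝ≥0 → Config N) (t : ℝ≥0) (j : ℕ) : ℝ :=
  Real.exp ((gam E N / N) * (current x t j - ∑ k ∈ Finset.Icc 1 j, particle (x 0) k))

/-- `r_t(j)`, for `1 ≤ j ≤ N-1`. -/
def rProfile (E α β : ℝ) (ρ₀ : ℝ → ℝ) (N : ℕ) (t : ℝ) (j : ℕ) : ℝ :=
  -(1 / gam E N) * gradMinus N (fun k => Real.log (lam E α β ρ₀ N t k)) j

/-- The modified density fluctuation field `\tilde Y^N_t(g)`, for `g : {0, …, N} → ℝ`. -/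
def modifiedDensityField (E α β : ℝ) (ρ₀ : ℝ → ℝ) {N : ℕ} (x : ℝ≥0 → Config N) (t : ℝ≥0)
    (g : ℕ → ℝ) : ℝ :=
  1 / √(N : ℝ) * ∑ j ∈ Finset.Ico 1 N, g j * (particle (x t) j - rProfile E α β ρ₀ N t j)

/-- The current fluctuation field `J^N_t(g)`, for `g : {0, …, N} → ℝ`. -/
def currentField (E α β : ℝ) (ρ₀ : ℝ → ℝ) {N : ℕ} (x : ℝ≥0 → Config N) (t : ℝ≥0)
    (g : ℕ → ℝ) : ℝ :=
  1 / √(N : ℝ) * ∑ j ∈ Finset.range N,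
    gradPlus N g j / (gam E N * lam E α β ρ₀ N t j) * (xi E x t j - lam E α β ρ₀ N t j)

/-- The remainder `R^N_t(g)`, for `g : {0, …, N} → ℝ`. -/
def remainder (E α β : ℝ) (ρ₀ : ℝ → ℝ) {N : ℕ} (x : ℝ≥0 → Config N) (t : ℝ≥0)
    (g : ℕ → ℝ) : ℝ :=
  1 / √(N : ℝ) * ∑ j ∈ Finset.range N,
    1 / gam E N * gradPlus N g j *
      (Real.log (xi E x t j / lam E α β ρ₀ N t j) + 1 - xi E x t j / lam E α β ρ₀ N t j)

end

end WASEP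

/-!
# The modified density field and the current field of the WASEP are asymptotically equal

By conservation of particles `ξ_t(j) = exp {(γ/N) (W_t^{0,1} - ∑_{k ≤ j} η_t(k))}`, so the density is
the discrete logarithmic derivative of `ξ`, as `r` is that of `λ`. A summation by parts shows that,
for test functions vanishing at the ends, the density field minus the current field is exactly the
remainder `R` (`density_sub_current_eq_remainder`). The remainder is quadratic in the fluctuation
`Z = ξ - λ` (`abs_remainder_le`): if `|Z| ≤ λ/2`, then `|R| ≤ C √N · N⁻¹ ∑ Z(j)²`. Everything follows
once the mean square of `Z` is shown to be `o(N^{-1/2})`, uniformly in `t ∈ [0,T]`, with probability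
tending to one (`tendsto_measure_not_isClose`). The smallness of `sup |Z|` then comes from a Sobolev
inequality, since `ξ` and `λ` have gradients of the order of their values (`ratioCone`).

**The resolvent form.** The Cole-Hopf transformation linearizes the drift: `dξ = Ω ξ dt + dM`, while
`∂_t λ = Ω λ`, and `Ω` is symmetric for the weights `(1 + E/N)^{-j}` (`innerW_Omega`). The uniform
control in time is obtained for the negative order norm `Φ(Z) = ⟨Z, (κ - Ω)⁻¹ Z⟩`, with `1 ≤ κ ≤ N`.
The drift increases `Φ` at a bounded rate (`IsResolvent.drift_le`). Each jump modifies a single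
coordinate of `ξ` by `O(1/N)`, so the noise contributes a sum of diagonal elements of the resolvent,
which are `O(κ^{-1/2} N⁻²)` by the Sobolev inequality (`IsResolvent.diag_le`). Hence the generator
increases `Φ` at rate at most `C (Φ + κ^{-1/2} N⁻¹)`, with `C` independent of `N` and `κ`
(`IsResolvent.drift_add_noise_le`). In return, `Z` has gradients bounded in mean square by those of
`ξ` and `λ`, so interpolation gives
`N⁻¹ ∑ Z(j)² ≤ C (κ Φ(Z) + 1/κ)` (`IsResolvent.meanSq_le`). At time `0` the moment assumption gives
`E Φ = O(κ⁻¹ N⁻¹)`. For `κ = N^{3/4}` the level `ε/(κ √N)` is much larger than both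
`κ⁻¹ N⁻¹` and `κ^{-1/2} N⁻¹`, and `√N/κ → 0`, so a maximal inequality for `Φ` is enough.

**Time discretization.** No stochastic calculus is needed. Along the grid of mesh `T/n` the pair
formed by the configuration and the current through `{0,1}`, read off from successive
configurations, satisfies a one-step inequality (`IsResolvent.semigroup_form_le`), and the discrete
maximal inequality applies (`measureReal_grid_form_le`). As `n → ∞` with `N` fixed, every càdlàg
trajectory has at most one jump in each cell, the observed currents are the true ones, and a failure
at any time of `[0,T]` is seen on all fine grids (`IsCadlag.eventually_isBadOnGrid`). This gives the
bound in continuous time, for outer probability (`measure_not_isGoodAt_le`).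

**Bounds on `λ`.** The flow of `Ω` preserves a closed convex cone as soon as an explicit Euler step
does (`exp_smul_mem_of_euler`). This yields the gradient bounds for `λ`, and a comparison with
`λ_0`, for which `|Ω λ_0| ≤ C λ_0` because `ρ₀` is Lipschitz and compatible with the boundary
densities, gives `c ≤ λ ≤ C` on `[0,T]` (`lamVec_bounds`).
-/

namespace WASEP

/-! ### The operator `Ω` as a weighted divergence -/

/-- The flux through the bond to the right of `j`, with the Robin condition at the bond
`{N-1, N}`. -/
noncomputable def fluxRight (E β : ℝ) (N : ℕ) (f : ℕ → ℝ) (j : ℕ) : ℝ :=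
  if j + 1 = N then β * (E / N) * f j else f (j + 1) - f j

/-- The flux through the bond to the left of `j`, with the Robin condition at the bond `{0, 1}`. -/
noncomputable def fluxLeft (E α : ℝ) (N : ℕ) (f : ℕ → ℝ) (j : ℕ) : ℝ :=
  if j = 0 then α * (E / N) * f 0 else (1 + E / N) * (f j - f (j - 1))

@[simp] theorem extend_coe {N : ℕ} (f : Fin N → ℝ) (j : Fin N) : extend f j = f j := by
  simp [extend]

theorem sum_fin_eq_sum_range {N : ℕ} (F : ℕ → ℝ → ℝ) (f : Fin N → ℝ) :
    ∑ j : Fin N, F j (f j) = ∑ j ∈ Finset.range N, F j (extend f j) := by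
  rw [Finset.sum_range]
  simp

theorem extend_add {N : ℕ} (f g : Fin N → ℝ) (j : ℕ) :
    extend (f + g) j = extend f j + extend g j := by
  unfold extend; split_ifs <;> simp

theorem extend_sub {N : ℕ} (f g : Fin N → ℝ) (j : ℕ) :
    extend (f - g) j = extend f j - extend g j := by
  unfold extend; split_ifs <;> simp

theorem extend_smul {N : ℕ} (c : ℝ) (f : Fin N → ℝ) (j : ℕ) :
    extend (c • f) j = c * extend f j := by
  unfold extend; split_ifs <;> simp

/-- `Ω` is the divergence of the two fluxes, including at the ends of `Λ_N`, where the terms of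
order `N` in its definition become Robin boundary fluxes. -/
theorem Omega_apply {E α β : ℝ} {N : ℕ} (hN : 2 ≤ N) (f : Fin N → ℝ) (j : Fin N) :
    Omega E α β N f j =
      (N : ℝ) ^ 2 * (fluxRight E β N (extend f) j - fluxLeft E α N (extend f) j) := by
  have hN0 : (N : ℝ) ≠ 0 := by positivity
  have hj := j.2
  change (if (j : ℕ) = 0 then -α * E * N * extend f 0 + N * gradPlus N (extend f) 0
        else if (j : ℕ) + 1 = N then
          β * E * N * extend f (N - 1) - N * (1 + E / N) * gradMinus N (extend f) (N - 1)
        else lap N (extend f) j - E * gradMinus N (extend f) j) = _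
  unfold fluxRight fluxLeft gradPlus gradMinus lap
  by_cases h0 : (j : ℕ) = 0
  · have h1 : ¬ ((j : ℕ) + 1 = N) := by omega
    rw [if_pos h0, if_neg h1, if_pos h0, h0]
    field_simp
    ring
  · by_cases h1 : (j : ℕ) + 1 = N
    · rw [if_neg h0, if_pos h1, if_pos h1, if_neg h0, show N - 1 = (j : ℕ) by omega]
      field_simp
      ring
    · rw [if_neg h0, if_neg h1, if_neg h1, if_neg h0]
      field_simp
      ring

/-- The reversible weight `(1 + E/N)^{-j}` of `Ω`. -/
noncomputable def weight (E : ℝ) (N j : ℕ) : ℝ := ((1 + E / N) ^ j)⁻¹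

/-- The normalized scalar product on functions on `Λ_N` for which `Ω` is symmetric. -/
noncomputable def innerW (E : ℝ) (N : ℕ) (f g : Fin N → ℝ) : ℝ :=
  1 / N * ∑ j : Fin N, weight E N j * f j * g j

/-- The empirical mean of `f²`. -/
noncomputable def meanSq (N : ℕ) (f : Fin N → ℝ) : ℝ := 1 / N * ∑ j : Fin N, f j ^ 2

/-- The Dirichlet energy `N⁻¹ ∑ (∇_N^+ f)²`. -/
noncomputable def energy (N : ℕ) (f : Fin N → ℝ) : ℝ :=
  N * ∑ j ∈ Finset.range (N - 1), (extend f (j + 1) - extend f j) ^ 2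

theorem one_le_ratio {E : ℝ} (hE : 0 < E) (N : ℕ) : 1 ≤ 1 + E / N := by
  have : 0 ≤ E / N := by positivity
  linarith

theorem ratio_pow_le {E : ℝ} (hE : 0 < E) {N j : ℕ} (hj : j ≤ N) :
    (1 + E / N) ^ j ≤ Real.exp E := by
  rcases Nat.eq_zero_or_pos N with rfl | hN
  · have : j = 0 := by omega
    subst this
    simp [hE.le]
  have hN' : (0 : ℝ) < N := by exact_mod_cast hN
  calc (1 + E / N) ^ j ≤ (1 + E / N) ^ N := pow_le_pow_right₀ (one_le_ratio hE N) hj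
    _ ≤ (Real.exp (E / N)) ^ N := by
        gcongr
        linarith [Real.add_one_le_exp (E / N)]
    _ = Real.exp E := by
        rw [← Real.exp_nat_mul]
        congr 1
        field_simp

theorem weight_pos {E : ℝ} (hE : 0 < E) (N j : ℕ) : 0 < weight E N j := by
  have := one_le_ratio hE N
  unfold weight; positivity

theorem weight_le_one {E : ℝ} (hE : 0 < E) (N j : ℕ) : weight E N j ≤ 1 :=
  inv_le_one_of_one_le₀ (one_le_pow₀ (one_le_ratio hE N))

theorem le_weight {E : ℝ} (hE : 0 < E) {N j : ℕ} (hj : j ≤ N) :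
    Real.exp (-E) ≤ weight E N j := by
  rw [Real.exp_neg]
  have := one_le_ratio hE N
  exact inv_anti₀ (by positivity) (ratio_pow_le hE hj)

theorem weight_succ {E : ℝ} (hE : 0 < E) (N j : ℕ) :
    weight E N (j + 1) * (1 + E / N) = weight E N j := by
  have := one_le_ratio hE N
  unfold weight
  rw [pow_succ]
  field_simp

theorem innerW_comm (E : ℝ) {N : ℕ} (f g : Fin N → ℝ) : innerW E N f g = innerW E N g f := by
  unfold innerW
  congr 1
  exact Finset.sum_congr rfl fun j _ => by ring

theorem innerW_add_left (E : ℝ) {N : ℕ} (f f' g : Fin N → ℝ) :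
    innerW E N (f + f') g = innerW E N f g + innerW E N f' g := by
  unfold innerW
  rw [← mul_add, ← Finset.sum_add_distrib]
  congr 1
  exact Finset.sum_congr rfl fun j _ => by simp only [Pi.add_apply]; ring

theorem innerW_smul_left (E : ℝ) {N : ℕ} (c : ℝ) (f g : Fin N → ℝ) :
    innerW E N (c • f) g = c * innerW E N f g := by
  unfold innerW
  rw [mul_left_comm, Finset.mul_sum (a := c)]
  congr 1
  exact Finset.sum_congr rfl fun j _ => by simp only [Pi.smul_apply, smul_eq_mul]; ring

theorem innerW_add_right (E : ℝ) {N : ℕ} (f g g' : Fin N → ℝ) :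
    innerW E N f (g + g') = innerW E N f g + innerW E N f g' := by
  rw [innerW_comm, innerW_add_left, innerW_comm E g, innerW_comm E g']

theorem innerW_smul_right (E : ℝ) {N : ℕ} (c : ℝ) (f g : Fin N → ℝ) :
    innerW E N f (c • g) = c * innerW E N f g := by
  rw [innerW_comm, innerW_smul_left, innerW_comm E g]

theorem innerW_sub_left (E : ℝ) {N : ℕ} (f f' g : Fin N → ℝ) :
    innerW E N (f - f') g = innerW E N f g - innerW E N f' g := by
  have := innerW_add_left E f ((-1 : ℝ) • f') g
  rw [innerW_smul_left] at this
  rw [sub_eq_add_neg f f', ← neg_one_smul ℝ f', this]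
  ring

theorem innerW_sub_right (E : ℝ) {N : ℕ} (f g g' : Fin N → ℝ) :
    innerW E N f (g - g') = innerW E N f g - innerW E N f g' := by
  rw [innerW_comm, innerW_sub_left, innerW_comm E g, innerW_comm E g']

theorem innerW_single_left (E : ℝ) {N : ℕ} (j : Fin N) (c : ℝ) (g : Fin N → ℝ) :
    innerW E N (Pi.single j c) g = 1 / N * (weight E N j * c * g j) := by
  unfold innerW
  rw [Finset.sum_eq_single j]
  · simp
  · intro k _ hk
    simp [Pi.single_eq_of_ne hk]
  · simp

theorem innerW_self_le {E : ℝ} (hE : 0 < E) {N : ℕ} (f : Fin N → ℝ) :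
    innerW E N f f ≤ meanSq N f := by
  unfold innerW meanSq
  gcongr with j
  nlinarith [weight_le_one hE N j, sq_nonneg (f j)]

theorem le_innerW_self {E : ℝ} (hE : 0 < E) {N : ℕ} (f : Fin N → ℝ) :
    Real.exp (-E) * meanSq N f ≤ innerW E N f f := by
  unfold innerW meanSq
  rw [mul_left_comm, Finset.mul_sum]
  refine mul_le_mul_of_nonneg_left (Finset.sum_le_sum fun j _ => ?_) (by positivity)
  rw [mul_assoc, ← sq]
  exact mul_le_mul_of_nonneg_right (le_weight hE j.2.le) (sq_nonneg _)

theorem meanSq_nonneg {N : ℕ} (f : Fin N → ℝ) : 0 ≤ meanSq N f := by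
  unfold meanSq; positivity

theorem energy_nonneg {N : ℕ} (f : Fin N → ℝ) : 0 ≤ energy N f := by
  unfold energy; positivity

theorem innerW_self_nonneg {E : ℝ} (hE : 0 < E) {N : ℕ} (f : Fin N → ℝ) :
    0 ≤ innerW E N f f :=
  le_trans (mul_nonneg (Real.exp_pos _).le (meanSq_nonneg f)) (le_innerW_self hE f)

/-- Summation by parts: the bilinear form of `Ω` is a weighted Dirichlet form plus boundary terms,
in particular it is symmetric. -/
theorem innerW_Omega {E α β : ℝ} (hE : 0 < E) {N : ℕ} (hN : 2 ≤ N) (f g : Fin N → ℝ) :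
    innerW E N g (Omega E α β N f) =
      -(N * ∑ j ∈ Finset.range (N - 1), weight E N j * (extend f (j + 1) - extend f j) *
          (extend g (j + 1) - extend g j))
      + β * E * weight E N (N - 1) * extend f (N - 1) * extend g (N - 1)
      - α * E * extend f 0 * extend g 0 := by
  have hN0 : (N : ℝ) ≠ 0 := by positivity
  have h1 : innerW E N g (Omega E α β N f) = N * ∑ j ∈ Finset.range N,
      (weight E N j * extend g j * fluxRight E β N (extend f) j
        - weight E N j * extend g j * fluxLeft E α N (extend f) j) := by
    unfold innerW
    rw [Finset.sum_range, Finset.mul_sum, Finset.mul_sum]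
    refine Finset.sum_congr rfl fun j _ => ?_
    rw [Omega_apply hN, extend_coe]
    field_simp
  rw [h1, Finset.sum_sub_distrib]
  obtain ⟨m, rfl⟩ : ∃ m, N = m + 1 := ⟨N - 1, by omega⟩
  rw [Finset.sum_range_succ, Finset.sum_range_succ' (fun j => weight E (m + 1) j * extend g j *
    fluxLeft E α (m + 1) (extend f) j)]
  have hR : ∀ j ∈ Finset.range m, weight E (m + 1) j * extend g j *
      fluxRight E β (m + 1) (extend f) j =
      weight E (m + 1) j * extend g j * (extend f (j + 1) - extend f j) := by
    intro j hj
    have : j + 1 ≠ m + 1 := by have := Finset.mem_range.1 hj; omega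
    rw [fluxRight, if_neg this]
  -- the weight absorbs the factor `1 + E/N` of the left flux, which makes the form symmetric
  have hL : ∀ j ∈ Finset.range m, weight E (m + 1) (j + 1) * extend g (j + 1) *
      fluxLeft E α (m + 1) (extend f) (j + 1) =
      weight E (m + 1) j * extend g (j + 1) * (extend f (j + 1) - extend f j) := by
    intro j hj
    rw [fluxLeft, if_neg (by omega), Nat.add_sub_cancel, ← weight_succ hE (m + 1) j]
    ring
  rw [Finset.sum_congr rfl hR, Finset.sum_congr rfl hL]
  have e1 : fluxRight E β (m + 1) (extend f) m = β * (E / (m + 1 : ℕ)) * extend f m := by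
    simp [fluxRight]
  have e2 : fluxLeft E α (m + 1) (extend f) 0 = α * (E / (m + 1 : ℕ)) * extend f 0 := by
    simp [fluxLeft]
  have e3 : weight E (m + 1) 0 = 1 := by simp [weight]
  rw [e1, e2, e3, Nat.add_sub_cancel]
  have e4 : ∑ j ∈ Finset.range m, weight E (m + 1) j * (extend f (j + 1) - extend f j) *
          (extend g (j + 1) - extend g j) =
        ∑ j ∈ Finset.range m, weight E (m + 1) j * extend g (j + 1) *
          (extend f (j + 1) - extend f j)
        - ∑ j ∈ Finset.range m, weight E (m + 1) j * extend g j *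
          (extend f (j + 1) - extend f j) := by
    rw [← Finset.sum_sub_distrib]
    exact Finset.sum_congr rfl fun j _ => by ring
  rw [e4]
  have : ((m + 1 : ℕ) : ℝ) * (E / (m + 1 : ℕ)) = E := by field_simp
  linear_combination (β * weight E (m + 1) m * extend f m * extend g m
    - α * extend f 0 * extend g 0) * this

theorem innerW_Omega_comm {E α β : ℝ} (hE : 0 < E) {N : ℕ} (hN : 2 ≤ N) (f g : Fin N → ℝ) :
    innerW E N g (Omega E α β N f) = innerW E N (Omega E α β N g) f := by
  rw [innerW_comm E (Omega E α β N g), innerW_Omega hE hN, innerW_Omega hE hN]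
  have : ∀ j, weight E N j * (extend f (j + 1) - extend f j) * (extend g (j + 1) - extend g j) =
    weight E N j * (extend g (j + 1) - extend g j) * (extend f (j + 1) - extend f j) :=
    fun j => by ring
  simp only [this]
  ring

/-! ### A Sobolev inequality and the coercivity of the resolvent -/

theorem sq_sub_sq_le_sum_abs (f : ℕ → ℝ) {m j k : ℕ} (hj : j ≤ m) (hk : k ≤ m) :
    f j ^ 2 - f k ^ 2 ≤ ∑ i ∈ Finset.range m, |f (i + 1) ^ 2 - f i ^ 2| := by
  rcases le_total k j with h | h
  · rw [← Finset.sum_Ico_sub (fun i => f i ^ 2) h]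
    refine (Finset.sum_le_sum fun i _ => le_abs_self _).trans ?_
    refine Finset.sum_le_sum_of_subset_of_nonneg ?_ fun _ _ _ => abs_nonneg _
    intro i hi
    have := Finset.mem_Ico.1 hi
    exact Finset.mem_range.2 (by omega)
  · rw [← neg_sub, ← Finset.sum_Ico_sub (fun i => f i ^ 2) h, ← Finset.sum_neg_distrib]
    refine (Finset.sum_le_sum fun i _ => neg_le_abs _).trans ?_
    refine Finset.sum_le_sum_of_subset_of_nonneg ?_ fun _ _ _ => abs_nonneg _
    intro i hi
    have := Finset.mem_Ico.1 hi
    exact Finset.mem_range.2 (by omega)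

/-- Sobolev inequality in dimension one: `f²` varies by at most `∑ |∇ f²|`, so its value at `j` is
compared with its mean. -/
theorem sq_le_sobolev {N : ℕ} (hN : 1 ≤ N) (f : Fin N → ℝ) {s : ℝ} (hs : 0 < s) {j : ℕ}
    (hj : j < N) : extend f j ^ 2 ≤ (1 + s) * meanSq N f + energy N f / s := by
  obtain ⟨m, rfl⟩ : ∃ m, N = m + 1 := ⟨N - 1, by omega⟩
  set M : ℝ := ((m + 1 : ℕ) : ℝ) with hM
  have hM0 : 0 < M := by positivity
  have hms : meanSq (m + 1) f = 1 / M * ∑ k ∈ Finset.range (m + 1), extend f k ^ 2 := by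
    unfold meanSq
    rw [sum_fin_eq_sum_range (fun _ x => x ^ 2)]
  set S := ∑ k ∈ Finset.range (m + 1), extend f k ^ 2 with hS
  have hgrad : ∑ i ∈ Finset.range m, |extend f (i + 1) ^ 2 - extend f i ^ 2|
      ≤ s * meanSq (m + 1) f + energy (m + 1) f / s := by
    -- `|a² - b²| ≤ (M/s) (a - b)² + (s/4M) (a + b)²` by completing the square
    have hpt : ∀ i ∈ Finset.range m, |extend f (i + 1) ^ 2 - extend f i ^ 2| ≤
        (M / s) * (extend f (i + 1) - extend f i) ^ 2
          + (s / (2 * M)) * extend f (i + 1) ^ 2 + (s / (2 * M)) * extend f i ^ 2 := by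
      intro i _
      generalize extend f (i + 1) = a
      generalize extend f i = b
      have e1 : (2 * M * (a - b) + s * (a + b)) ^ 2 / (4 * s * M) =
          M / s * (a - b) ^ 2 + s / (4 * M) * (a + b) ^ 2 + (a ^ 2 - b ^ 2) := by
        field_simp; ring
      have e2 : (2 * M * (a - b) - s * (a + b)) ^ 2 / (4 * s * M) =
          M / s * (a - b) ^ 2 + s / (4 * M) * (a + b) ^ 2 - (a ^ 2 - b ^ 2) := by
        field_simp; ring
      have e3 : s / (4 * M) * (a + b) ^ 2 + s / (4 * M) * (a - b) ^ 2 =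
          s / (2 * M) * a ^ 2 + s / (2 * M) * b ^ 2 := by
        field_simp; ring
      have p1 : 0 ≤ (2 * M * (a - b) + s * (a + b)) ^ 2 / (4 * s * M) := by positivity
      have p2 : 0 ≤ (2 * M * (a - b) - s * (a + b)) ^ 2 / (4 * s * M) := by positivity
      have p3 : 0 ≤ s / (4 * M) * (a - b) ^ 2 := by positivity
      rw [abs_le]
      constructor <;> linarith
    refine (Finset.sum_le_sum hpt).trans ?_
    rw [Finset.sum_add_distrib, Finset.sum_add_distrib, ← Finset.mul_sum, ← Finset.mul_sum,
      ← Finset.mul_sum]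
    have s1 : ∑ i ∈ Finset.range m, extend f (i + 1) ^ 2 ≤ S := by
      rw [hS, Finset.sum_range_succ']
      nlinarith [sq_nonneg (extend f 0)]
    have s2 : ∑ i ∈ Finset.range m, extend f i ^ 2 ≤ S := by
      rw [hS, Finset.sum_range_succ]
      nlinarith [sq_nonneg (extend f m)]
    have e1 : energy (m + 1) f / s =
        M / s * ∑ i ∈ Finset.range m, (extend f (i + 1) - extend f i) ^ 2 := by
      unfold energy
      rw [Nat.add_sub_cancel]
      ring
    have e2 : s * meanSq (m + 1) f = s / (2 * M) * S + s / (2 * M) * S := by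
      rw [hms]; field_simp; ring
    rw [e1, e2]
    have c0 : 0 ≤ s / (2 * M) := by positivity
    nlinarith [mul_le_mul_of_nonneg_left s1 c0, mul_le_mul_of_nonneg_left s2 c0]
  -- average over `k`
  have hall : ∀ k ∈ Finset.range (m + 1), extend f j ^ 2 ≤ extend f k ^ 2 +
      (s * meanSq (m + 1) f + energy (m + 1) f / s) := by
    intro k hk
    have := sq_sub_sq_le_sum_abs (extend f) (m := m) (j := j) (k := k) (by omega)
      (by have := Finset.mem_range.1 hk; omega)
    linarith
  have hsum := Finset.sum_le_sum hall
  rw [Finset.sum_add_distrib, Finset.sum_const, Finset.sum_const, Finset.card_range,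
    nsmul_eq_mul, nsmul_eq_mul, ← hM, ← hS] at hsum
  have : S = M * meanSq (m + 1) f := by rw [hms]; field_simp
  rw [this, ← mul_add] at hsum
  have := le_of_mul_le_mul_left hsum hM0
  linarith

/-- The growth constant of `Ω` in the weighted `L²` norm; its value comes from the choice
`s = 2 E e^E` in the Sobolev inequality. -/
noncomputable def growth (E : ℝ) : ℝ := Real.exp E * (E * (1 + 2 * E * Real.exp E))

theorem growth_pos {E : ℝ} (hE : 0 < E) : 0 < growth E := by
  unfold growth; positivity

/-- The only positive term of the form of `Ω` is the boundary term at `N-1`; the Sobolev inequality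
absorbs it into half of the Dirichlet form. -/
theorem innerW_Omega_self_le {E α β : ℝ} (hE : 0 < E) (hα : 0 < α) (hβ : β < 1) {N : ℕ}
    (hN : 2 ≤ N) (f : Fin N → ℝ) :
    innerW E N f (Omega E α β N f) ≤
      growth E * innerW E N f f - Real.exp (-E) / 2 * energy N f := by
  rw [innerW_Omega hE hN]
  have h1 : Real.exp (-E) * energy N f ≤ N * ∑ j ∈ Finset.range (N - 1), weight E N j *
      (extend f (j + 1) - extend f j) * (extend f (j + 1) - extend f j) := by
    unfold energy
    rw [mul_left_comm, Finset.mul_sum]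
    refine mul_le_mul_of_nonneg_left (Finset.sum_le_sum fun j hj => ?_) (by positivity)
    have := le_weight hE (N := N) (j := j) (by have := Finset.mem_range.1 hj; omega)
    rw [mul_assoc, ← sq]
    exact mul_le_mul_of_nonneg_right this (sq_nonneg _)
  have h2 := sq_le_sobolev (by omega) f (s := 2 * E * Real.exp E) (by positivity)
    (show N - 1 < N by omega)
  have h3 : β * E * weight E N (N - 1) * extend f (N - 1) * extend f (N - 1) ≤
      E * extend f (N - 1) ^ 2 := by
    have hw := weight_pos hE N (N - 1)
    have hw1 := weight_le_one hE N (N - 1)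
    have : β * weight E N (N - 1) ≤ 1 := by nlinarith
    nlinarith [mul_nonneg hE.le (sq_nonneg (extend f (N - 1)))]
  have h4 : 0 ≤ α * E * extend f 0 * extend f 0 := by
    have : 0 ≤ α * E * (extend f 0) ^ 2 := by positivity
    nlinarith
  have h5 := le_innerW_self hE f
  have h6 : E * (energy N f / (2 * E * Real.exp E)) = Real.exp (-E) / 2 * energy N f := by
    rw [Real.exp_neg]; field_simp
  have h7 : E * ((1 + 2 * E * Real.exp E) * meanSq N f) ≤ growth E * innerW E N f f := by
    have : growth E * (Real.exp (-E) * meanSq N f)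
        = E * ((1 + 2 * E * Real.exp E) * meanSq N f) := by
      unfold growth; rw [Real.exp_neg]; field_simp
    rw [← this]
    exact mul_le_mul_of_nonneg_left h5 (growth_pos hE).le
  nlinarith [mul_le_mul_of_nonneg_left h2 hE.le]

theorem neg_innerW_Omega_self_le {E α β : ℝ} (hE : 0 < E) (hα : α < 1) (hβ : 0 < β)
    {N : ℕ} (hN : 2 ≤ N) (f : Fin N → ℝ) :
    -innerW E N f (Omega E α β N f) ≤ (1 + E) * energy N f + 2 * E * meanSq N f := by
  rw [innerW_Omega hE hN]
  have h1 : N * ∑ j ∈ Finset.range (N - 1), weight E N j *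
      (extend f (j + 1) - extend f j) * (extend f (j + 1) - extend f j) ≤ energy N f := by
    unfold energy
    gcongr with j hj
    nlinarith [sq_nonneg (extend f (j + 1) - extend f j), weight_le_one hE N j]
  have h2 := sq_le_sobolev (by omega) f one_pos (show 0 < N by omega)
  have h3 : 0 ≤ β * E * weight E N (N - 1) * extend f (N - 1) * extend f (N - 1) := by
    have hw := weight_pos hE N (N - 1)
    have : 0 ≤ β * E * weight E N (N - 1) * (extend f (N - 1)) ^ 2 := by positivity
    nlinarith
  have h4 : α * E * extend f 0 * extend f 0 ≤ E * extend f 0 ^ 2 := by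
    nlinarith [mul_nonneg hE.le (sq_nonneg (extend f 0))]
  nlinarith [mul_le_mul_of_nonneg_left h2 hE.le]

/-- `G` is the resolvent `(κ - Ω)⁻¹`. -/
def IsResolvent (E α β : ℝ) (N : ℕ) (κ : ℝ) (G : (Fin N → ℝ) →L[ℝ] (Fin N → ℝ)) : Prop :=
  ∀ f, κ • G f - Omega E α β N (G f) = f

section Resolvent

variable {E α β κ : ℝ} {N : ℕ} {G : (Fin N → ℝ) →L[ℝ] (Fin N → ℝ)}

theorem coercive (hE : 0 < E) (hα : 0 < α) (hβ : β < 1) (hN : 2 ≤ N)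
    (hκ : 2 * growth E ≤ κ) (f : Fin N → ℝ) :
    κ / 2 * innerW E N f f + Real.exp (-E) / 2 * energy N f ≤
      innerW E N f (κ • f - Omega E α β N f) := by
  rw [innerW_sub_right, innerW_smul_right]
  nlinarith [innerW_Omega_self_le hE hα hβ hN f, innerW_self_nonneg hE f]

/-- Coercivity makes `κ - Ω` injective, hence invertible in finite dimension. -/
theorem exists_resolvent (hE : 0 < E) (hα : 0 < α) (hβ : β < 1) (hN : 2 ≤ N)
    (hκ : 2 * growth E ≤ κ) : ∃ G, IsResolvent E α β N κ G := by
  let A : (Fin N → ℝ) →ₗ[ℝ] (Fin N → ℝ) := κ • LinearMap.id - (Omega E α β N).toLinearMap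
  have hA : ∀ f, A f = κ • f - Omega E α β N f := fun f => rfl
  have hinj : Function.Injective A := by
    rw [injective_iff_map_eq_zero]
    intro f hf
    have h := coercive hE hα hβ hN hκ f
    rw [← hA, hf] at h
    have h0 : innerW E N f 0 = 0 := by simp [innerW]
    have hκ0 : 0 < κ := by linarith [growth_pos hE]
    have h1 := energy_nonneg f
    have h2 := le_innerW_self hE f
    have h3 := Real.exp_pos (-E)
    have h4 : meanSq N f ≤ 0 := by
      rw [h0] at h
      by_contra hc
      push Not at hc
      have : 0 < innerW E N f f := lt_of_lt_of_le (by positivity) h2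
      have : 0 < κ / 2 * innerW E N f f + Real.exp (-E) / 2 * energy N f := by positivity
      linarith
    have hN' : (0 : ℝ) < N := by positivity
    have h5 : ∑ j : Fin N, f j ^ 2 ≤ 0 := by
      by_contra hc
      push Not at hc
      have : 0 < meanSq N f := by unfold meanSq; positivity
      linarith
    have h6 := (Finset.sum_eq_zero_iff_of_nonneg (fun j _ => sq_nonneg (f j))).1
      (le_antisymm h5 (Finset.sum_nonneg fun j _ => sq_nonneg (f j)))
    funext j
    have := h6 j (Finset.mem_univ j)
    simpa using this
  let e := LinearEquiv.ofInjectiveEndo A hinj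
  refine ⟨LinearMap.toContinuousLinearMap e.symm.toLinearMap, fun f => ?_⟩
  have : A (e.symm f) = f := e.apply_symm_apply f
  rw [hA] at this
  exact this

theorem IsResolvent.innerW_comm (hG : IsResolvent E α β N κ G) (hE : 0 < E) (hN : 2 ≤ N)
    (f g : Fin N → ℝ) : innerW E N f (G g) = innerW E N g (G f) := by
  conv_lhs => rw [← hG f]
  conv_rhs => rw [← hG g]
  rw [innerW_sub_left, innerW_sub_left, innerW_smul_left, innerW_smul_left,
    ← innerW_Omega_comm hE hN, WASEP.innerW_comm E (G f) (G g),
    WASEP.innerW_comm E (G f) (Omega E α β N (G g))]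

theorem IsResolvent.coercive (hG : IsResolvent E α β N κ G) (hE : 0 < E) (hα : 0 < α)
    (hβ : β < 1) (hN : 2 ≤ N) (hκ : 2 * growth E ≤ κ) (f : Fin N → ℝ) :
    κ / 2 * innerW E N (G f) (G f) + Real.exp (-E) / 2 * energy N (G f) ≤
      innerW E N f (G f) := by
  have := WASEP.coercive hE hα hβ hN hκ (G f)
  rwa [hG f, WASEP.innerW_comm E (G f) f] at this

theorem IsResolvent.nonneg (hG : IsResolvent E α β N κ G) (hE : 0 < E) (hα : 0 < α)
    (hβ : β < 1) (hN : 2 ≤ N) (hκ : 2 * growth E ≤ κ) (f : Fin N → ℝ) :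
    0 ≤ innerW E N f (G f) := by
  have hκ0 : 0 < κ := by linarith [growth_pos hE]
  have h1 := energy_nonneg (G f)
  have h2 := innerW_self_nonneg hE (G f)
  exact le_trans (by positivity) (hG.coercive hE hα hβ hN hκ f)

/-- The deterministic part of the evolution increases the resolvent form at most exponentially,
with a rate which does not depend on `N` and `κ`. -/
theorem IsResolvent.drift_le (hG : IsResolvent E α β N κ G) (hE : 0 < E) (hα : 0 < α)
    (hβ : β < 1) (hN : 2 ≤ N) (hκ : 2 * growth E ≤ κ) (f : Fin N → ℝ) :
    innerW E N (Omega E α β N f) (G f) ≤ 2 * growth E * innerW E N f (G f) := by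
  have hκ0 : 0 < κ := by linarith [growth_pos hE]
  have h1 : innerW E N (Omega E α β N f) (G f) = κ * innerW E N (G f) (Omega E α β N (G f))
      - innerW E N (Omega E α β N (G f)) (Omega E α β N (G f)) := by
    rw [← innerW_Omega_comm hE hN, ← innerW_smul_left, ← innerW_sub_left, hG f]
  have h2 := innerW_self_nonneg hE (Omega E α β N (G f))
  have h3 := innerW_Omega_self_le hE hα hβ hN (G f)
  have h4 := hG.coercive hE hα hβ hN hκ f
  have h5 := energy_nonneg (G f)
  have h6 := Real.exp_pos (-E)
  have h7 : 0 ≤ Real.exp (-E) / 2 * energy N (G f) := by positivity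
  have h8 : innerW E N (G f) (Omega E α β N (G f)) ≤ growth E * innerW E N (G f) (G f) := by
    linarith
  have h9 := mul_le_mul_of_nonneg_left h8 hκ0.le
  have h10 : κ / 2 * innerW E N (G f) (G f) ≤ innerW E N f (G f) := by linarith
  nlinarith [mul_le_mul_of_nonneg_left h10 (growth_pos hE).le]

/-- The diagonal of the resolvent kernel is of order `κ^{-1/2}`. This regularization, which is
specific to dimension one, makes the noise small in the resolvent form. -/
theorem IsResolvent.diag_le (hG : IsResolvent E α β N κ G) (hE : 0 < E) (hα : 0 < α)
    (hβ : β < 1) (hN : 2 ≤ N) (hκ : 2 * growth E ≤ κ) (hκ1 : 1 ≤ κ) (j : Fin N) (c : ℝ) :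
    innerW E N (Pi.single j c) (G (Pi.single j c)) ≤
      4 * Real.exp E / (√κ * N ^ 2) * c ^ 2 := by
  have hscale : innerW E N (Pi.single j c) (G (Pi.single j c)) =
      c ^ 2 * innerW E N (Pi.single j 1) (G (Pi.single j 1)) := by
    have : (Pi.single j c : Fin N → ℝ) = c • Pi.single j 1 := by
      rw [← Pi.single_smul, smul_eq_mul, mul_one]
    rw [this, map_smul, innerW_smul_left, innerW_smul_right]
    ring
  rw [hscale, mul_comm]
  refine mul_le_mul_of_nonneg_right ?_ (sq_nonneg c)
  set y := G (Pi.single j 1) with hy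
  have hsqrt : 0 < √κ := Real.sqrt_pos.2 (by linarith)
  have hs1 : 1 ≤ √κ := Real.one_le_sqrt.2 hκ1
  have hsq : √κ * √κ = κ := Real.mul_self_sqrt (by linarith)
  have hN' : (0 : ℝ) < N := by positivity
  have h1 := hG.coercive hE hα hβ hN hκ (Pi.single j 1)
  rw [← hy] at h1
  have h2 := sq_le_sobolev (by omega) y hsqrt j.2
  rw [extend_coe] at h2
  have h3 := le_innerW_self hE y
  have h4 := innerW_single_left E j 1 y
  rw [mul_one] at h4
  set a := innerW E N (Pi.single j 1) y with ha
  have ha0 : 0 ≤ a := hG.nonneg hE hα hβ hN hκ _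
  have hw := weight_pos hE N j
  have hw1 := weight_le_one hE N j
  have hx : 0 < Real.exp (-E) := Real.exp_pos _
  have hm := meanSq_nonneg y
  have he := energy_nonneg y
  -- `√κ y_j²` is dominated by the resolvent form, which is proportional to `y_j`
  have h5 : √κ * (Real.exp (-E) * y j ^ 2) ≤ 4 * a := by
    have e1 : √κ * (energy N y / √κ) = energy N y := by field_simp
    have e2 : √κ * y j ^ 2 ≤ 2 * κ * meanSq N y + energy N y := by
      calc √κ * y j ^ 2 ≤ √κ * ((1 + √κ) * meanSq N y + energy N y / √κ) := by gcongr
        _ = (√κ + κ) * meanSq N y + energy N y := by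
            linear_combination e1 + meanSq N y * hsq
        _ ≤ 2 * κ * meanSq N y + energy N y := by
            have : √κ ≤ κ := by nlinarith
            nlinarith
    have h6 : κ * (Real.exp (-E) * meanSq N y) ≤ κ * innerW E N y y := by gcongr
    nlinarith [mul_le_mul_of_nonneg_left e2 hx.le, mul_nonneg hx.le he]
  -- `a = N⁻¹ π_j y_j` with `π_j ≤ 1`
  have h6 : a ^ 2 * N ^ 2 ≤ y j ^ 2 := by
    rw [h4]
    have : (1 / N * (weight E N j * y j)) ^ 2 * (N : ℝ) ^ 2 = (weight E N j) ^ 2 * y j ^ 2 := by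
      field_simp
    rw [this]
    have : weight E N j ^ 2 ≤ 1 := by nlinarith
    nlinarith [sq_nonneg (y j)]
  have h7 : √κ * Real.exp (-E) * (a ^ 2 * N ^ 2) ≤ 4 * a := by
    refine le_trans ?_ h5
    rw [mul_assoc]
    gcongr
  rw [le_div_iff₀ (by positivity)]
  rcases ha0.eq_or_lt with h0 | hpos
  · rw [← h0, zero_mul]; positivity
  · have h8 : √κ * Real.exp (-E) * (a * N ^ 2) ≤ 4 := by
      refine le_of_mul_le_mul_right ?_ hpos
      nlinarith
    have h9 : Real.exp E * Real.exp (-E) = 1 := by rw [← Real.exp_add]; simp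
    calc a * (√κ * N ^ 2) = Real.exp E * (√κ * Real.exp (-E) * (a * N ^ 2)) := by
          linear_combination (- a * √κ * N ^ 2) * h9
      _ ≤ Real.exp E * 4 := by gcongr
      _ = 4 * Real.exp E := by ring

theorem IsResolvent.form_le (hG : IsResolvent E α β N κ G) (hE : 0 < E) (hα : 0 < α)
    (hβ : β < 1) (hN : 2 ≤ N) (hκ : 2 * growth E ≤ κ) (f : Fin N → ℝ) :
    innerW E N f (G f) ≤ 2 / κ * innerW E N f f := by
  have hκ0 : 0 < κ := by linarith [growth_pos hE]
  have h1 := hG.coercive hE hα hβ hN hκ f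
  -- expand `0 ≤ ‖f - (κ/2) G f‖²` and use coercivity
  have h2 := innerW_self_nonneg hE (f - (κ / 2) • G f)
  rw [innerW_sub_left, innerW_sub_right, innerW_sub_right, innerW_smul_left, innerW_smul_left,
    innerW_smul_right, innerW_smul_right, WASEP.innerW_comm E (G f) f] at h2
  have h3 : 0 ≤ Real.exp (-E) / 2 * energy N (G f) :=
    mul_nonneg (by positivity) (energy_nonneg _)
  have h4 : κ / 2 * innerW E N (G f) (G f) ≤ innerW E N f (G f) := by linarith
  have h5 := mul_le_mul_of_nonneg_left h4 (show 0 ≤ κ / 2 by positivity)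
  have h6 : κ / 2 * innerW E N f (G f) ≤ innerW E N f f := by nlinarith
  calc innerW E N f (G f) = 2 / κ * (κ / 2 * innerW E N f (G f)) := by field_simp
    _ ≤ _ := by gcongr

/-- Interpolation: the `L²` norm is controlled by the resolvent form and the form of `-Ω`. This is
the positivity of `κ - Ω` at `f - κ G f`. -/
theorem IsResolvent.interpolation (hG : IsResolvent E α β N κ G) (hE : 0 < E) (hα : 0 < α)
    (hβ : β < 1) (hN : 2 ≤ N) (hκ : 2 * growth E ≤ κ) (f : Fin N → ℝ) :
    innerW E N f f ≤
      κ * innerW E N f (G f) + 1 / κ * -innerW E N f (Omega E α β N f) := by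
  have hκ0 : 0 < κ := by linarith [growth_pos hE]
  have h0 : 0 ≤ innerW E N (f - κ • G f) (κ • (f - κ • G f) - Omega E α β N (f - κ • G f)) := by
    refine le_trans ?_ (WASEP.coercive hE hα hβ hN hκ _)
    have := innerW_self_nonneg hE (f - κ • G f)
    have := energy_nonneg (f - κ • G f)
    positivity
  -- since `(κ - Ω) G f = f`
  have h1 : κ • (f - κ • G f) - Omega E α β N (f - κ • G f) = - Omega E α β N f := by
    have h := hG f
    have h2 : Omega E α β N (G f) = κ • G f - f := by
      rw [sub_eq_iff_eq_add] at h
      exact eq_sub_of_add_eq' h.symm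
    rw [map_sub, map_smul, h2, smul_sub, smul_sub]
    abel
  have h2 : innerW E N (κ • G f) (Omega E α β N f) =
      κ * (κ * innerW E N f (G f) - innerW E N f f) := by
    rw [innerW_smul_left, innerW_Omega_comm hE hN]
    have h : Omega E α β N (G f) = κ • G f - f := by
      have h := hG f
      rw [sub_eq_iff_eq_add] at h
      exact eq_sub_of_add_eq' h.symm
    rw [h, innerW_sub_left, innerW_smul_left, WASEP.innerW_comm E (G f) f]
  rw [h1, ← neg_one_smul ℝ, innerW_smul_right, innerW_sub_left, h2] at h0
  have : κ * innerW E N f f ≤ κ * (κ * innerW E N f (G f) +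
      1 / κ * -innerW E N f (Omega E α β N f)) := by
    have e : κ * (1 / κ * -innerW E N f (Omega E α β N f)) = -innerW E N f (Omega E α β N f) := by
      field_simp
    rw [mul_add, e]
    linarith
  exact le_of_mul_le_mul_left this hκ0

end Resolvent

/-! ### Exponentials of operators -/

/-- A closed convex cone which is preserved by one explicit Euler step of `x' = A x` is preserved
by the flow: `exp (t A) = e^{-t/h} ∑ (t/h)^n / n! (1 + h A)^n`. -/
theorem exp_smul_mem_of_euler {V : Type*} [NormedAddCommGroup V] [NormedSpace ℝ V]
    [CompleteSpace V] (A : V →L[ℝ] V) (K : Set V) (hclosed : IsClosed K) (hzero : (0 : V) ∈ K)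
    (hadd : ∀ f ∈ K, ∀ g ∈ K, f + g ∈ K) (hsmul : ∀ c : ℝ, 0 ≤ c → ∀ f ∈ K, c • f ∈ K)
    {h : ℝ} (hh : 0 < h) (hK : ∀ f ∈ K, f + h • A f ∈ K) {t : ℝ} (ht : 0 ≤ t) {f : V}
    (hf : f ∈ K) : NormedSpace.exp (t • A) f ∈ K := by
  set B : V →L[ℝ] V := 1 + h • A with hB
  have hpow : ∀ n : ℕ, (B ^ n) f ∈ K := by
    intro n
    induction n with
    | zero => simpa using hf
    | succ n ih =>
      rw [pow_succ', mul_apply_eq_comp]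
      have := hK _ ih
      simpa [hB] using this
  have hsum := (NormedSpace.exp_series_hasSum_exp' (𝕂 := ℝ) ((t / h) • B)).mapL
    (ContinuousLinearMap.apply ℝ V f)
  have hmem : NormedSpace.exp ((t / h) • B) f ∈ K := by
    refine hclosed.mem_of_tendsto hsum (Eventually.of_forall fun s => ?_)
    refine Finset.sum_induction _ (· ∈ K) (fun a b ha hb => hadd a ha b hb) hzero fun n _ => ?_
    simp only [ContinuousLinearMap.apply_apply, _root_.smul_apply, smul_pow]
    exact hsmul _ (by positivity) _ (hsmul _ (by positivity) _ (hpow n))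
  have hexp : NormedSpace.exp (t • A) =
      Real.exp (-(t / h)) • NormedSpace.exp ((t / h) • B) := by
    have e1 : t • A = (-(t / h)) • (1 : V →L[ℝ] V) + (t / h) • B := by
      have : t / h * h = t := by field_simp
      rw [hB, smul_add, smul_smul, this, neg_smul]
      abel
    have hc : Commute ((-(t / h)) • (1 : V →L[ℝ] V)) ((t / h) • B) :=
      ((Commute.one_left B).smul_right (t / h)).smul_left (-(t / h))
    let _ : NormedAlgebra ℚ (V →L[ℝ] V) := NormedAlgebra.restrictScalars ℚ ℝ _
    rw [e1, NormedSpace.exp_add_of_commute hc]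
    have e2 : (-(t / h)) • (1 : V →L[ℝ] V) = algebraMap ℝ (V →L[ℝ] V) (-(t / h)) := by
      rw [Algebra.algebraMap_eq_smul_one]
    rw [e2, ← NormedSpace.algebraMap_exp_comm, ← Real.exp_eq_exp_ℝ,
      Algebra.algebraMap_eq_smul_one, smul_mul_assoc, one_mul]
  rw [hexp, _root_.smul_apply]
  exact hsmul _ (Real.exp_pos _).le _ hmem

/-- Taylor expansion of the exponential, to second order. -/
theorem norm_exp_sub_one_sub_le {V : Type*} [NormedAddCommGroup V] [NormedSpace ℝ V]
    [CompleteSpace V] (A : V →L[ℝ] V) :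
    ‖NormedSpace.exp A - 1 - A‖ ≤ ‖A‖ ^ 2 * Real.exp ‖A‖ := by
  have h1 := NormedSpace.exp_series_hasSum_exp' (𝕂 := ℝ) A
  have h2 := (hasSum_nat_add_iff' 2).2 h1
  have h3 : (∑ i ∈ Finset.range 2, ((i.factorial : ℝ)⁻¹) • A ^ i) = 1 + A := by
    simp [Finset.sum_range_succ]
  rw [h3, ← sub_sub] at h2
  have h4 : HasSum (fun n : ℕ => ‖A‖ ^ 2 * (((n.factorial : ℝ)⁻¹) • ‖A‖ ^ n))
      (‖A‖ ^ 2 * Real.exp ‖A‖) := by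
    rw [Real.exp_eq_exp_ℝ]
    exact (NormedSpace.exp_series_hasSum_exp' (𝕂 := ℝ) ‖A‖).mul_left _
  refine h2.norm_le_of_bounded h4 fun n => ?_
  rw [norm_smul, norm_inv, Real.norm_natCast]
  have h5 : ‖A ^ (n + 2)‖ ≤ ‖A‖ ^ (n + 2) := norm_pow_le' A (by omega)
  have h6 : (((n + 2).factorial : ℝ))⁻¹ ≤ ((n.factorial : ℝ))⁻¹ := by
    gcongr
    omega
  calc (((n + 2).factorial : ℝ))⁻¹ * ‖A ^ (n + 2)‖ ≤
      ((n.factorial : ℝ))⁻¹ * ‖A‖ ^ (n + 2) := by gcongr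
    _ = _ := by rw [smul_eq_mul]; ring

theorem norm_exp_smul_sub_le {V : Type*} [NormedAddCommGroup V] [NormedSpace ℝ V]
    [CompleteSpace V] (A : V →L[ℝ] V) {h : ℝ} (h0 : 0 ≤ h) (h1 : h ≤ 1) (f : V) :
    ‖NormedSpace.exp (h • A) f - f - h • A f‖ ≤ ‖A‖ ^ 2 * Real.exp ‖A‖ * h ^ 2 * ‖f‖ := by
  have e : NormedSpace.exp (h • A) f - f - h • A f = (NormedSpace.exp (h • A) - 1 - h • A) f := by
    simp
  rw [e]
  refine (ContinuousLinearMap.le_opNorm _ f).trans ?_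
  gcongr
  refine (norm_exp_sub_one_sub_le (h • A)).trans ?_
  have : ‖h • A‖ = h * ‖A‖ := by rw [norm_smul, Real.norm_of_nonneg h0]
  rw [this]
  have h2 : h * ‖A‖ ≤ ‖A‖ := by nlinarith [norm_nonneg A]
  calc (h * ‖A‖) ^ 2 * Real.exp (h * ‖A‖) ≤ (h * ‖A‖) ^ 2 * Real.exp ‖A‖ := by gcongr
    _ = _ := by ring

/-! ### Bounds on `λ` -/

theorem continuous_extend {N : ℕ} (j : ℕ) : Continuous fun f : Fin N → ℝ => extend f j := by
  unfold extend
  split_ifs <;> fun_prop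

theorem extend_zero {N : ℕ} (j : ℕ) : extend (0 : Fin N → ℝ) j = 0 := by
  unfold extend; split_ifs <;> simp

/-- An Euler step of this length preserves the cones used below. -/
noncomputable def eulerStep (E : ℝ) (N : ℕ) : ℝ := ((N : ℝ) ^ 2 * (2 + E / N))⁻¹

theorem eulerStep_pos {E : ℝ} (hE : 0 < E) {N : ℕ} (hN : 2 ≤ N) : 0 < eulerStep E N := by
  unfold eulerStep; positivity

theorem extend_euler {E α β : ℝ} (hE : 0 < E) {N : ℕ} (hN : 2 ≤ N) (f : Fin N → ℝ) {j : ℕ}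
    (hj : j < N) : extend (f + eulerStep E N • Omega E α β N f) j =
      extend f j + (2 + E / N)⁻¹ *
        (fluxRight E β N (extend f) j - fluxLeft E α N (extend f) j) := by
  rw [extend_add, extend_smul]
  have : extend (Omega E α β N f) j = Omega E α β N f ⟨j, hj⟩ := by simp [extend, hj]
  rw [this, Omega_apply hN]
  have h2 : (2 + E / N) ≠ 0 := by positivity
  have h3 : (N : ℝ) ≠ 0 := by positivity
  unfold eulerStep
  simp only
  field_simp

/-- Functions on `Λ_N` satisfying the microscopic gradient bounds of the Cole-Hopf variables. -/
def ratioCone (E : ℝ) (N : ℕ) : Set (Fin N → ℝ) :=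
  {f | 0 ≤ extend f 0 ∧ ∀ j, j + 1 < N →
    extend f j ≤ extend f (j + 1) ∧ extend f (j + 1) ≤ (1 + E / N) * extend f j}

theorem ratioCone_nonneg {E : ℝ} {N : ℕ} {f : Fin N → ℝ} (hf : f ∈ ratioCone E N) :
    ∀ j, 0 ≤ extend f j := by
  intro j
  by_cases hj : j < N
  · induction j with
    | zero => exact hf.1
    | succ j ih => exact (ih (by omega)).trans (hf.2 j hj).1
  · simp [extend, hj]

/-- The gradient bounds survive an Euler step. The upper bound uses that the step length is
`(N² (2 + E/N))⁻¹`, for which the coefficient of `(1 + E/N) f_j - f_{j+1}` vanishes. -/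
theorem ratioCone_euler {E α β : ℝ} (hE : 0 < E) (hα : α ∈ Set.Ioo (0 : ℝ) 1)
    (hβ : β ∈ Set.Ioo (0 : ℝ) 1) {N : ℕ} (hN : 2 ≤ N) (f : Fin N → ℝ) (hf : f ∈ ratioCone E N) :
    f + eulerStep E N • Omega E α β N f ∈ ratioCone E N := by
  have hnn := ratioCone_nonneg hf
  set e : ℝ := E / N with he
  have he0 : 0 < e := by positivity
  set c : ℝ := (2 + e)⁻¹ with hc
  have hc0 : 0 < c := by positivity
  have hc1 : c * (2 + e) = 1 := by rw [hc]; field_simp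
  -- both fluxes lie between `0` and `e` times the value of `f`
  have hR : ∀ j, j < N → 0 ≤ fluxRight E β N (extend f) j ∧
      fluxRight E β N (extend f) j ≤ e * extend f j := by
    intro j hj
    have := hnn j
    unfold fluxRight
    rw [← he]
    split_ifs with h
    · have := mul_nonneg he0.le this
      constructor <;> nlinarith [hβ.1, hβ.2]
    · have := hf.2 j (by omega)
      constructor <;> linarith
  have hL : ∀ j, j < N → 0 ≤ fluxLeft E α N (extend f) j ∧
      fluxLeft E α N (extend f) j ≤ e * extend f j := by
    intro j hj
    have := hnn j
    unfold fluxLeft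
    rw [← he]
    split_ifs with h
    · subst h
      have := mul_nonneg he0.le this
      constructor <;> nlinarith [hα.1, hα.2]
    · have h1 := hf.2 (j - 1) (by omega)
      rw [show j - 1 + 1 = j by omega, ← he] at h1
      constructor <;> nlinarith
  refine ⟨?_, fun j hj => ?_⟩
  · rw [extend_euler hE hN f (by omega), ← he, ← hc]
    have h1 := (hR 0 (by omega)).1
    have h2 := (hL 0 (by omega)).2
    have h3 : c * (e * extend f 0) ≤ extend f 0 := by nlinarith [hnn 0]
    nlinarith [mul_nonneg hc0.le h1, mul_le_mul_of_nonneg_left h2 hc0.le]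
  · rw [extend_euler hE hN f (by omega), extend_euler hE hN f hj, ← he, ← hc]
    have e1 : fluxRight E β N (extend f) j = extend f (j + 1) - extend f j := by
      rw [fluxRight, if_neg (by omega)]
    have e2 : fluxLeft E α N (extend f) (j + 1) = (1 + e) * (extend f (j + 1) - extend f j) := by
      rw [fluxLeft, if_neg (by omega), Nat.add_sub_cancel]
    have h1 := hR (j + 1) hj
    have h2 := hL j (by omega)
    have h3 := hf.2 j hj
    rw [← he] at h3
    rw [e1, e2]
    generalize fluxRight E β N (extend f) (j + 1) = R at h1 ⊢
    generalize fluxLeft E α N (extend f) j = L at h2 ⊢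
    generalize extend f (j + 1) = y at *
    generalize extend f j = x at *
    constructor
    · nlinarith [mul_nonneg hc0.le h1.1, mul_nonneg hc0.le h2.1]
    -- after the bounds on `R` and `L` the right-hand side of `key` vanishes identically
    · have k1 := mul_le_mul_of_nonneg_left h1.2 hc0.le
      have k2 := mul_le_mul_of_nonneg_left h2.2 (mul_nonneg hc0.le (by linarith : 0 ≤ 1 + e))
      have key : (1 + e) * (x + c * (y - x - L)) - (y + c * (R - (1 + e) * (y - x)))
          = c * (2 + e) * ((1 + e) * x - y) + (1 - c * (2 + e)) * ((1 + e) * x - y)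
            + 2 * c * (1 + e) * (y - x) - c * (1 + e) * L - c * R := by ring
      have : 2 * c * (1 + e) * (y - x) + (c * (2 + e)) * ((1 + e) * x - y)
          - c * (1 + e) * (e * x) - c * (e * y) = 0 := by ring
      rw [hc1] at key this
      nlinarith

/-- The gradient bounds of `ratioCone` are preserved by the flow of `Ω`. -/
theorem exp_smul_Omega_mem_ratioCone {E α β : ℝ} (hE : 0 < E) (hα : α ∈ Set.Ioo (0 : ℝ) 1)
    (hβ : β ∈ Set.Ioo (0 : ℝ) 1) {N : ℕ} (hN : 2 ≤ N) {f : Fin N → ℝ} (hf : f ∈ ratioCone E N)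
    {t : ℝ} (ht : 0 ≤ t) : NormedSpace.exp (t • Omega E α β N) f ∈ ratioCone E N := by
  refine exp_smul_mem_of_euler _ _ ?_ ?_ ?_ ?_ (eulerStep_pos hE hN)
    (ratioCone_euler hE hα hβ hN) ht hf
  · have : ratioCone E N = {f | 0 ≤ extend f 0} ∩ ⋂ j, ⋂ (_ : j + 1 < N),
        ({f | extend f j ≤ extend f (j + 1)} ∩
          {f | extend f (j + 1) ≤ (1 + E / N) * extend f j}) := by
      ext f; simp [ratioCone]
    rw [this]
    refine (isClosed_le continuous_const (continuous_extend 0)).inter ?_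
    refine isClosed_iInter fun j => isClosed_iInter fun _ => ?_
    exact (isClosed_le (continuous_extend j) (continuous_extend _)).inter
      (isClosed_le (continuous_extend _) ((continuous_extend j).const_mul _))
  · simp [ratioCone, extend_zero]
  · intro f hf g hg
    refine ⟨?_, fun j hj => ?_⟩
    · rw [extend_add]; linarith [hf.1, hg.1]
    · have h1 := hf.2 j hj
      have h2 := hg.2 j hj
      rw [extend_add, extend_add]
      constructor <;> nlinarith
  · intro c hc f hf
    refine ⟨?_, fun j hj => ?_⟩
    · rw [extend_smul]; exact mul_nonneg hc hf.1
    · have h1 := hf.2 j hj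
      rw [extend_smul, extend_smul]
      constructor
      · exact mul_le_mul_of_nonneg_left h1.1 hc
      · nlinarith [mul_le_mul_of_nonneg_left h1.2 hc]

/-- Maximum principle for one Euler step. -/
theorem euler_nonneg {E α β : ℝ} (hE : 0 < E) (hα : α ∈ Set.Ioo (0 : ℝ) 1)
    (hβ : β ∈ Set.Ioo (0 : ℝ) 1) {N : ℕ} (hN : 2 ≤ N) {f : Fin N → ℝ} (hf : ∀ j, 0 ≤ f j)
    (j : Fin N) : 0 ≤ (f + eulerStep E N • Omega E α β N f) j := by
  have hnn : ∀ j, 0 ≤ extend f j := by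
    intro j; unfold extend; split_ifs
    exacts [hf _, le_rfl]
  rw [← extend_coe (f + _) j, extend_euler hE hN f j.2]
  set e : ℝ := E / N with he
  have he0 : 0 < e := by positivity
  set c : ℝ := (2 + e)⁻¹ with hc
  have hc0 : 0 < c := by positivity
  have hc1 : c * (2 + e) = 1 := by rw [hc]; field_simp
  have hj := hnn j
  have hR : - extend f j ≤ fluxRight E β N (extend f) j := by
    unfold fluxRight
    rw [← he]
    split_ifs
    · have := mul_nonneg he0.le hj
      nlinarith [hβ.1]
    · linarith [hnn (j + 1)]
  have hL : fluxLeft E α N (extend f) j ≤ (1 + e) * extend f j := by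
    unfold fluxLeft
    rw [← he]
    split_ifs with h
    · rw [h] at hj ⊢
      have := mul_nonneg he0.le hj
      nlinarith [hα.2]
    · nlinarith [hnn (j - 1)]
  nlinarith [mul_le_mul_of_nonneg_left hR hc0.le, mul_le_mul_of_nonneg_left hL hc0.le]

/-- Comparison principle: a nonnegative subsolution or supersolution (according to the sign `s`)
of the stationary equation `Ω f = ∓ C f` remains so along the flow of `Ω`. -/
theorem exp_smul_Omega_barrier {E α β : ℝ} (hE : 0 < E) (hα : α ∈ Set.Ioo (0 : ℝ) 1)
    (hβ : β ∈ Set.Ioo (0 : ℝ) 1) {N : ℕ} (hN : 2 ≤ N) {C s : ℝ} {f : Fin N → ℝ}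
    (hf : ∀ j, 0 ≤ f j ∧ 0 ≤ (C • f + s • Omega E α β N f) j) {t : ℝ} (ht : 0 ≤ t) :
    ∀ j, 0 ≤ NormedSpace.exp (t • Omega E α β N) f j ∧
      0 ≤ (C • NormedSpace.exp (t • Omega E α β N) f
        + s • Omega E α β N (NormedSpace.exp (t • Omega E α β N) f)) j := by
  refine exp_smul_mem_of_euler (Omega E α β N)
    {f | ∀ j, 0 ≤ f j ∧ 0 ≤ (C • f + s • Omega E α β N f) j} ?_ ?_ ?_ ?_
    (eulerStep_pos hE hN) ?_ ht hf
  · simp only [Set.ofPred_forall, Set.ofPred_and]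
    refine isClosed_iInter fun j => ?_
    refine (isClosed_le continuous_const (by fun_prop)).inter
      (isClosed_le continuous_const (by fun_prop))
  · simp
  · intro f hf g hg j
    have h1 := hf j
    have h2 := hg j
    simp only [Pi.add_apply, Pi.smul_apply, smul_eq_mul, map_add] at *
    constructor <;> linarith
  · intro c hc f hf j
    have h1 := hf j
    simp only [Pi.add_apply, Pi.smul_apply, smul_eq_mul, map_smul] at *
    exact ⟨mul_nonneg hc h1.1, by nlinarith [mul_nonneg hc h1.2]⟩
  · intro f hf j
    refine ⟨euler_nonneg hE hα hβ hN (fun j => (hf j).1) j, ?_⟩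
    -- `Ω` commutes with the Euler step, so the maximum principle applies to `C f + s Ω f`
    have h := euler_nonneg hE hα hβ hN (fun j => (hf j).2) j
    simp only [Pi.add_apply, Pi.smul_apply, smul_eq_mul, map_smul, map_add] at *
    linarith

/-- `ρ₀` takes values in `[0,1]`, has the boundary values `α`, `β`, and is Lipschitz. -/
structure IsProfile (α β : ℝ) (ρ₀ : ℝ → ℝ) (L : ℝ) : Prop where
  mem : ∀ x ∈ Set.Icc (0 : ℝ) 1, ρ₀ x ∈ Set.Icc (0 : ℝ) 1
  zero : ρ₀ 0 = α
  one : ρ₀ 1 = β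
  lipschitz : ∀ x ∈ Set.Icc (0 : ℝ) 1, ∀ y ∈ Set.Icc (0 : ℝ) 1, |ρ₀ y - ρ₀ x| ≤ L * |y - x|

theorem neg_gam_div {E : ℝ} {N : ℕ} (hN : 2 ≤ N) : -(gam E N / N) = Real.log (1 + E / N) := by
  have : (N : ℝ) ≠ 0 := by positivity
  unfold gam
  field_simp

theorem log_ratio_nonneg {E : ℝ} (hE : 0 < E) (N : ℕ) : 0 ≤ Real.log (1 + E / N) :=
  Real.log_nonneg (one_le_ratio hE N)

theorem log_ratio_le {E : ℝ} (hE : 0 < E) (N : ℕ) : Real.log (1 + E / N) ≤ E / N := by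
  have := Real.log_le_sub_one_of_pos (show 0 < 1 + E / N by linarith [one_le_ratio hE N])
  linarith

/-- `(1 + e)^r = 1 + r e + O(e²)` for `r ∈ [0,1]`. -/
theorem abs_exp_mul_log_sub_le {e r : ℝ} (he : 0 ≤ e) (hr : r ∈ Set.Icc (0 : ℝ) 1) :
    |Real.exp (Real.log (1 + e) * r) - 1 - r * e| ≤ e ^ 2 := by
  have h1 : Real.exp (Real.log (1 + e) * r) ≤ 1 + r * e := by
    rw [← Real.rpow_def_of_pos (by linarith)]
    exact rpow_one_add_le_one_add_mul_self (by linarith) hr.1 hr.2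
  have h2 := Real.add_one_le_exp (Real.log (1 + e) * r)
  have h3 : e - e ^ 2 ≤ Real.log (1 + e) := by
    have h := Real.one_sub_inv_le_log_of_pos (show 0 < 1 + e by linarith)
    have : e - e ^ 2 ≤ 1 - (1 + e)⁻¹ := by
      have e1 : 1 - (1 + e)⁻¹ - (e - e ^ 2) = e ^ 3 / (1 + e) := by field_simp; ring
      have : 0 ≤ e ^ 3 / (1 + e) := by positivity
      linarith
    linarith
  have h4 : (e - e ^ 2) * r ≤ Real.log (1 + e) * r := mul_le_mul_of_nonneg_right h3 hr.1
  have h5 : e ^ 2 * r ≤ e ^ 2 := mul_le_of_le_one_right (sq_nonneg e) hr.2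
  rw [abs_le]
  constructor <;> nlinarith [sq_nonneg e]

section Lam

variable {E α β L : ℝ} {ρ₀ : ℝ → ℝ}

theorem div_mem_Icc {N j : ℕ} (hj : j ≤ N) : (j : ℝ) / N ∈ Set.Icc (0 : ℝ) 1 := by
  refine ⟨by positivity, div_le_one_of_le₀ (by exact_mod_cast hj) (by positivity)⟩

theorem extend_lamInit {N j : ℕ} (hN : 2 ≤ N) (hj : j < N) : extend (lamInit E ρ₀ N) j =
    Real.exp (Real.log (1 + E / N) * ∑ k ∈ Finset.Icc 1 j, ρ₀ ((k : ℝ) / N)) := by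
  simp only [extend, hj, dif_pos, lamInit, neg_gam_div hN]

theorem extend_lamInit_succ {N j : ℕ} (hN : 2 ≤ N) (hj : j + 1 < N) :
    extend (lamInit E ρ₀ N) (j + 1) = extend (lamInit E ρ₀ N) j *
      Real.exp (Real.log (1 + E / N) * ρ₀ ((j + 1 : ℕ) / N)) := by
  rw [extend_lamInit hN hj, extend_lamInit hN (by omega), ← Real.exp_add,
    Finset.sum_Icc_succ_top (by omega), mul_add]

theorem lamInit_pos {N : ℕ} (j : Fin N) : 0 < lamInit E ρ₀ N j := Real.exp_pos _

theorem sum_profile_mem (hρ : IsProfile α β ρ₀ L) {N j : ℕ} (hj : j ≤ N) :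
    ∑ k ∈ Finset.Icc 1 j, ρ₀ ((k : ℝ) / N) ∈ Set.Icc (0 : ℝ) j := by
  have h : ∀ k ∈ Finset.Icc 1 j, ρ₀ ((k : ℝ) / N) ∈ Set.Icc (0 : ℝ) 1 := fun k hk =>
    hρ.mem _ (div_mem_Icc ((Finset.mem_Icc.1 hk).2.trans hj))
  refine ⟨Finset.sum_nonneg fun k hk => (h k hk).1, ?_⟩
  calc ∑ k ∈ Finset.Icc 1 j, ρ₀ ((k : ℝ) / N) ≤ ∑ _k ∈ Finset.Icc 1 j, (1 : ℝ) :=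
        Finset.sum_le_sum fun k hk => (h k hk).2
    _ = j := by simp

theorem exp_log_ratio_mul_le (hE : 0 < E) {N : ℕ} (hN : 2 ≤ N) {x : ℝ} (hx : x ≤ N) :
    Real.exp (Real.log (1 + E / N) * x) ≤ Real.exp E := by
  have hN' : (0 : ℝ) < N := by positivity
  refine Real.exp_le_exp.2 ?_
  calc Real.log (1 + E / N) * x ≤ Real.log (1 + E / N) * N :=
        mul_le_mul_of_nonneg_left hx (log_ratio_nonneg hE N)
    _ ≤ E / N * N := mul_le_mul_of_nonneg_right (log_ratio_le hE N) hN'.le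
    _ = E := by field_simp

theorem one_le_lamInit (hE : 0 < E) (hρ : IsProfile α β ρ₀ L) {N : ℕ} (hN : 2 ≤ N) (j : Fin N) :
    1 ≤ lamInit E ρ₀ N j := by
  rw [← extend_coe (lamInit E ρ₀ N) j, extend_lamInit hN j.2]
  exact Real.one_le_exp (mul_nonneg (log_ratio_nonneg hE N) (sum_profile_mem hρ j.2.le).1)

theorem lamInit_le (hE : 0 < E) (hρ : IsProfile α β ρ₀ L) {N : ℕ} (hN : 2 ≤ N) (j : Fin N) :
    lamInit E ρ₀ N j ≤ Real.exp E := by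
  rw [← extend_coe (lamInit E ρ₀ N) j, extend_lamInit hN j.2]
  refine exp_log_ratio_mul_le hE hN ((sum_profile_mem hρ j.2.le).2.trans ?_)
  exact_mod_cast j.2.le

theorem lamInit_mem_ratioCone (hE : 0 < E) (hρ : IsProfile α β ρ₀ L) {N : ℕ} (hN : 2 ≤ N) :
    lamInit E ρ₀ N ∈ ratioCone E N := by
  have hp : ∀ j < N, 0 < extend (lamInit E ρ₀ N) j := fun j hj => by
    rw [extend_lamInit hN hj]; exact Real.exp_pos _
  refine ⟨(hp 0 (by omega)).le, fun j hj => ?_⟩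
  have h0 := hp j (by omega)
  have hr := hρ.mem _ (div_mem_Icc hj.le)
  have hq := log_ratio_nonneg hE N
  rw [extend_lamInit_succ hN hj]
  constructor
  · exact le_mul_of_one_le_right h0.le (Real.one_le_exp (mul_nonneg hq hr.1))
  · rw [mul_comm (1 + E / N)]
    refine mul_le_mul_of_nonneg_left ?_ h0.le
    calc Real.exp (Real.log (1 + E / N) * ρ₀ ((j + 1 : ℕ) / N))
        ≤ Real.exp (Real.log (1 + E / N)) :=
          Real.exp_le_exp.2 (mul_le_of_le_one_right hq hr.2)
      _ = 1 + E / N := Real.exp_log (by linarith [one_le_ratio hE N])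

/-- The rate at which `λ` may grow or decay. -/
noncomputable def lamRate (E L : ℝ) : ℝ := E * L + 2 * E ^ 2

/-- The initial condition is an approximate solution of the stationary equation. This is where the
compatibility of `ρ₀` with the boundary densities is used. -/
theorem abs_Omega_lamInit_le (hE : 0 < E) (hρ : IsProfile α β ρ₀ L) {N : ℕ} (hN : 2 ≤ N)
    (j : Fin N) : |Omega E α β N (lamInit E ρ₀ N) j| ≤ lamRate E L * lamInit E ρ₀ N j := by
  have hN' : (0 : ℝ) < N := by positivity
  set h := extend (lamInit E ρ₀ N) with hh
  have hpos : 0 < h j := by rw [hh, extend_coe]; exact lamInit_pos j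
  rw [Omega_apply hN, ← extend_coe (lamInit E ρ₀ N) j, ← hh]
  set e : ℝ := E / N with he
  have he0 : 0 < e := by positivity
  have hR : |fluxRight E β N h j - ρ₀ ((j + 1 : ℕ) / N) * e * h j| ≤ e ^ 2 * h j := by
    unfold fluxRight
    split_ifs with hj
    · rw [hj, div_self hN'.ne', hρ.one, ← he, sub_self, abs_zero]
      positivity
    · have hj1 : (j : ℕ) + 1 < N := by have := j.2; omega
      rw [hh, extend_lamInit_succ hN hj1, ← hh, ← he]
      have := abs_exp_mul_log_sub_le he0.le (hρ.mem _ (div_mem_Icc hj1.le))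
      calc _ = |(Real.exp (Real.log (1 + e) * ρ₀ ((j + 1 : ℕ) / N)) - 1
              - ρ₀ ((j + 1 : ℕ) / N) * e) * h j| := by congr 1; ring
        _ ≤ _ := by
          rw [abs_mul, abs_of_pos hpos]
          exact mul_le_mul_of_nonneg_right this hpos.le
  have hL : |fluxLeft E α N h j - ρ₀ ((j : ℕ) / N) * e * h j| ≤ e ^ 2 * h j := by
    unfold fluxLeft
    split_ifs with hj
    · rw [hj, Nat.cast_zero, zero_div, hρ.zero, ← he, sub_self, abs_zero]
      rw [hj] at hpos
      positivity
    · obtain ⟨i, hi⟩ : ∃ i, (j : ℕ) = i + 1 := ⟨j - 1, by omega⟩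
      have hi1 : i + 1 < N := by have := j.2; omega
      have hr := hρ.mem _ (div_mem_Icc hi1.le)
      have hs : h (i + 1) = h i * Real.exp (Real.log (1 + e) * ρ₀ ((i + 1 : ℕ) / N)) :=
        extend_lamInit_succ hN hi1
      rw [hi] at hpos ⊢
      rw [Nat.add_sub_cancel, ← he]
      set r := ρ₀ ((i + 1 : ℕ) / N) with hrdef
      have h1 : (1 + e) * h i = Real.exp (Real.log (1 + e) * (1 - r)) * h (i + 1) := by
        rw [hs, mul_left_comm, ← Real.exp_add, ← mul_add, sub_add_cancel, mul_one,
          Real.exp_log (by linarith), mul_comm]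
      have := abs_exp_mul_log_sub_le he0.le
        (show 1 - r ∈ Set.Icc (0 : ℝ) 1 from ⟨by linarith [hr.2], by linarith [hr.1]⟩)
      calc _ = |-((Real.exp (Real.log (1 + e) * (1 - r)) - 1 - (1 - r) * e) * h (i + 1))| := by
            congr 1; rw [mul_sub (1 + e), h1]; ring
        _ ≤ _ := by
          rw [abs_neg, abs_mul, abs_of_pos hpos]
          exact mul_le_mul_of_nonneg_right this hpos.le
  have hlip : |ρ₀ ((j + 1 : ℕ) / N) - ρ₀ ((j : ℕ) / N)| ≤ L / N := by
    refine (hρ.lipschitz _ (div_mem_Icc j.2.le) _ (div_mem_Icc j.2)).trans_eq ?_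
    have : ((j + 1 : ℕ) : ℝ) / N - ((j : ℕ) : ℝ) / N = 1 / N := by push_cast; ring
    rw [this, abs_of_pos (by positivity)]
    ring
  generalize fluxRight E β N h j = R at *
  generalize fluxLeft E α N h j = F at *
  generalize ρ₀ ((j + 1 : ℕ) / N) = r at *
  generalize ρ₀ ((j : ℕ) / N) = r' at *
  have hRF : |R - F| ≤ (e * (L / N) + 2 * e ^ 2) * h j := by
    have e1 : R - F = (R - r * e * h j) - (F - r' * e * h j) + (r - r') * (e * h j) := by ring
    rw [e1]
    refine (abs_add_le _ _).trans ?_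
    have h2 := (abs_sub (R - r * e * h j) (F - r' * e * h j)).trans (add_le_add hR hL)
    have h3 : |(r - r') * (e * h j)| ≤ L / N * (e * h j) := by
      rw [abs_mul, abs_of_pos (show 0 < e * h j by positivity)]
      exact mul_le_mul_of_nonneg_right hlip (by positivity)
    linarith
  rw [abs_mul, abs_of_pos (by positivity)]
  calc (N : ℝ) ^ 2 * |R - F| ≤ (N : ℝ) ^ 2 * ((e * (L / N) + 2 * e ^ 2) * h j) := by gcongr
    _ = lamRate E L * h j := by
      rw [he, lamRate]; field_simp

theorem lamVec_mem_ratioCone (hE : 0 < E) (hα : α ∈ Set.Ioo (0 : ℝ) 1)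
    (hβ : β ∈ Set.Ioo (0 : ℝ) 1) (hρ : IsProfile α β ρ₀ L) {N : ℕ} (hN : 2 ≤ N) {t : ℝ}
    (ht : 0 ≤ t) : lamVec E α β ρ₀ N t ∈ ratioCone E N :=
  exp_smul_Omega_mem_ratioCone hE hα hβ hN (lamInit_mem_ratioCone hE hρ hN) ht

/-- `e^{s C t} λ_t` is monotone in time, increasing for `s = 1` and decreasing for `s = -1`. -/
theorem lamVec_monotone (hE : 0 < E) (hα : α ∈ Set.Ioo (0 : ℝ) 1)
    (hβ : β ∈ Set.Ioo (0 : ℝ) 1) (hρ : IsProfile α β ρ₀ L) {N : ℕ} (hN : 2 ≤ N) {t : ℝ}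
    (ht : 0 ≤ t) (j : Fin N) {s : ℝ} (hs : s = 1 ∨ s = -1) :
    s * lamInit E ρ₀ N j ≤
      s * (Real.exp (s * lamRate E L * t) * lamVec E α β ρ₀ N t j) := by
  set C := lamRate E L
  have hb : ∀ t, 0 ≤ t → 0 ≤ C * lamVec E α β ρ₀ N t j
      + s * Omega E α β N (lamVec E α β ρ₀ N t) j := by
    intro t ht
    refine (exp_smul_Omega_barrier hE hα hβ hN (C := C) (s := s) (fun i => ?_) ht j).2
    refine ⟨(lamInit_pos i).le, ?_⟩
    have := abs_le.1 (abs_Omega_lamInit_le hE hρ hN i)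
    simp only [Pi.add_apply, Pi.smul_apply, smul_eq_mul]
    rcases hs with rfl | rfl <;> linarith [this.1, this.2]
  let F : ℝ → ℝ := fun u => s * (Real.exp (s * C * u) * lamVec E α β ρ₀ N u j)
  have hF : ∀ u, HasDerivAt F (s * (Real.exp (s * C * u) * (s * C) * lamVec E α β ρ₀ N u j
      + Real.exp (s * C * u) * Omega E α β N (lamVec E α β ρ₀ N u) j)) u := by
    intro u
    have h1 : HasDerivAt (fun u => Real.exp (s * C * u)) (Real.exp (s * C * u) * (s * C)) u := by
      simpa using ((hasDerivAt_id u).const_mul (s * C)).exp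
    have h2 := (hasDerivAt_pi.1 (hasDerivAt_lamVec E α β ρ₀ N u)) j
    exact (h1.mul h2).const_mul s
  have hmono : MonotoneOn F (Set.Ici 0) := by
    refine monotoneOn_of_deriv_nonneg (convex_Ici 0)
      (fun u _ => (hF u).continuousAt.continuousWithinAt)
      (fun u _ => (hF u).differentiableAt.differentiableWithinAt) fun u hu => ?_
    rw [interior_Ici] at hu
    rw [(hF u).deriv]
    -- the derivative is `e^{s C u} (C λ + s Ω λ)`, since `s² = 1`
    have hss : s * s = 1 := by rcases hs with rfl | rfl <;> norm_num
    have := mul_nonneg (Real.exp_pos (s * C * u)).le (hb u (le_of_lt hu))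
    calc (0 : ℝ) ≤ _ := this
      _ = _ := by linear_combination (-Real.exp (s * C * u) * C * lamVec E α β ρ₀ N u j) * hss
  have := hmono (Set.self_mem_Ici) (Set.mem_Ici.2 ht) ht
  simpa [F, lamVec_zero] using this

/-- `λ` is bounded above and away from zero on `[0,T]`, uniformly in `N`. -/
theorem lamVec_bounds (hE : 0 < E) (hα : α ∈ Set.Ioo (0 : ℝ) 1)
    (hβ : β ∈ Set.Ioo (0 : ℝ) 1) (hρ : IsProfile α β ρ₀ L) {N : ℕ} (hN : 2 ≤ N) {T t : ℝ}
    (ht : 0 ≤ t) (htT : t ≤ T) (j : Fin N) :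
    Real.exp (-(lamRate E L * T)) ≤ lamVec E α β ρ₀ N t j ∧
      lamVec E α β ρ₀ N t j ≤ Real.exp (E + lamRate E L * T) := by
  have hL : 0 ≤ L := by
    have h := hρ.lipschitz 0 (by simp) 1 (by simp)
    have := abs_nonneg (ρ₀ 1 - ρ₀ 0)
    norm_num at h
    linarith
  have hC : 0 ≤ lamRate E L := by unfold lamRate; positivity
  have h1 := lamVec_monotone hE hα hβ hρ hN ht j (Or.inl rfl)
  have h2 := lamVec_monotone hE hα hβ hρ hN ht j (Or.inr rfl)
  have h3 := one_le_lamInit hE hρ hN j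
  have h4 := lamInit_le hE hρ hN j
  have h5 : lamRate E L * t ≤ lamRate E L * T := by gcongr
  generalize lamVec E α β ρ₀ N t j = x at *
  have e1 : Real.exp (lamRate E L * t) * Real.exp (-(lamRate E L * t)) = 1 := by
    rw [← Real.exp_add]; simp
  constructor
  · have h6 : 1 ≤ Real.exp (lamRate E L * t) * x := by
      simp only [one_mul] at h1; linarith
    calc Real.exp (-(lamRate E L * T)) ≤ Real.exp (-(lamRate E L * t)) :=
          Real.exp_le_exp.2 (by linarith)
      _ ≤ Real.exp (-(lamRate E L * t)) * (Real.exp (lamRate E L * t) * x) :=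
          le_mul_of_one_le_right (Real.exp_pos _).le h6
      _ = x := by linear_combination x * e1
  · have h6 : Real.exp (-(lamRate E L * t)) * x ≤ Real.exp E := by
      have : -1 * lamRate E L * t = -(lamRate E L * t) := by ring
      rw [this] at h2
      linarith
    calc x = Real.exp (lamRate E L * t) * (Real.exp (-(lamRate E L * t)) * x) := by
          linear_combination (-x) * e1
      _ ≤ Real.exp (lamRate E L * T) * Real.exp E :=
          mul_le_mul (Real.exp_le_exp.2 h5) h6
            (by
              by_contra hneg
              push Not at hneg
              have : x < 0 := by
                by_contra hx
                push Not at hx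
                exact absurd hneg (not_lt.2 (mul_nonneg (Real.exp_pos _).le hx))
              simp only [one_mul] at h1
              nlinarith [Real.exp_pos (lamRate E L * t)])
            (Real.exp_pos _).le
      _ = Real.exp (E + lamRate E L * T) := by rw [← Real.exp_add, add_comm]

end Lam

/-! ### Moves of the particles -/

/-- A particle may jump from `j` to `j+1`. -/
def CanJumpRight {N : ℕ} (ζ : Config N) (j : ℕ) : Prop :=
  (j = 0 ∨ Occupied ζ j) ∧ (j + 1 = N ∨ Vacant ζ (j + 1))

/-- A particle may jump from `j+1` to `j`. -/
def CanJumpLeft {N : ℕ} (ζ : Config N) (j : ℕ) : Prop :=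
  (j = 0 ∨ Vacant ζ j) ∧ (j + 1 = N ∨ Occupied ζ (j + 1))

/-- The number of particles in `{1, …, j}`. -/
noncomputable def mass {N : ℕ} (ζ : Config N) (j : ℕ) : ℝ := ∑ k ∈ Finset.Icc 1 j, particle ζ k

open Classical in
/-- The current through the bond `{j, j+1}` when the configuration passes from `ζ` to `ζ'` in a
single jump. -/
noncomputable def stepCurrent {N : ℕ} (ζ ζ' : Config N) (j : ℕ) : ℤ :=
  (if ζ' = bondMove j ζ ∧ CanJumpRight ζ j then 1 else 0)
    - (if ζ' = bondMove j ζ ∧ CanJumpLeft ζ j then 1 else 0)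

section Moves

variable {N : ℕ} {ζ : Config N} {j k : ℕ}

theorem particle_of_occupied (h : Occupied ζ j) : particle ζ j = 1 := by
  obtain ⟨h1, h2⟩ := h
  simp [particle, h1, h2]

theorem particle_of_vacant (h : Vacant ζ j) : particle ζ j = 0 := by
  obtain ⟨h1, h2⟩ := h
  simp [particle, h2]

theorem occupied_or_vacant (ζ : Config N) (hj : j ∈ Finset.Ico 1 N) :
    Occupied ζ j ∨ Vacant ζ j := by
  cases h : ζ ⟨j, hj⟩
  · exact Or.inr ⟨hj, h⟩
  · exact Or.inl ⟨hj, h⟩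

theorem particle_mem (ζ : Config N) (j : ℕ) : particle ζ j ∈ Set.Icc (0 : ℝ) 1 := by
  unfold particle
  split_ifs <;> norm_num

theorem particle_flipAt (hk : k ∈ Finset.Ico 1 N) :
    particle (flipAt j ζ) k = if k = j then 1 - particle ζ k else particle ζ k := by
  unfold particle flipAt
  rw [dif_pos hk, dif_pos hk]
  by_cases h : k = j
  · simp only [h, if_true]
    cases ζ ⟨j, h ▸ hk⟩ <;> simp
  · simp [h]

theorem particle_bondMove_bulk (hj : j ∈ Finset.Ico 1 N) (hj' : j + 1 ∈ Finset.Ico 1 N)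
    (hk : k ∈ Finset.Ico 1 N) : particle (bondMove j ζ) k =
      if k = j then particle ζ (j + 1) else if k = j + 1 then particle ζ j else particle ζ k := by
  unfold bondMove
  rw [dif_pos ⟨hj, hj'⟩]
  by_cases h1 : k = j
  · subst h1
    simp [particle, hj, hj']
  · by_cases h2 : k = j + 1
    · subst h2
      simp [particle, hj, hj']
    · have e : Equiv.swap (⟨j, hj⟩ : Site N) ⟨j + 1, hj'⟩ ⟨k, hk⟩ = ⟨k, hk⟩ :=
        Equiv.swap_apply_of_ne_of_ne (by simpa using h1) (by simpa using h2)
      simp only [particle, hk, dif_pos, e, h1, h2, if_false]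

theorem bondMove_zero : bondMove 0 ζ = flipAt 1 ζ := by
  simp [bondMove]

theorem bondMove_last (hN : 2 ≤ N) (hj : j + 1 = N) : bondMove j ζ = flipAt j ζ := by
  unfold bondMove
  rw [dif_neg (by rintro ⟨-, h⟩; have := Finset.mem_Ico.1 h; omega), if_neg (by omega)]

theorem particle_bondMove_right (hN : 2 ≤ N) (hj : j < N) (h : CanJumpRight ζ j)
    (hk : k ∈ Finset.Ico 1 N) : particle (bondMove j ζ) k =
      particle ζ k - (if k = j then 1 else 0) + (if k = j + 1 then 1 else 0) := by
  have hk' := Finset.mem_Ico.1 hk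
  by_cases h0 : j = 0
  · subst h0
    have hv := particle_of_vacant (h.2.resolve_left (by omega))
    rw [bondMove_zero, particle_flipAt hk, if_neg (show k ≠ 0 by omega)]
    by_cases h1 : k = 1
    · subst h1
      simp only [zero_add] at hv
      simp [hv]
    · simp [h1]
  · have ho := particle_of_occupied (h.1.resolve_left h0)
    by_cases h1 : j + 1 = N
    · rw [bondMove_last hN h1, particle_flipAt hk, if_neg (show k ≠ j + 1 by omega)]
      by_cases h2 : k = j
      · subst h2
        simp [ho]
      · simp [h2]
    · have hv := particle_of_vacant (h.2.resolve_left h1)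
      rw [particle_bondMove_bulk (Finset.mem_Ico.2 ⟨by omega, hj⟩)
        (Finset.mem_Ico.2 ⟨by omega, by omega⟩) hk]
      by_cases h2 : k = j
      · subst h2
        simp [ho, hv]
      · by_cases h3 : k = j + 1
        · subst h3
          simp [ho, hv]
        · simp [h2, h3]

theorem particle_bondMove_left (hN : 2 ≤ N) (hj : j < N) (h : CanJumpLeft ζ j)
    (hk : k ∈ Finset.Ico 1 N) : particle (bondMove j ζ) k =
      particle ζ k + (if k = j then 1 else 0) - (if k = j + 1 then 1 else 0) := by
  have hk' := Finset.mem_Ico.1 hk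
  by_cases h0 : j = 0
  · subst h0
    have hv := particle_of_occupied (h.2.resolve_left (by omega))
    rw [bondMove_zero, particle_flipAt hk, if_neg (show k ≠ 0 by omega)]
    by_cases h1 : k = 1
    · subst h1
      simp only [zero_add] at hv
      simp [hv]
    · simp [h1]
  · have ho := particle_of_vacant (h.1.resolve_left h0)
    by_cases h1 : j + 1 = N
    · rw [bondMove_last hN h1, particle_flipAt hk, if_neg (show k ≠ j + 1 by omega)]
      by_cases h2 : k = j
      · subst h2
        simp [ho]
      · simp [h2]
    · have hv := particle_of_occupied (h.2.resolve_left h1)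
      rw [particle_bondMove_bulk (Finset.mem_Ico.2 ⟨by omega, hj⟩)
        (Finset.mem_Ico.2 ⟨by omega, by omega⟩) hk]
      by_cases h2 : k = j
      · subst h2
        simp [ho, hv]
      · by_cases h3 : k = j + 1
        · subst h3
          simp [ho, hv]
        · simp [h2, h3]

theorem sum_Icc_indicator (i m : ℕ) :
    ∑ k ∈ Finset.Icc 1 i, (if k = m then (1 : ℝ) else 0) = if 1 ≤ m ∧ m ≤ i then 1 else 0 := by
  rw [Finset.sum_ite_eq' (Finset.Icc 1 i) m (fun _ => (1 : ℝ))]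
  simp [Finset.mem_Icc]

theorem indicator_bond (i j : ℕ) :
    (if 1 ≤ j ∧ j ≤ i then (1 : ℝ) else 0) - (if 1 ≤ j + 1 ∧ j + 1 ≤ i then 1 else 0) =
      (if i = j then 1 else 0) - (if j = 0 then 1 else 0) := by
  split_ifs <;> first | omega | norm_num

theorem mass_bondMove_right (hN : 2 ≤ N) (hj : j < N) (h : CanJumpRight ζ j) {i : ℕ}
    (hi : i < N) : mass (bondMove j ζ) i =
      mass ζ i - (if i = j then 1 else 0) + (if j = 0 then 1 else 0) := by
  unfold mass
  rw [Finset.sum_congr rfl fun k hk => particle_bondMove_right hN hj h (Finset.mem_Ico.2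
    ⟨(Finset.mem_Icc.1 hk).1, lt_of_le_of_lt (Finset.mem_Icc.1 hk).2 hi⟩),
    Finset.sum_add_distrib, Finset.sum_sub_distrib, sum_Icc_indicator, sum_Icc_indicator]
  linarith [indicator_bond i j]

theorem mass_bondMove_left (hN : 2 ≤ N) (hj : j < N) (h : CanJumpLeft ζ j) {i : ℕ}
    (hi : i < N) : mass (bondMove j ζ) i =
      mass ζ i + (if i = j then 1 else 0) - (if j = 0 then 1 else 0) := by
  unfold mass
  rw [Finset.sum_congr rfl fun k hk => particle_bondMove_left hN hj h (Finset.mem_Ico.2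
    ⟨(Finset.mem_Icc.1 hk).1, lt_of_le_of_lt (Finset.mem_Icc.1 hk).2 hi⟩),
    Finset.sum_sub_distrib, Finset.sum_add_distrib, sum_Icc_indicator, sum_Icc_indicator]
  linarith [indicator_bond i j]

/-- The increment of the mass profile produced by a jump to the right through `{j, j+1}`. -/
def massIncrement (j i : ℕ) : ℤ := (if j = 0 then 1 else 0) - (if i = j then 1 else 0)

theorem massIncrement_inj {j k : ℕ} (h1 : massIncrement j j = massIncrement k j)
    (h2 : massIncrement j k = massIncrement k k) : j = k := by
  unfold massIncrement at h1 h2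
  by_contra hne
  simp only [if_true, hne, Ne.symm hne, if_false] at h1 h2
  omega

/-- For `N ≥ 3` a jump to the right and a jump to the left never have the same effect; for `N = 2`
the creation of a particle from the left and from the right are indistinguishable. -/
theorem massIncrement_ne_neg (hN : 3 ≤ N) {j k : ℕ} (hj : j < N)
    (h : ∀ i < N, massIncrement j i = -massIncrement k i) : False := by
  have h1 := h 1 (by omega)
  have h2 := h 2 (by omega)
  have h3 := h j hj
  unfold massIncrement at h1 h2 h3
  by_cases hj0 : j = 0
  · subst hj0
    by_cases hk1 : 1 = k
    · subst hk1; simp at h2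
    · by_cases hk0 : k = 0 <;> simp_all
  · by_cases hk0 : k = 0
    · subst hk0
      by_cases hj1 : 1 = j
      · subst hj1; simp at h2
      · simp_all
    · by_cases hjk : j = k <;> simp_all

theorem mass_bondMove_right_eq_add (hN : 2 ≤ N) (hj : j < N) (h : CanJumpRight ζ j) {i : ℕ}
    (hi : i < N) : mass (bondMove j ζ) i = mass ζ i + massIncrement j i := by
  rw [mass_bondMove_right hN hj h hi]
  unfold massIncrement
  push_cast
  ring

theorem mass_bondMove_left_eq_sub (hN : 2 ≤ N) (hj : j < N) (h : CanJumpLeft ζ j) {i : ℕ}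
    (hi : i < N) : mass (bondMove j ζ) i = mass ζ i - massIncrement j i := by
  rw [mass_bondMove_left hN hj h hi]
  unfold massIncrement
  push_cast
  ring

/-- The increments of the mass profile identify the bond through which a particle has moved, and
the direction of the move. -/
theorem stepCurrent_right (hN : 3 ≤ N) (hj : j < N) (h : CanJumpRight ζ j) {k : ℕ} (hk : k < N) :
    stepCurrent ζ (bondMove j ζ) k = if k = j then 1 else 0 := by
  have hm : ∀ i < N, _ := fun i hi => mass_bondMove_right_eq_add (by omega) hj h hi
  have hR : bondMove j ζ = bondMove k ζ → CanJumpRight ζ k → k = j := by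
    intro he hc
    have hm' : ∀ i < N, massIncrement j i = massIncrement k i := fun i hi => by
      have := mass_bondMove_right_eq_add (by omega) hk hc hi
      rw [← he, hm i hi] at this
      exact_mod_cast add_left_cancel this
    exact (massIncrement_inj (hm' j hj) (hm' k hk)).symm
  have hL : bondMove j ζ = bondMove k ζ → ¬ CanJumpLeft ζ k := by
    intro he hc
    refine massIncrement_ne_neg hN hj (k := k) fun i hi => ?_
    have := mass_bondMove_left_eq_sub (by omega) hk hc hi
    rw [← he, hm i hi, sub_eq_add_neg] at this
    exact_mod_cast add_left_cancel this
  unfold stepCurrent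
  by_cases hkj : k = j
  · subst hkj
    rw [if_pos ⟨rfl, h⟩, if_neg (fun hh => hL hh.1 hh.2), if_pos rfl, sub_zero]
  · rw [if_neg (fun hh => hkj (hR hh.1 hh.2)), if_neg (fun hh => hL hh.1 hh.2), if_neg hkj,
      sub_zero]

theorem stepCurrent_left (hN : 3 ≤ N) (hj : j < N) (h : CanJumpLeft ζ j) {k : ℕ} (hk : k < N) :
    stepCurrent ζ (bondMove j ζ) k = if k = j then -1 else 0 := by
  have hm : ∀ i < N, _ := fun i hi => mass_bondMove_left_eq_sub (by omega) hj h hi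
  have hR : bondMove j ζ = bondMove k ζ → CanJumpLeft ζ k → k = j := by
    intro he hc
    have hm' : ∀ i < N, massIncrement j i = massIncrement k i := fun i hi => by
      have := mass_bondMove_left_eq_sub (by omega) hk hc hi
      rw [← he, hm i hi] at this
      exact_mod_cast sub_right_injective this
    exact (massIncrement_inj (hm' j hj) (hm' k hk)).symm
  have hL : bondMove j ζ = bondMove k ζ → ¬ CanJumpRight ζ k := by
    intro he hc
    refine massIncrement_ne_neg hN hk (k := j) fun i hi => ?_
    have := mass_bondMove_right_eq_add (by omega) hk hc hi
    rw [← he, hm i hi, sub_eq_add_neg] at this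
    exact_mod_cast (add_left_cancel this).symm
  unfold stepCurrent
  by_cases hkj : k = j
  · subst hkj
    rw [if_neg (fun hh => hL hh.1 hh.2), if_pos ⟨rfl, h⟩, if_pos rfl, zero_sub]
  · rw [if_neg (fun hh => hL hh.1 hh.2), if_neg (fun hh => hkj (hR hh.1 hh.2)), if_neg hkj,
      sub_zero]

theorem bondMove_ne_of_canJumpRight (hN : 3 ≤ N) (hj : j < N) (h : CanJumpRight ζ j) :
    bondMove j ζ ≠ ζ := by
  intro he
  have h1 := mass_bondMove_right (by omega) hj h hj
  have h2 := mass_bondMove_right (i := 1) (by omega) hj h (by omega)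
  rw [he] at h1 h2
  split_ifs at h1 h2 <;> first | omega | linarith

theorem bondMove_ne_of_canJumpLeft (hN : 3 ≤ N) (hj : j < N) (h : CanJumpLeft ζ j) :
    bondMove j ζ ≠ ζ := by
  intro he
  have h1 := mass_bondMove_left (by omega) hj h hj
  have h2 := mass_bondMove_left (i := 1) (by omega) hj h (by omega)
  rw [he] at h1 h2
  split_ifs at h1 h2 <;> first | omega | linarith

/-- A configuration which does not change produces no current; a jump always changes it. -/
theorem stepCurrent_self (hN : 3 ≤ N) (hj : j < N) : stepCurrent ζ ζ j = 0 := by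
  unfold stepCurrent
  rw [if_neg (fun hh => bondMove_ne_of_canJumpRight hN hj hh.2 hh.1.symm),
    if_neg (fun hh => bondMove_ne_of_canJumpLeft hN hj hh.2 hh.1.symm), sub_zero]

theorem neg_one_le_stepCurrent (ζ ζ' : Config N) (j : ℕ) : -1 ≤ stepCurrent ζ ζ' j := by
  unfold stepCurrent
  split_ifs <;> omega

theorem abs_stepCurrent_le (ζ ζ' : Config N) (j : ℕ) : |stepCurrent ζ ζ' j| ≤ 1 := by
  unfold stepCurrent
  split_ifs <;> simp

/-- The exchange across a bond which admits no jump does nothing. -/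
theorem bondMove_of_not_canJump (hN : 2 ≤ N) (hj : j < N) (hR : ¬ CanJumpRight ζ j)
    (hL : ¬ CanJumpLeft ζ j) : bondMove j ζ = ζ := by
  unfold CanJumpRight at hR
  unfold CanJumpLeft at hL
  by_cases h0 : j = 0
  · have := occupied_or_vacant ζ (j := j + 1) (Finset.mem_Ico.2 ⟨by omega, by omega⟩)
    tauto
  · by_cases h1 : j + 1 = N
    · have := occupied_or_vacant ζ (j := j) (Finset.mem_Ico.2 ⟨by omega, by omega⟩)
      tauto
    · have hj0 : j ∈ Finset.Ico 1 N := Finset.mem_Ico.2 ⟨by omega, by omega⟩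
      have hj1 : j + 1 ∈ Finset.Ico 1 N := Finset.mem_Ico.2 ⟨by omega, by omega⟩
      have e : ζ ⟨j, hj0⟩ = ζ ⟨j + 1, hj1⟩ := by
        have k1 : ¬ (Occupied ζ j ∧ Vacant ζ (j + 1)) := fun h => hR ⟨Or.inr h.1, Or.inr h.2⟩
        have k2 : ¬ (Vacant ζ j ∧ Occupied ζ (j + 1)) := fun h => hL ⟨Or.inr h.1, Or.inr h.2⟩
        unfold Occupied Vacant at k1 k2
        cases e1 : ζ ⟨j, hj0⟩ <;> cases e2 : ζ ⟨j + 1, hj1⟩ <;> simp_all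
      unfold bondMove
      rw [dif_pos ⟨hj0, hj1⟩]
      funext k
      by_cases h2 : k = ⟨j, hj0⟩
      · rw [h2, Equiv.swap_apply_left, e]
      · by_cases h3 : k = ⟨j + 1, hj1⟩
        · rw [h3, Equiv.swap_apply_right, e]
        · rw [Equiv.swap_apply_of_ne_of_ne h2 h3]

/-- The configuration `ζ'` is reached from `ζ` in at most one jump. -/
def IsStep {N : ℕ} (ζ ζ' : Config N) : Prop := ζ' = ζ ∨ ∃ j < N, ζ' = bondMove j ζ

/-- Conservation of the number of particles along a step. -/
theorem IsStep.mass_sub {ζ' : Config N} (h : IsStep ζ ζ') (hN : 3 ≤ N) {i : ℕ} (hi : i < N) :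
    mass ζ' i - mass ζ i = stepCurrent ζ ζ' 0 - stepCurrent ζ ζ' i := by
  have hself : mass ζ i - mass ζ i = stepCurrent ζ ζ 0 - stepCurrent ζ ζ i := by
    rw [stepCurrent_self hN (by omega), stepCurrent_self hN hi]; simp
  rcases h with rfl | ⟨j, hj, rfl⟩
  · exact hself
  · by_cases hR : CanJumpRight ζ j
    · rw [mass_bondMove_right (by omega) hj hR hi, stepCurrent_right hN hj hR (by omega),
        stepCurrent_right hN hj hR hi]
      simp only [eq_comm (a := 0) (b := j)]
      push_cast
      ring
    · by_cases hL : CanJumpLeft ζ j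
      · rw [mass_bondMove_left (by omega) hj hL hi, stepCurrent_left hN hj hL (by omega),
          stepCurrent_left hN hj hL hi]
        simp only [eq_comm (a := 0) (b := j)]
        split_ifs <;> norm_num
      · rw [bondMove_of_not_canJump (by omega) hj hR hL]
        exact hself

end Moves

/-! ### The microscopic Cole-Hopf transformation -/

/-- The Cole-Hopf variables `ξ` as a function of the configuration and of the current `w` through
the bond `{0, 1}`. -/
noncomputable def coleHopf (E : ℝ) {N : ℕ} (ζ : Config N) (w : ℤ) : Fin N → ℝ :=
  fun j => Real.exp (gam E N / N * (w - mass ζ j))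

section ColeHopf

variable {E α β : ℝ} {N : ℕ} {ζ : Config N} {w : ℤ}

theorem exp_gam_div (hE : 0 < E) (hN : 2 ≤ N) : Real.exp (gam E N / N) = (1 + E / N)⁻¹ := by
  have h := exp_neg_gam hE (show 0 < N by omega)
  rw [neg_div, Real.exp_neg] at h
  rw [← h, inv_inv]

theorem exp_neg_gam_div (hE : 0 < E) (hN : 2 ≤ N) : Real.exp (-(gam E N / N)) = 1 + E / N := by
  rw [← neg_div]; exact exp_neg_gam hE (by omega)

theorem coleHopf_pos (j : Fin N) : 0 < coleHopf E ζ w j := Real.exp_pos _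

theorem extend_coleHopf {j : ℕ} (hj : j < N) :
    extend (coleHopf E ζ w) j = Real.exp (gam E N / N * (w - mass ζ j)) := by
  simp [extend, hj, coleHopf]

theorem coleHopf_bondMove_right (hE : 0 < E) (hN : 3 ≤ N) (j : Fin N) (h : CanJumpRight ζ j) :
    coleHopf E (bondMove j ζ) (w + stepCurrent ζ (bondMove j ζ) 0) =
      coleHopf E ζ w + Pi.single j (((1 + E / N)⁻¹ - 1) * coleHopf E ζ w j) := by
  funext i
  rw [stepCurrent_right hN j.2 h (by omega)]
  simp only [coleHopf, Pi.add_apply, mass_bondMove_right (by omega) j.2 h i.2,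
    eq_comm (a := 0) (b := (j : ℕ))]
  by_cases hij : i = j
  · subst hij
    rw [Pi.single_eq_same, if_pos rfl, ← exp_gam_div hE (by omega), sub_mul, ← Real.exp_add,
      one_mul, add_sub_cancel]
    congr 1
    push_cast
    ring
  · rw [Pi.single_eq_of_ne hij, if_neg (fun hh => hij (Fin.ext hh)), add_zero]
    congr 1
    push_cast
    ring

theorem coleHopf_bondMove_left (hE : 0 < E) (hN : 3 ≤ N) (j : Fin N) (h : CanJumpLeft ζ j) :
    coleHopf E (bondMove j ζ) (w + stepCurrent ζ (bondMove j ζ) 0) =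
      coleHopf E ζ w + Pi.single j (E / N * coleHopf E ζ w j) := by
  funext i
  rw [stepCurrent_left hN j.2 h (by omega)]
  simp only [coleHopf, Pi.add_apply, mass_bondMove_left (by omega) j.2 h i.2,
    eq_comm (a := 0) (b := (j : ℕ))]
  have hs : ((if (j : ℕ) = 0 then (-1 : ℤ) else 0 : ℤ) : ℝ) = -(if (j : ℕ) = 0 then 1 else 0) := by
    split_ifs <;> simp
  rw [Int.cast_add, hs]
  by_cases hij : i = j
  · subst hij
    have : E / N = Real.exp (-(gam E N / N)) - 1 := by rw [exp_neg_gam_div hE (by omega)]; ring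
    rw [Pi.single_eq_same, if_pos rfl, this, sub_mul, ← Real.exp_add,
      one_mul, add_sub_cancel]
    congr 1
    ring
  · rw [Pi.single_eq_of_ne hij, if_neg (fun hh => hij (Fin.ext hh)), add_zero]
    ring_nf

theorem occ_mem (hα : α ∈ Set.Ioo (0 : ℝ) 1) (hβ : β ∈ Set.Ioo (0 : ℝ) 1) (ζ : Config N) (j : ℕ) :
    occ α β ζ j ∈ Set.Icc (0 : ℝ) 1 := by
  unfold occ
  split_ifs
  exacts [⟨hα.1.le, hα.2.le⟩, ⟨hβ.1.le, hβ.2.le⟩, particle_mem ζ j]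

theorem occ_of_mem {j : ℕ} (hj : j ∈ Finset.Ico 1 N) : occ α β ζ j = particle ζ j := by
  have := Finset.mem_Ico.1 hj
  rw [occ, if_neg (by omega), if_neg (by omega)]

/-- The rate of a bond consists of its right part if a particle may jump to the right, and of its
left part if a particle may jump to the left. -/
theorem jump_trichotomy (α β : ℝ) (ζ : Config N) (hN : 2 ≤ N) {j : ℕ} (hj : j < N) :
    (CanJumpRight ζ j ∧ occ α β ζ (j + 1) * (1 - occ α β ζ j) = 0) ∨
    (CanJumpLeft ζ j ∧ occ α β ζ j * (1 - occ α β ζ (j + 1)) = 0) ∨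
    (occ α β ζ (j + 1) * (1 - occ α β ζ j) = 0 ∧ occ α β ζ j * (1 - occ α β ζ (j + 1)) = 0) := by
  by_cases h0 : j = 0
  · have hm : j + 1 ∈ Finset.Ico 1 N := Finset.mem_Ico.2 ⟨by omega, by omega⟩
    rcases occupied_or_vacant ζ hm with h | h
    · refine Or.inr (Or.inl ⟨⟨Or.inl h0, Or.inr h⟩, ?_⟩)
      rw [occ_of_mem hm, particle_of_occupied h]; ring
    · refine Or.inl ⟨⟨Or.inl h0, Or.inr h⟩, ?_⟩
      rw [occ_of_mem hm, particle_of_vacant h]; ring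
  · have hm : j ∈ Finset.Ico 1 N := Finset.mem_Ico.2 ⟨by omega, by omega⟩
    by_cases h1 : j + 1 = N
    · rcases occupied_or_vacant ζ hm with h | h
      · refine Or.inl ⟨⟨Or.inr h, Or.inl h1⟩, ?_⟩
        rw [occ_of_mem hm, particle_of_occupied h]; ring
      · refine Or.inr (Or.inl ⟨⟨Or.inr h, Or.inl h1⟩, ?_⟩)
        rw [occ_of_mem hm, particle_of_vacant h]; ring
    · have hm' : j + 1 ∈ Finset.Ico 1 N := Finset.mem_Ico.2 ⟨by omega, by omega⟩
      rw [occ_of_mem hm, occ_of_mem hm']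
      rcases occupied_or_vacant ζ hm with h | h <;> rcases occupied_or_vacant ζ hm' with h' | h'
      · rw [particle_of_occupied h, particle_of_occupied h']; norm_num
      · rw [particle_of_occupied h, particle_of_vacant h']
        exact Or.inl ⟨⟨Or.inr h, Or.inr h'⟩, by norm_num⟩
      · rw [particle_of_vacant h, particle_of_occupied h']
        exact Or.inr (Or.inl ⟨⟨Or.inr h, Or.inr h'⟩, by norm_num⟩)
      · rw [particle_of_vacant h, particle_of_vacant h']; norm_num

/-- The generator applied to a function of the Cole-Hopf variables: a jump through the bond
`{j, j+1}` modifies the variable at `j` only. -/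
theorem generator_coleHopf (hE : 0 < E) (hN : 3 ≤ N) (α β : ℝ) (ζ : Config N) (w : ℤ)
    (F : (Fin N → ℝ) → ℝ) :
    generator E α β N (fun ζ' => F (coleHopf E ζ' (w + stepCurrent ζ ζ' 0))) ζ =
      (N : ℝ) ^ 2 * ∑ j : Fin N,
        ((1 + E / N) * (occ α β ζ j * (1 - occ α β ζ (j + 1))) *
            (F (coleHopf E ζ w + Pi.single j (((1 + E / N)⁻¹ - 1) * coleHopf E ζ w j))
              - F (coleHopf E ζ w))
          + occ α β ζ (j + 1) * (1 - occ α β ζ j) *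
            (F (coleHopf E ζ w + Pi.single j (E / N * coleHopf E ζ w j))
              - F (coleHopf E ζ w))) := by
  rw [generator_apply, Finset.sum_range]
  congr 1
  refine Finset.sum_congr rfl fun j _ => ?_
  rw [stepCurrent_self hN (by omega), add_zero]
  have hr : rate E α β j ζ = (1 + E / N) * (occ α β ζ j * (1 - occ α β ζ (j + 1)))
      + occ α β ζ (j + 1) * (1 - occ α β ζ j) := by unfold rate; ring
  rw [hr]
  rcases jump_trichotomy α β ζ (by omega) j.2 with ⟨h, h0⟩ | ⟨h, h0⟩ | ⟨h0, h1⟩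
  · rw [h0, coleHopf_bondMove_right hE hN j h]; ring
  · rw [h0, coleHopf_bondMove_left hE hN j h]; ring
  · rw [h0, h1]; ring

theorem mass_succ (ζ : Config N) (j : ℕ) : mass ζ (j + 1) = mass ζ j + particle ζ (j + 1) := by
  unfold mass; rw [Finset.sum_Icc_succ_top (by omega)]

theorem particle_eq_zero_or_one (ζ : Config N) (j : ℕ) : particle ζ j = 0 ∨ particle ζ j = 1 := by
  unfold particle
  split_ifs <;> simp

theorem extend_coleHopf_succ (hE : 0 < E) (hN : 2 ≤ N) {j : ℕ} (hj : j + 1 < N) :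
    extend (coleHopf E ζ w) (j + 1) =
      (1 + E / N * particle ζ (j + 1)) * extend (coleHopf E ζ w) j := by
  rw [extend_coleHopf hj, extend_coleHopf (show j < N by omega), mass_succ]
  rcases particle_eq_zero_or_one ζ (j + 1) with h | h
  · rw [h]; simp
  · rw [h, mul_one, ← exp_neg_gam_div hE hN, ← Real.exp_add]
    congr 1
    ring

/-- The Cole-Hopf variables linearize the drift: the action of `Ω` on them. -/
theorem Omega_coleHopf (hE : 0 < E) (hN : 2 ≤ N) (j : Fin N) :
    Omega E α β N (coleHopf E ζ w) j =
      (N : ℝ) ^ 2 * (E / N * (occ α β ζ (j + 1) - occ α β ζ j) * coleHopf E ζ w j) := by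
  rw [Omega_apply hN, ← extend_coe (coleHopf E ζ w) j]
  congr 1
  have hR : fluxRight E β N (extend (coleHopf E ζ w)) j =
      E / N * occ α β ζ (j + 1) * extend (coleHopf E ζ w) j := by
    unfold fluxRight
    split_ifs with h
    · rw [occ, if_neg (by omega), if_pos h]; ring
    · have := j.2
      rw [extend_coleHopf_succ hE hN (by omega),
        occ_of_mem (Finset.mem_Ico.2 ⟨by omega, by omega⟩)]
      ring
  have hL : fluxLeft E α N (extend (coleHopf E ζ w)) j =
      E / N * occ α β ζ j * extend (coleHopf E ζ w) j := by
    unfold fluxLeft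
    split_ifs with h
    · rw [h, occ, if_pos rfl]; ring
    · have := j.2
      have hs := extend_coleHopf_succ (ζ := ζ) (w := w) hE hN (j := j - 1) (by omega)
      rw [show (j : ℕ) - 1 + 1 = j by omega] at hs
      rw [occ_of_mem (Finset.mem_Ico.2 ⟨by omega, by omega⟩), hs]
      rcases particle_eq_zero_or_one ζ j with h | h <;> rw [h] <;> ring
  rw [hR, hL]
  ring

/-- The occupation variables take the values `0` and `1`, so `ξ(j+1)/ξ(j)` is `1` or `1 + E/N`. -/
theorem coleHopf_mem_ratioCone (hE : 0 < E) (hN : 2 ≤ N) (ζ : Config N) (w : ℤ) :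
    coleHopf E ζ w ∈ ratioCone E N := by
  have hp : ∀ j < N, 0 < extend (coleHopf E ζ w) j := fun j hj => by
    rw [extend_coleHopf hj]; exact Real.exp_pos _
  refine ⟨(hp 0 (by omega)).le, fun j hj => ?_⟩
  rw [extend_coleHopf_succ hE hN hj]
  have h0 := hp j (by omega)
  have hq : 0 < E / N := by positivity
  have := mul_pos hq h0
  rcases particle_eq_zero_or_one ζ (j + 1) with h | h <;> rw [h] <;> constructor <;> nlinarith

end ColeHopf

/-! ### The resolvent form of the fluctuation `ξ - λ` -/

/-- The constant in the bound of the Dirichlet form of a difference of two elements of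
`ratioCone`. -/
noncomputable def dirichletConst (E : ℝ) : ℝ := (1 + E) * (6 * E ^ 2) + 2 * E

/-- The constant in the bound of the quadratic variation of the resolvent form. -/
noncomputable def noiseConst (E Λ : ℝ) : ℝ := 32 * Real.exp (3 * E) * E ^ 2 * (1 + Λ ^ 2)

/-- The exponential growth rate of the resolvent form. -/
noncomputable def formRate (E Λ : ℝ) : ℝ := 4 * growth E + noiseConst E Λ

/-- The range of the spectral parameter `κ` of the resolvent. -/
structure IsAdmissible (E : ℝ) (N : ℕ) (κ : ℝ) : Prop where
  growth_le : 2 * growth E ≤ κ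
  one_le : 1 ≤ κ
  dirichlet_le : 2 * (dirichletConst E * Real.exp E) ≤ κ
  le_size : κ ≤ N

theorem dirichletConst_pos {E : ℝ} (hE : 0 < E) : 0 < dirichletConst E := by
  unfold dirichletConst; positivity

theorem noiseConst_pos {E : ℝ} (hE : 0 < E) (Λ : ℝ) : 0 < noiseConst E Λ := by
  unfold noiseConst; positivity

theorem formRate_pos {E : ℝ} (hE : 0 < E) (Λ : ℝ) : 0 < formRate E Λ := by
  unfold formRate
  linarith [growth_pos hE, noiseConst_pos hE Λ]

/-- Elements of `ratioCone` have gradients bounded by `E` times their values. -/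
theorem energy_le_of_mem_ratioCone {E : ℝ} (hE : 0 < E) {N : ℕ} (hN : 2 ≤ N) {f : Fin N → ℝ}
    (hf : f ∈ ratioCone E N) : energy N f ≤ E ^ 2 * meanSq N f := by
  have hN' : (0 : ℝ) < N := by positivity
  have hnn := ratioCone_nonneg hf
  unfold energy meanSq
  rw [sum_fin_eq_sum_range (fun _ x => x ^ 2)]
  calc N * ∑ j ∈ Finset.range (N - 1), (extend f (j + 1) - extend f j) ^ 2
      ≤ N * ∑ j ∈ Finset.range (N - 1), (E / N) ^ 2 * extend f j ^ 2 := by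
        refine mul_le_mul_of_nonneg_left (Finset.sum_le_sum fun j hj => ?_) hN'.le
        have h := hf.2 j (by have := Finset.mem_range.1 hj; omega)
        rw [← mul_pow]
        exact pow_le_pow_left₀ (by linarith) (by linarith) 2
    _ ≤ N * ((E / N) ^ 2 * ∑ j ∈ Finset.range N, extend f j ^ 2) := by
        rw [← Finset.mul_sum]
        gcongr
        exact Nat.sub_le N 1
    _ = E ^ 2 * (1 / N * ∑ j ∈ Finset.range N, extend f j ^ 2) := by field_simp

theorem meanSq_le_of_abs_le {N : ℕ} (hN : 2 ≤ N) {f : Fin N → ℝ} {Λ : ℝ}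
    (hf : ∀ j, |f j| ≤ Λ) : meanSq N f ≤ Λ ^ 2 := by
  have hN' : (0 : ℝ) < N := by positivity
  unfold meanSq
  calc 1 / N * ∑ j : Fin N, f j ^ 2 ≤ 1 / N * ∑ _j : Fin N, Λ ^ 2 := by
        refine mul_le_mul_of_nonneg_left (Finset.sum_le_sum fun j _ => ?_) (by positivity)
        exact sq_le_sq' (abs_le.1 (hf j)).1 (abs_le.1 (hf j)).2
    _ = Λ ^ 2 := by simp; field_simp

theorem meanSq_le_two {N : ℕ} (f g : Fin N → ℝ) :
    meanSq N f ≤ 2 * meanSq N (f - g) + 2 * meanSq N g := by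
  unfold meanSq
  have : ∑ j, f j ^ 2 ≤ 2 * ∑ j, (f - g) j ^ 2 + 2 * ∑ j, g j ^ 2 := by
    rw [Finset.mul_sum, Finset.mul_sum, ← Finset.sum_add_distrib]
    refine Finset.sum_le_sum fun j _ => ?_
    simp only [Pi.sub_apply]
    nlinarith [sq_nonneg (f j - 2 * g j)]
  have := mul_le_mul_of_nonneg_left this (show (0 : ℝ) ≤ 1 / N by positivity)
  linarith

theorem energy_sub_le {N : ℕ} (f g : Fin N → ℝ) :
    energy N (f - g) ≤ 2 * energy N f + 2 * energy N g := by
  unfold energy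
  have : ∑ j ∈ Finset.range (N - 1), (extend (f - g) (j + 1) - extend (f - g) j) ^ 2
      ≤ 2 * ∑ j ∈ Finset.range (N - 1), (extend f (j + 1) - extend f j) ^ 2
        + 2 * ∑ j ∈ Finset.range (N - 1), (extend g (j + 1) - extend g j) ^ 2 := by
    rw [Finset.mul_sum, Finset.mul_sum, ← Finset.sum_add_distrib]
    refine Finset.sum_le_sum fun j _ => ?_
    rw [extend_sub, extend_sub]
    nlinarith [sq_nonneg ((extend f (j + 1) - extend f j) + (extend g (j + 1) - extend g j))]
  have := mul_le_mul_of_nonneg_left this (show (0 : ℝ) ≤ N by positivity)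
  linarith

section Form

variable {E α β κ Λ : ℝ} {N : ℕ} {G : (Fin N → ℝ) →L[ℝ] (Fin N → ℝ)}

theorem energy_sub_le_of_mem_ratioCone (hE : 0 < E) (hN : 2 ≤ N) {f l : Fin N → ℝ}
    (hf : f ∈ ratioCone E N) (hl : l ∈ ratioCone E N) (hlΛ : ∀ j, |l j| ≤ Λ) :
    energy N (f - l) ≤ 6 * E ^ 2 * (meanSq N (f - l) + Λ ^ 2) := by
  have h1 := energy_sub_le f l
  have h2 := energy_le_of_mem_ratioCone hE hN hf
  have h3 := energy_le_of_mem_ratioCone hE hN hl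
  have h4 := meanSq_le_two f l
  have h5 := meanSq_le_of_abs_le hN hlΛ
  have h6 := meanSq_nonneg (f - l)
  have hE2 : 0 ≤ E ^ 2 := sq_nonneg E
  nlinarith [mul_le_mul_of_nonneg_left h4 hE2, mul_le_mul_of_nonneg_left h5 hE2,
    mul_nonneg hE2 h6]

/-- For differences of elements of `ratioCone`, which are Lipschitz functions, the resolvent form
controls the `L²` norm up to an error of order `1/κ`. -/
theorem IsResolvent.meanSq_le (hG : IsResolvent E α β N κ G) (hE : 0 < E)
    (hα : α ∈ Set.Ioo (0 : ℝ) 1) (hβ : β ∈ Set.Ioo (0 : ℝ) 1) (hN : 2 ≤ N)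
    (hκ : IsAdmissible E N κ) {f l : Fin N → ℝ} (hf : f ∈ ratioCone E N)
    (hl : l ∈ ratioCone E N) (hlΛ : ∀ j, |l j| ≤ Λ) :
    meanSq N (f - l) ≤ Real.exp E *
      (2 * κ * innerW E N (f - l) (G (f - l)) + 2 * dirichletConst E * Λ ^ 2 / κ) := by
  have hκ0 : 0 < κ := by linarith [hκ.one_le]
  set Z := f - l with hZ
  have h1 := hG.interpolation hE hα.1 hβ.2 hN hκ.growth_le Z
  have h2 := neg_innerW_Omega_self_le hE hα.2 hβ.1 hN Z
  have h3 := energy_sub_le_of_mem_ratioCone hE hN hf hl hlΛ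
  rw [← hZ] at h3
  have h4 := le_innerW_self hE Z
  have h5 := meanSq_nonneg Z
  set Q := meanSq N Z
  set I := innerW E N Z Z
  set D := innerW E N Z (Omega E α β N Z)
  have hexp : Real.exp E * Real.exp (-E) = 1 := by rw [← Real.exp_add]; simp
  have hQI : Q ≤ Real.exp E * I := by
    calc Q = Real.exp E * (Real.exp (-E) * Q) := by linear_combination (-Q) * hexp
      _ ≤ _ := mul_le_mul_of_nonneg_left h4 (Real.exp_pos E).le
  have hD : -D ≤ dirichletConst E * (Q + Λ ^ 2) := by
    unfold dirichletConst
    have := mul_le_mul_of_nonneg_left h3 (show 0 ≤ 1 + E by linarith)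
    nlinarith [mul_nonneg hE.le (sq_nonneg Λ)]
  have hI0 : 0 ≤ I := innerW_self_nonneg hE Z
  have hD2 : 1 / κ * -D ≤ I / 2 + dirichletConst E * Λ ^ 2 / κ := by
    -- for large `κ` half of the `L²` norm absorbs the Dirichlet form of `f - l`
    have h6 : dirichletConst E * Q ≤ κ / 2 * I := by
      calc dirichletConst E * Q ≤ dirichletConst E * (Real.exp E * I) :=
            mul_le_mul_of_nonneg_left hQI (dirichletConst_pos hE).le
        _ = (2 * (dirichletConst E * Real.exp E)) / 2 * I := by ring
        _ ≤ κ / 2 * I := by gcongr; exact hκ.dirichlet_le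
    calc 1 / κ * -D ≤ 1 / κ * (κ / 2 * I + dirichletConst E * Λ ^ 2) := by
          gcongr; linarith
      _ = I / 2 + dirichletConst E * Λ ^ 2 / κ := by field_simp
  refine hQI.trans (mul_le_mul_of_nonneg_left ?_ (Real.exp_pos E).le)
  have : 2 * dirichletConst E * Λ ^ 2 / κ = 2 * (dirichletConst E * Λ ^ 2 / κ) := by ring
  rw [this]
  linarith

theorem norm_sq_le_meanSq (hN : 2 ≤ N) (f : Fin N → ℝ) : ‖f‖ ^ 2 ≤ N * meanSq N f := by
  have hN' : (0 : ℝ) < N := by positivity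
  have : ‖f‖ ≤ √(N * meanSq N f) := by
    rw [pi_norm_le_iff_of_nonneg (Real.sqrt_nonneg _)]
    intro j
    rw [Real.norm_eq_abs]
    refine Real.abs_le_sqrt ?_
    unfold meanSq
    rw [← mul_assoc, mul_one_div_cancel hN'.ne', one_mul]
    exact Finset.single_le_sum (f := fun j => f j ^ 2) (fun i _ => sq_nonneg _)
      (Finset.mem_univ j)
  calc ‖f‖ ^ 2 ≤ √(N * meanSq N f) ^ 2 := by gcongr
    _ = _ := Real.sq_sqrt (mul_nonneg hN'.le (meanSq_nonneg _))

theorem IsResolvent.norm_sub_sq_le (hG : IsResolvent E α β N κ G) (hE : 0 < E)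
    (hα : α ∈ Set.Ioo (0 : ℝ) 1) (hβ : β ∈ Set.Ioo (0 : ℝ) 1) (hN : 2 ≤ N)
    (hκ : IsAdmissible E N κ) {f l : Fin N → ℝ} (hf : f ∈ ratioCone E N)
    (hl : l ∈ ratioCone E N) (hlΛ : ∀ j, |l j| ≤ Λ) :
    ‖f - l‖ ^ 2 ≤ N * (Real.exp E * (2 * κ + 2 * dirichletConst E * Λ ^ 2 / κ)) *
      (1 + innerW E N (f - l) (G (f - l))) := by
  have hN' : (0 : ℝ) < N := by positivity
  have hκ0 : 0 < κ := by linarith [hκ.one_le]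
  have hΦ0 := hG.nonneg hE hα.1 hβ.2 hN hκ.growth_le (f - l)
  refine (norm_sq_le_meanSq hN _).trans ((mul_le_mul_of_nonneg_left
    (hG.meanSq_le hE hα hβ hN hκ hf hl hlΛ) hN'.le).trans ?_)
  rw [mul_assoc (N : ℝ), mul_assoc (Real.exp E)]
  gcongr
  have d0 : 0 ≤ 2 * dirichletConst E * Λ ^ 2 / κ := by
    have := dirichletConst_pos hE; positivity
  linarith [mul_nonneg d0 hΦ0]

/-- The contribution of the jumps to the second order part of the generator. -/
noncomputable def noise (E α β : ℝ) (N : ℕ) (G : (Fin N → ℝ) →L[ℝ] (Fin N → ℝ)) (ζ : Config N)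
    (w : ℤ) : ℝ :=
  (N : ℝ) ^ 2 * ∑ j : Fin N,
    ((1 + E / N) * (occ α β ζ j * (1 - occ α β ζ (j + 1))) *
        innerW E N (Pi.single j (((1 + E / N)⁻¹ - 1) * coleHopf E ζ w j))
          (G (Pi.single j (((1 + E / N)⁻¹ - 1) * coleHopf E ζ w j)))
      + occ α β ζ (j + 1) * (1 - occ α β ζ j) *
        innerW E N (Pi.single j (E / N * coleHopf E ζ w j))
          (G (Pi.single j (E / N * coleHopf E ζ w j))))

theorem IsResolvent.form_add (hG : IsResolvent E α β N κ G) (hE : 0 < E) (hN : 2 ≤ N)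
    (f g : Fin N → ℝ) : innerW E N (f + g) (G (f + g)) =
      innerW E N f (G f) + 2 * innerW E N g (G f) + innerW E N g (G g) := by
  rw [map_add, innerW_add_left, innerW_add_right, innerW_add_right, hG.innerW_comm hE hN f g]
  ring

/-- The generator acting on the resolvent form of `ξ - l`. -/
theorem IsResolvent.generator_form (hG : IsResolvent E α β N κ G) (hE : 0 < E) (hN : 3 ≤ N)
    (ζ : Config N) (w : ℤ) (l : Fin N → ℝ) :
    generator E α β N (fun ζ' =>
        innerW E N (coleHopf E ζ' (w + stepCurrent ζ ζ' 0) - l)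
          (G (coleHopf E ζ' (w + stepCurrent ζ ζ' 0) - l))) ζ =
      2 * innerW E N (Omega E α β N (coleHopf E ζ w)) (G (coleHopf E ζ w - l))
        + noise E α β N G ζ w := by
  have hN' : (N : ℝ) ≠ 0 := by positivity
  have hq : (1 + E / N) ≠ 0 := by positivity
  have hd : ∀ u : Fin N → ℝ, innerW E N (coleHopf E ζ w + u - l) (G (coleHopf E ζ w + u - l))
      - innerW E N (coleHopf E ζ w - l) (G (coleHopf E ζ w - l)) =
      2 * innerW E N u (G (coleHopf E ζ w - l)) + innerW E N u (G u) := by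
    intro u
    rw [add_sub_right_comm, hG.form_add hE (by omega)]
    ring
  rw [generator_coleHopf hE hN α β ζ w (fun x => innerW E N (x - l) (G (x - l)))]
  simp only [hd]
  have hΩ : innerW E N (Omega E α β N (coleHopf E ζ w)) (G (coleHopf E ζ w - l)) =
      (N : ℝ) ^ 2 * ∑ j : Fin N, 1 / N * (weight E N j *
        (E / N * (occ α β ζ (j + 1) - occ α β ζ j) * coleHopf E ζ w j)
          * G (coleHopf E ζ w - l) j) := by
    unfold innerW
    rw [Finset.mul_sum, Finset.mul_sum]
    refine Finset.sum_congr rfl fun j _ => ?_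
    rw [Omega_coleHopf hE (by omega)]
    ring
  rw [hΩ, noise, mul_left_comm, ← mul_add]
  congr 1
  rw [Finset.mul_sum, ← Finset.sum_add_distrib]
  refine Finset.sum_congr rfl fun j _ => ?_
  rw [innerW_single_left E j _ (G (coleHopf E ζ w - l)),
    innerW_single_left E j _ (G (coleHopf E ζ w - l))]
  have h2 : (1 + E / N) * ((1 + E / N)⁻¹ - 1) = -(E / N) := by
    rw [mul_sub, mul_inv_cancel₀ hq]; ring
  generalize weight E N j = a
  generalize coleHopf E ζ w j = b
  generalize G (coleHopf E ζ w - l) j = c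
  linear_combination (occ α β ζ j * (1 - occ α β ζ (j + 1)) * 2 * (1 / N) * a * b * c) * h2

/-- Each jump moves one coordinate of `ξ` by at most `(E/N) ξ(j)`, at rate of order `N²`; its effect on
the resolvent form is a diagonal element of the resolvent, bounded in `IsResolvent.diag_le`. -/
theorem IsResolvent.noise_le (hG : IsResolvent E α β N κ G) (hE : 0 < E)
    (hα : α ∈ Set.Ioo (0 : ℝ) 1) (hβ : β ∈ Set.Ioo (0 : ℝ) 1) (hN : 2 ≤ N)
    (hκ : IsAdmissible E N κ) (ζ : Config N) (w : ℤ) :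
    noise E α β N G ζ w ≤
      8 * Real.exp (2 * E) * E ^ 2 * (1 / (√κ * N)) * meanSq N (coleHopf E ζ w) := by
  have hN' : (0 : ℝ) < N := by positivity
  have hs : 0 < √κ := Real.sqrt_pos.2 (by linarith [hκ.one_le])
  have hq1 := one_le_ratio hE N
  have hq2 : 1 + E / N ≤ Real.exp E := by
    simpa using ratio_pow_le hE (N := N) (j := 1) (by omega)
  set e : ℝ := E / N with he
  have he0 : 0 < e := by positivity
  set K : ℝ := 4 * Real.exp E / (√κ * N ^ 2) with hK
  have hK0 : 0 ≤ K := by positivity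
  have hsmall : ((1 + e)⁻¹ - 1) ^ 2 ≤ e ^ 2 := by
    have h0 : (1 + e)⁻¹ - 1 = -e / (1 + e) := by field_simp; ring
    rw [h0, div_pow, neg_sq]
    exact div_le_self (sq_nonneg e) (one_le_pow₀ hq1)
  unfold noise meanSq
  rw [← he]
  have hterm : ∀ j : Fin N,
      ((1 + e) * (occ α β ζ j * (1 - occ α β ζ (j + 1))) *
        innerW E N (Pi.single j (((1 + e)⁻¹ - 1) * coleHopf E ζ w j))
          (G (Pi.single j (((1 + e)⁻¹ - 1) * coleHopf E ζ w j)))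
      + occ α β ζ (j + 1) * (1 - occ α β ζ j) *
        innerW E N (Pi.single j (e * coleHopf E ζ w j))
          (G (Pi.single j (e * coleHopf E ζ w j)))) ≤
      2 * Real.exp E * (K * (e ^ 2 * coleHopf E ζ w j ^ 2)) := by
    intro j
    have d1 := hG.diag_le hE hα.1 hβ.2 hN hκ.growth_le hκ.one_le j
      (((1 + e)⁻¹ - 1) * coleHopf E ζ w j)
    have d2 := hG.diag_le hE hα.1 hβ.2 hN hκ.growth_le hκ.one_le j (e * coleHopf E ζ w j)
    rw [← hK, mul_pow] at d1 d2
    have o1 := occ_mem hα hβ ζ j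
    have o2 := occ_mem hα hβ ζ (j + 1)
    set x := occ α β ζ j
    set y := occ α β ζ (j + 1)
    set c2 := coleHopf E ζ w j ^ 2
    have hc2 : 0 ≤ c2 := sq_nonneg _
    have hM0 : 0 ≤ K * (e ^ 2 * c2) := by positivity
    have d1' := d1.trans (mul_le_mul_of_nonneg_left (mul_le_mul_of_nonneg_right hsmall hc2) hK0)
    have p1 : 0 ≤ x * (1 - y) := mul_nonneg o1.1 (by linarith [o2.2])
    have p2 : 0 ≤ y * (1 - x) := mul_nonneg o2.1 (by linarith [o1.2])
    have p1' : x * (1 - y) ≤ 1 := by nlinarith [o1.1, o1.2, o2.1, o2.2]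
    have p2' : y * (1 - x) ≤ 1 := by nlinarith [o1.1, o1.2, o2.1, o2.2]
    have q1 : (1 + e) * (x * (1 - y)) ≤ Real.exp E := by nlinarith
    have q2 : y * (1 - x) ≤ Real.exp E := by linarith
    calc _ ≤ (1 + e) * (x * (1 - y)) * (K * (e ^ 2 * c2)) + y * (1 - x) * (K * (e ^ 2 * c2)) :=
          add_le_add (mul_le_mul_of_nonneg_left d1' (by positivity))
            (mul_le_mul_of_nonneg_left d2 p2)
      _ ≤ Real.exp E * (K * (e ^ 2 * c2)) + Real.exp E * (K * (e ^ 2 * c2)) := by gcongr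
      _ = _ := by ring
  calc _ ≤ (N : ℝ) ^ 2 * ∑ j : Fin N, 2 * Real.exp E * (K * (e ^ 2 * coleHopf E ζ w j ^ 2)) := by
        gcongr with j
        exact hterm j
    _ = _ := by
        simp only [← Finset.mul_sum]
        rw [hK, he, show 2 * E = E + E by ring, Real.exp_add]
        field_simp
        ring

/-- The differential inequality for the resolvent form of `ξ - l` when `l` evolves by `Ω`. All
constants are uniform in `N` and `κ`. -/
theorem IsResolvent.drift_add_noise_le (hG : IsResolvent E α β N κ G) (hE : 0 < E)
    (hα : α ∈ Set.Ioo (0 : ℝ) 1) (hβ : β ∈ Set.Ioo (0 : ℝ) 1) (hN : 2 ≤ N)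
    (hκ : IsAdmissible E N κ) (ζ : Config N) (w : ℤ) {l : Fin N → ℝ} (hl : l ∈ ratioCone E N)
    (hlΛ : ∀ j, |l j| ≤ Λ) :
    2 * innerW E N (Omega E α β N (coleHopf E ζ w - l)) (G (coleHopf E ζ w - l))
        + noise E α β N G ζ w ≤
      formRate E Λ * (innerW E N (coleHopf E ζ w - l) (G (coleHopf E ζ w - l))
        + 1 / (√κ * N)) := by
  have hN' : (0 : ℝ) < N := by positivity
  have hκ0 : 0 < κ := by linarith [hκ.one_le]
  have hs : 0 < √κ := Real.sqrt_pos.2 hκ0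
  have hs1 : 1 ≤ √κ := Real.one_le_sqrt.2 hκ.one_le
  have hsq : √κ * √κ = κ := Real.mul_self_sqrt hκ0.le
  have h1 := hG.drift_le hE hα.1 hβ.2 hN hκ.growth_le (coleHopf E ζ w - l)
  have h2 := hG.noise_le hE hα hβ hN hκ ζ w
  have h3 := meanSq_le_two (coleHopf E ζ w) l
  have h4 := meanSq_le_of_abs_le hN hlΛ
  have h5 := hG.meanSq_le hE hα hβ hN hκ (coleHopf_mem_ratioCone hE hN ζ w) hl hlΛ
  have h6 := hG.nonneg hE hα.1 hβ.2 hN hκ.growth_le (coleHopf E ζ w - l)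
  set Φ := innerW E N (coleHopf E ζ w - l) (G (coleHopf E ζ w - l))
  set b : ℝ := 1 / (√κ * N) with hb
  have hb0 : 0 < b := by positivity
  -- `b κ = √κ / N ≤ 1`, because `1 ≤ κ ≤ N`
  have hbκ : b * κ ≤ 1 := by
    rw [hb, div_mul_eq_mul_div, one_mul, div_le_one (by positivity)]
    have := hκ.le_size
    nlinarith
  -- the mean square of `ξ` in `noise_le` is controlled by `κ Φ` and the bound on `l`
  have hnoise : noise E α β N G ζ w ≤ noiseConst E Λ * (Φ + b) := by
    have hx : 1 ≤ Real.exp E := Real.one_le_exp hE.le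
    have e2 : Real.exp (2 * E) = Real.exp E * Real.exp E := by rw [← Real.exp_add]; ring_nf
    have e3 : Real.exp (3 * E) = Real.exp E * Real.exp E * Real.exp E := by
      rw [← Real.exp_add, ← Real.exp_add]; ring_nf
    have hd : Real.exp E * (2 * dirichletConst E * Λ ^ 2 / κ) ≤ Λ ^ 2 := by
      have : Real.exp E * (2 * dirichletConst E * Λ ^ 2 / κ) =
          (2 * (dirichletConst E * Real.exp E)) / κ * Λ ^ 2 := by ring
      rw [this]
      exact mul_le_of_le_one_left (sq_nonneg Λ) ((div_le_one hκ0).2 hκ.dirichlet_le)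
    have hm : meanSq N (coleHopf E ζ w) ≤ 4 * Real.exp E * (κ * Φ) + 4 * Λ ^ 2 := by nlinarith
    have hbm : b * meanSq N (coleHopf E ζ w) ≤ 4 * Real.exp E * (1 + Λ ^ 2) * (Φ + b) := by
      have k1 := mul_le_mul_of_nonneg_left hm hb0.le
      have k2 : b * (κ * Φ) ≤ Φ := by nlinarith
      have k3 : Real.exp E * (b * (κ * Φ)) ≤ Real.exp E * Φ :=
        mul_le_mul_of_nonneg_left k2 (Real.exp_pos E).le
      have k4 : b * Λ ^ 2 ≤ Real.exp E * (b * Λ ^ 2) :=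
        le_mul_of_one_le_left (by positivity) hx
      have k5 : 0 ≤ Real.exp E * (Λ ^ 2 * Φ) := by positivity
      have k6 : 0 ≤ Real.exp E * b := by positivity
      nlinarith
    unfold noiseConst
    rw [e3]
    rw [e2] at h2
    refine h2.trans ?_
    have := mul_le_mul_of_nonneg_left hbm
      (show 0 ≤ 8 * (Real.exp E * Real.exp E) * E ^ 2 by positivity)
    calc _ = 8 * (Real.exp E * Real.exp E) * E ^ 2 * (b * meanSq N (coleHopf E ζ w)) := by ring
      _ ≤ _ := this
      _ = _ := by ring
  unfold formRate
  have := mul_pos (growth_pos hE) hb0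
  nlinarith

/-! ### The resolvent form after a short time -/

theorem abs_innerW_le (hE : 0 < E) (f g : Fin N → ℝ) : |innerW E N f g| ≤ ‖f‖ * ‖g‖ := by
  rcases Nat.eq_zero_or_pos N with rfl | hN
  · simp only [innerW, Finset.univ_eq_empty, Finset.sum_empty, mul_zero, abs_zero]
    positivity
  have hN' : (0 : ℝ) < N := by exact_mod_cast hN
  unfold innerW
  rw [abs_mul, abs_of_pos (show (0 : ℝ) < 1 / N by positivity)]
  calc 1 / (N : ℝ) * |∑ j : Fin N, weight E N j * f j * g j|
      ≤ 1 / N * ∑ _j : Fin N, ‖f‖ * ‖g‖ := by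
        gcongr
        refine (Finset.abs_sum_le_sum_abs _ _).trans (Finset.sum_le_sum fun j _ => ?_)
        rw [abs_mul, abs_mul, abs_of_pos (weight_pos hE N j)]
        have h1 : |f j| ≤ ‖f‖ := norm_le_pi_norm f j
        have h2 : |g j| ≤ ‖g‖ := norm_le_pi_norm g j
        have h3 : weight E N j * |f j| ≤ 1 * ‖f‖ :=
          mul_le_mul (weight_le_one hE N j) h1 (abs_nonneg _) zero_le_one
        calc weight E N j * |f j| * |g j| ≤ (1 * ‖f‖) * ‖g‖ :=
              mul_le_mul h3 h2 (abs_nonneg _) (by positivity)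
          _ = _ := by ring
    _ = ‖f‖ * ‖g‖ := by simp; field_simp

theorem abs_form_le (hE : 0 < E) (G : (Fin N → ℝ) →L[ℝ] (Fin N → ℝ)) (f g : Fin N → ℝ) :
    |innerW E N f (G g)| ≤ ‖G‖ * ‖f‖ * ‖g‖ := by
  calc |innerW E N f (G g)| ≤ ‖f‖ * ‖G g‖ := abs_innerW_le hE f (G g)
    _ ≤ ‖f‖ * (‖G‖ * ‖g‖) := by gcongr; exact G.le_opNorm g
    _ = _ := by ring

/-- Crude bound, with a constant depending on `N`, for the Cole-Hopf variables of an arbitrary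
configuration. -/
theorem norm_coleHopf_le (hE : 0 < E) (hN : 2 ≤ N) (ζ ζ' : Config N) (w : ℤ) :
    ‖coleHopf E ζ' (w + stepCurrent ζ ζ' 0)‖ ≤ Real.exp (-(gam E N / N) * (N + 1)) *
      ‖coleHopf E ζ w‖ := by
  have hg : 0 ≤ -(gam E N / N) := by rw [neg_gam_div hN]; exact log_ratio_nonneg hE N
  rw [pi_norm_le_iff_of_nonneg (by positivity)]
  intro i
  have h0 : coleHopf E ζ w ⟨0, by omega⟩ ≤ ‖coleHopf E ζ w‖ :=
    (le_abs_self _).trans (norm_le_pi_norm (coleHopf E ζ w) _)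
  refine le_trans ?_ (mul_le_mul_of_nonneg_left h0 (Real.exp_pos _).le)
  rw [Real.norm_of_nonneg (coleHopf_pos i).le]
  unfold coleHopf
  rw [← Real.exp_add, Real.exp_le_exp]
  have hm0 : mass ζ ((⟨0, by omega⟩ : Fin N) : ℕ) = 0 := by simp [mass]
  have hm : mass ζ' i ≤ N := by
    unfold mass
    calc ∑ k ∈ Finset.Icc 1 (i : ℕ), particle ζ' k ≤ ∑ _k ∈ Finset.Icc 1 (i : ℕ), (1 : ℝ) :=
          Finset.sum_le_sum fun k _ => (particle_mem ζ' k).2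
      _ = (i : ℕ) := by simp
      _ ≤ N := by exact_mod_cast i.2.le
  have hs : (-1 : ℝ) ≤ stepCurrent ζ ζ' 0 := by exact_mod_cast neg_one_le_stepCurrent ζ ζ' 0
  rw [hm0]
  push_cast
  nlinarith

/-- Replacing `exp (h Ω) l` by its first order expansion in the resolvent form. -/
theorem IsResolvent.form_expansion (hG : IsResolvent E α β N κ G) (hE : 0 < E) (hN : 2 ≤ N)
    (hΛ : 0 ≤ Λ) : ∃ K : ℝ, 0 ≤ K ∧ ∀ (f l : Fin N → ℝ) (h : ℝ), 0 ≤ h → h ≤ 1 → ‖l‖ ≤ Λ →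
      innerW E N (f - NormedSpace.exp (h • Omega E α β N) l)
          (G (f - NormedSpace.exp (h • Omega E α β N) l))
        + h * (2 * innerW E N (Omega E α β N f)
          (G (f - NormedSpace.exp (h • Omega E α β N) l))) ≤
      innerW E N (f - l) (G (f - l))
        + h * (2 * innerW E N (Omega E α β N (f - l)) (G (f - l)))
        + K * h ^ 2 * (1 + ‖f‖ + Λ) ^ 2 := by
  set A := Omega E α β N
  set K₁ := ‖A‖ ^ 2 * Real.exp ‖A‖ with hK₁
  have hK₁0 : 0 ≤ K₁ := by positivity
  set c := ‖A‖ + K₁ with hc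
  have hc0 : 0 ≤ c := by positivity
  refine ⟨‖G‖ * (2 * K₁ + c ^ 2 + 2 * ‖A‖ * c), by positivity, ?_⟩
  intro f l h h0 h1 hl
  set l' := NormedSpace.exp (h • A) l
  set X := 1 + ‖f‖ + Λ with hX
  have hf0 := norm_nonneg f
  have hfX : ‖f‖ ≤ X := by linarith
  have hΛX : Λ ≤ X := by linarith
  have hX0 : 0 ≤ X := by linarith
  have hr : ‖l' - l - h • A l‖ ≤ K₁ * h ^ 2 * X := by
    refine (norm_exp_smul_sub_le A h0 h1 l).trans ?_
    gcongr
    exact hl.trans hΛX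
  have hu : ‖l - l'‖ ≤ c * h * X := by
    have e : l - l' = -((l' - l - h • A l) + h • A l) := by abel
    rw [e, norm_neg]
    refine (norm_add_le _ _).trans ?_
    have k1 : ‖h • A l‖ ≤ ‖A‖ * h * X := by
      rw [norm_smul, Real.norm_of_nonneg h0]
      calc h * ‖A l‖ ≤ h * (‖A‖ * X) := by
            gcongr
            exact (A.le_opNorm l).trans (by gcongr; exact hl.trans hΛX)
        _ = _ := by ring
    have k2 : K₁ * h ^ 2 * X ≤ K₁ * h * X := by
      have : h ^ 2 ≤ h := by nlinarith
      gcongr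
    calc _ ≤ K₁ * h * X + ‖A‖ * h * X := add_le_add (hr.trans k2) k1
      _ = c * h * X := by rw [hc]; ring
  have hZ : ‖f - l‖ ≤ X := by
    refine (norm_sub_le f l).trans ?_
    linarith
  have hAf : ‖A f‖ ≤ ‖A‖ * X := (A.le_opNorm f).trans (by gcongr)
  have e1 : f - l' = (f - l) + (l - l') := by abel
  have e2 : innerW E N (A f) (G (f - l')) =
      innerW E N (A f) (G (f - l)) + innerW E N (A f) (G (l - l')) := by
    rw [e1, map_add, innerW_add_right]
  -- the terms of first order in `h` combine to the drift of `f - l`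
  have e3 : innerW E N (l - l') (G (f - l)) =
      -innerW E N (l' - l - h • A l) (G (f - l)) - h * innerW E N (A l) (G (f - l)) := by
    rw [innerW_sub_left, innerW_sub_left, innerW_sub_left, innerW_smul_left]
    ring
  have b1 := (neg_le_abs _).trans (abs_form_le hE G (l' - l - h • A l) (f - l))
  have b2 := (le_abs_self _).trans (abs_form_le hE G (l - l') (l - l'))
  have b3 := (le_abs_self _).trans (abs_form_le hE G (A f) (l - l'))
  have b1' : ‖G‖ * ‖l' - l - h • A l‖ * ‖f - l‖ ≤ ‖G‖ * (K₁ * h ^ 2 * X) * X := by gcongr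
  have b2' : ‖G‖ * ‖l - l'‖ * ‖l - l'‖ ≤ ‖G‖ * (c * h * X) * (c * h * X) := by gcongr
  have b3' : ‖G‖ * ‖A f‖ * ‖l - l'‖ ≤ ‖G‖ * (‖A‖ * X) * (c * h * X) := by gcongr
  have b3'' := mul_le_mul_of_nonneg_left (b3.trans b3') h0
  rw [e2]
  rw [e1, hG.form_add hE hN, e3, map_sub A f l, innerW_sub_left E (A f)]
  linarith

/-- One step of size `h` of the Markov chain `(η, W^{0,1})`: up to an error of order `h²`, which is
not uniform in `N`, the resolvent form grows at a rate uniform in `N`. -/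
theorem IsResolvent.semigroup_form_le (hG : IsResolvent E α β N κ G) (hE : 0 < E)
    (hα : α ∈ Set.Ioo (0 : ℝ) 1) (hβ : β ∈ Set.Ioo (0 : ℝ) 1) (hN : 3 ≤ N)
    (hκ : IsAdmissible E N κ) (hΛ : 0 ≤ Λ) :
    ∃ h₀ : ℝ, 0 < h₀ ∧ ∀ (h : ℝ≥0) (ζ : Config N) (w : ℤ) (l : Fin N → ℝ), (h : ℝ) ≤ h₀ →
      l ∈ ratioCone E N → ‖l‖ ≤ Λ → ‖NormedSpace.exp ((h : ℝ) • Omega E α β N) l‖ ≤ Λ →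
      semigroup E α β N h (fun ζ' =>
          innerW E N (coleHopf E ζ' (w + stepCurrent ζ ζ' 0)
              - NormedSpace.exp ((h : ℝ) • Omega E α β N) l)
            (G (coleHopf E ζ' (w + stepCurrent ζ ζ' 0)
              - NormedSpace.exp ((h : ℝ) • Omega E α β N) l))) ζ + 1 / (√κ * N) ≤
        (1 + 2 * formRate E Λ * h) *
          (innerW E N (coleHopf E ζ w - l) (G (coleHopf E ζ w - l)) + 1 / (√κ * N)) := by
  have hN2 : 2 ≤ N := by omega
  have hN' : (0 : ℝ) < N := by positivity
  have hκ0 : 0 < κ := by linarith [hκ.one_le]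
  have hs : 0 < √κ := Real.sqrt_pos.2 hκ0
  obtain ⟨K, hK0, hK⟩ := hG.form_expansion hE hN2 hΛ
  set L := generator E α β N
  set K₁ := ‖L‖ ^ 2 * Real.exp ‖L‖ with hK₁
  have hK₁0 : 0 ≤ K₁ := by positivity
  set M := Real.exp (-(gam E N / N) * (N + 1)) with hM
  set K₂ := K₁ * (‖G‖ * (M + 1) ^ 2) + K with hK₂
  have hK₂0 : 0 ≤ K₂ := by positivity
  -- `‖ξ‖² ≤ K₃ (1 + Φ)`, with a constant depending on `N`
  set K₃ := N * (Real.exp E * (2 * κ + 2 * dirichletConst E * Λ ^ 2 / κ)) with hK₃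
  have hK₃0 : 0 ≤ K₃ := by have := dirichletConst_pos hE; positivity
  set b : ℝ := 1 / (√κ * N) with hb
  have hb0 : 0 < b := by positivity
  set K₄ := K₂ * (2 * (1 + 2 * Λ) ^ 2 + 2 * K₃) with hK₄
  have hK₄0 : 0 ≤ K₄ := by positivity
  have hC := formRate_pos hE Λ
  set C := formRate E Λ
  refine ⟨min 1 (C / (K₄ * (1 + 1 / b) + 1)), lt_min one_pos (by positivity), ?_⟩
  intro h ζ w l hh hl hlΛ hlΛ'
  have h0 : (0 : ℝ) ≤ h := h.2
  have h1 : (h : ℝ) ≤ 1 := hh.trans (min_le_left _ _)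
  have h2 : (h : ℝ) * (K₄ * (1 + 1 / b)) ≤ C := by
    have := hh.trans (min_le_right _ _)
    rw [le_div_iff₀ (by positivity)] at this
    linarith
  set l' := NormedSpace.exp ((h : ℝ) • Omega E α β N) l with hl'
  set g : Config N → ℝ := fun ζ' => innerW E N (coleHopf E ζ' (w + stepCurrent ζ ζ' 0) - l')
            (G (coleHopf E ζ' (w + stepCurrent ζ ζ' 0) - l')) with hg
  set ξ := coleHopf E ζ w with hξ
  set Φ := innerW E N (ξ - l) (G (ξ - l)) with hΦ
  have hΦ0 : 0 ≤ Φ := hG.nonneg hE hα.1 hβ.2 hN2 hκ.growth_le _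
  set X := 1 + ‖ξ‖ + Λ with hX
  have hX0 : 0 ≤ X := by positivity
  have hlj : ∀ j, |l j| ≤ Λ := fun j => (norm_le_pi_norm l j).trans hlΛ
  -- size of the test function
  have hgn : ‖g‖ ≤ ‖G‖ * (M + 1) ^ 2 * X ^ 2 := by
    rw [pi_norm_le_iff_of_nonneg (by positivity)]
    intro ζ'
    have k1 : ‖coleHopf E ζ' (w + stepCurrent ζ ζ' 0) - l'‖ ≤ (M + 1) * X := by
      refine (norm_sub_le _ _).trans ?_
      have := norm_coleHopf_le hE hN2 ζ ζ' w
      rw [← hM, ← hξ] at this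
      have hMpos : 0 ≤ M := (Real.exp_pos _).le
      have hxx : ‖ξ‖ ≤ X := by linarith
      have : M * ‖ξ‖ ≤ M * X := by gcongr
      have := norm_nonneg ξ
      linarith
    calc ‖g ζ'‖ ≤ ‖G‖ * ‖coleHopf E ζ' (w + stepCurrent ζ ζ' 0) - l'‖ *
          ‖coleHopf E ζ' (w + stepCurrent ζ ζ' 0) - l'‖ := abs_form_le hE G _ _
      _ ≤ ‖G‖ * ((M + 1) * X) * ((M + 1) * X) := by gcongr
      _ = _ := by ring
  -- second order expansion of the semigroup
  have hsg : semigroup E α β N h g ζ ≤ g ζ + h * L g ζ + K₁ * (‖G‖ * (M + 1) ^ 2) * h ^ 2 * X ^ 2 := by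
    have k := (norm_le_pi_norm _ ζ).trans (norm_exp_smul_sub_le L h0 h1 g)
    have k2 := (le_abs_self _).trans k
    have e : (NormedSpace.exp ((h : ℝ) • L) g - g - (h : ℝ) • L g) ζ =
        semigroup E α β N h g ζ - g ζ - h * L g ζ := rfl
    rw [e] at k2
    have : K₁ * (h : ℝ) ^ 2 * ‖g‖ ≤ K₁ * (h : ℝ) ^ 2 * (‖G‖ * (M + 1) ^ 2 * X ^ 2) := by gcongr
    rw [← hK₁] at k2
    linarith
  have hgζ : g ζ = innerW E N (ξ - l') (G (ξ - l')) := by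
    simp only [hg]
    rw [stepCurrent_self hN (by omega), add_zero]
  have hLg : L g ζ = 2 * innerW E N (Omega E α β N ξ) (G (ξ - l')) + noise E α β N G ζ w :=
    hG.generator_form hE hN ζ w l'
  have hexp := hK ξ l h h0 h1 hlΛ
  rw [← hl'] at hexp
  have hdrift := mul_le_mul_of_nonneg_left
    (hG.drift_add_noise_le hE hα hβ hN2 hκ ζ w hl hlj) h0
  rw [← hξ, ← hΦ, ← hb] at hdrift
  have hmain : semigroup E α β N h g ζ ≤ Φ + h * (C * (Φ + b)) + K₂ * h ^ 2 * X ^ 2 := by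
    rw [hgζ, hLg] at hsg
    rw [hK₂]
    linarith
  -- bound of `X` by the resolvent form
  have hX2 : X ^ 2 ≤ (2 * (1 + 2 * Λ) ^ 2 + 2 * K₃) * (1 + Φ) := by
    have k1 : ‖ξ - l‖ ^ 2 ≤ K₃ * (1 + Φ) := hG.norm_sub_sq_le hE hα hβ hN2 hκ
      (coleHopf_mem_ratioCone hE hN2 ζ w) hl hlj
    have k2 : X ≤ (1 + 2 * Λ) + ‖ξ - l‖ := by
      have : ‖ξ‖ ≤ ‖ξ - l‖ + ‖l‖ := by simpa using norm_add_le (ξ - l) l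
      rw [hX]
      linarith only [this, hlΛ]
    have k3 : X ^ 2 ≤ ((1 + 2 * Λ) + ‖ξ - l‖) ^ 2 := by gcongr
    have k4 := mul_nonneg (sq_nonneg (1 + 2 * Λ)) hΦ0
    have k5 := sq_nonneg ((1 + 2 * Λ) - ‖ξ - l‖)
    calc X ^ 2 ≤ 2 * (1 + 2 * Λ) ^ 2 + 2 * ‖ξ - l‖ ^ 2 := by linarith only [k3, k5]
      _ ≤ 2 * (1 + 2 * Λ) ^ 2 + 2 * (K₃ * (1 + Φ)) := by linarith only [k1]
      _ ≤ _ := by linarith only [k4]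
  -- for `h ≤ h₀` the error of order `h²` is at most the first order growth
  have hX3 : K₂ * (h : ℝ) ^ 2 * X ^ 2 ≤ h * (C * (Φ + b)) := by
    calc K₂ * (h : ℝ) ^ 2 * X ^ 2
        ≤ K₂ * (h : ℝ) ^ 2 * ((2 * (1 + 2 * Λ) ^ 2 + 2 * K₃) * (1 + Φ)) := by gcongr
      _ = h * (h * K₄ * (1 + Φ)) := by rw [hK₄]; ring
      _ ≤ h * (h * K₄ * ((1 + 1 / b) * (Φ + b))) := by
          gcongr
          have : (1 + 1 / b) * (Φ + b) = Φ + b + Φ / b + 1 := by field_simp; ring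
          rw [this]
          have : 0 ≤ Φ / b := by positivity
          linarith
      _ = h * (h * (K₄ * (1 + 1 / b)) * (Φ + b)) := by ring
      _ ≤ h * (C * (Φ + b)) := by gcongr
  calc semigroup E α β N h g ζ + b ≤ Φ + h * (C * (Φ + b)) + h * (C * (Φ + b)) + b := by linarith
    _ = (1 + 2 * C * h) * (Φ + b) := by ring

end Form

/-! ### Trajectories observed along a grid -/

/-- The `i`-th point of the grid which divides `[0,T]` into `n` intervals. -/
noncomputable def gridTime (T : ℝ≥0) (n i : ℕ) : ℝ≥0 := i * (T / n)

/-- The current through `{j, j+1}` computed from the observation of the trajectory at the first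
`i` points of the grid, as if at most one jump occurred between two of them. -/
noncomputable def gridCurrent {N : ℕ} (x : ℝ≥0 → Config N) (T : ℝ≥0) (n i j : ℕ) : ℤ :=
  ∑ k ∈ Finset.range i, stepCurrent (x (gridTime T n k)) (x (gridTime T n (k + 1))) j

theorem gridTime_zero (T : ℝ≥0) (n : ℕ) : gridTime T n 0 = 0 := by simp [gridTime]

theorem gridTime_succ (T : ℝ≥0) (n i : ℕ) : gridTime T n (i + 1) = gridTime T n i + T / n := by
  unfold gridTime; push_cast; ring

theorem gridTime_mono (T : ℝ≥0) (n : ℕ) : Monotone (gridTime T n) := by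
  intro i j h
  unfold gridTime
  gcongr

theorem gridTime_le {T : ℝ≥0} {n i : ℕ} (hi : i ≤ n) : gridTime T n i ≤ T := by
  rcases Nat.eq_zero_or_pos n with rfl | hn
  · simp [gridTime]
  · have hn' : (n : ℝ≥0) ≠ 0 := by positivity
    calc gridTime T n i ≤ gridTime T n n := gridTime_mono T n hi
      _ = T := by unfold gridTime; field_simp

/-- On a fine grid every time is followed closely by a point of the grid. -/
theorem exists_gridTime_mem {T t ε : ℝ≥0} (hT : 0 < T) (ht : t ≤ T) {n : ℕ} (hn : 0 < n)
    (hε : T / n < ε) : ∃ i ≤ n, t ≤ gridTime T n i ∧ gridTime T n i < t + ε := by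
  have hn' : (0 : ℝ≥0) < n := by exact_mod_cast hn
  have hd : 0 < T / n := by positivity
  refine ⟨⌈t / (T / n)⌉₊, ?_, ?_, ?_⟩
  · rw [Nat.ceil_le, div_le_iff₀ hd]
    calc t ≤ T := ht
      _ = n * (T / n) := by field_simp
  · unfold gridTime
    calc t = t / (T / n) * (T / n) := by field_simp
      _ ≤ _ := by gcongr; exact Nat.le_ceil _
  · unfold gridTime
    calc (⌈t / (T / n)⌉₊ : ℝ≥0) * (T / n) ≤ (t / (T / n) + 1) * (T / n) := by
          gcongr; exact (Nat.ceil_lt_add_one zero_le).le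
      _ = t + T / n := by field_simp
      _ < t + ε := by gcongr

section Path

variable {N : ℕ} {x : ℝ≥0 → Config N}

/-- Right-continuity and existence of left limits. -/
def IsCadlag (x : ℝ≥0 → Config N) : Prop :=
  (∀ t, ContinuousWithinAt x (Set.Ici t) t) ∧ ∀ t, ∃ ζ, Tendsto x (𝓝[<] t) (𝓝 ζ)

/-- On `s` the trajectory has at most one jump, at time `t` and from the configuration `ζ`. -/
structure JumpsOnlyAt (x : ℝ≥0 → Config N) (s : Set ℝ≥0) (t : ℝ≥0) (ζ : Config N) : Prop where
  left_limit : Tendsto x (𝓝[<] t) (𝓝 ζ)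
  before : ∀ u ∈ s, u < t → x u = ζ
  after : ∀ u ∈ s, t ≤ u → x u = x t

/-- The state space is finite, hence a trajectory is constant on each side of `t` near `t`. -/
theorem IsCadlag.exists_jumpsOnlyAt (hx : IsCadlag x) (t : ℝ≥0) :
    ∃ ε > 0, ∃ ζ, JumpsOnlyAt x (Metric.ball t ε) t ζ := by
  obtain ⟨ζ, hζ⟩ := hx.2 t
  have h1 := hx.1 t
  unfold ContinuousWithinAt at h1
  rw [nhds_discrete, tendsto_pure] at h1
  have h2 := hζ
  rw [nhds_discrete, tendsto_pure] at h2
  obtain ⟨ε₁, hε₁, h1⟩ := Metric.eventually_nhds_iff.1 (eventually_nhdsWithin_iff.1 h1)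
  obtain ⟨ε₂, hε₂, h2⟩ := Metric.eventually_nhds_iff.1 (eventually_nhdsWithin_iff.1 h2)
  refine ⟨min ε₁ ε₂, lt_min hε₁ hε₂, ζ, hζ, fun u hu hut => ?_, fun u hu hut => ?_⟩
  · exact h2 (lt_of_lt_of_le (Metric.mem_ball.1 hu) (min_le_right _ _)) hut
  · exact h1 (lt_of_lt_of_le (Metric.mem_ball.1 hu) (min_le_left _ _)) hut

/-- By compactness, short intervals in `[0,T]` contain at most one jump. -/
theorem IsCadlag.exists_uniform (hx : IsCadlag x) (T : ℝ≥0) :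
    ∃ δ > 0, ∀ s ≤ T, ∃ t ζ, JumpsOnlyAt x (Metric.ball s δ) t ζ := by
  choose ε hε ζ h using hx.exists_jumpsOnlyAt
  have hcomp : IsCompact (Set.Icc (0 : ℝ≥0) T) := isCompact_Icc
  obtain ⟨δ, hδ, hball⟩ := lebesgue_number_lemma_of_metric (c := fun t => Metric.ball t (ε t))
    hcomp (fun t => Metric.isOpen_ball)
    (fun t _ => Set.mem_iUnion.2 ⟨t, Metric.mem_ball_self (hε t)⟩)
  refine ⟨δ, hδ, fun s hs => ?_⟩
  obtain ⟨t, ht⟩ := hball s ⟨zero_le, hs⟩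
  exact ⟨t, ζ t, (h t).left_limit, fun u hu => (h t).before u (ht hu),
    fun u hu => (h t).after u (ht hu)⟩

theorem JumpsOnlyAt.mono {s s' : Set ℝ≥0} {t : ℝ≥0} {ζ : Config N} (h : JumpsOnlyAt x s t ζ)
    (hs : s' ⊆ s) : JumpsOnlyAt x s' t ζ :=
  ⟨h.left_limit, fun u hu => h.before u (hs hu), fun u hu => h.after u (hs hu)⟩

theorem neBot_nhdsLT {u : ℝ≥0} (hu : 0 < u) : (𝓝[<] u).NeBot := nhdsLT_neBot_of_exists_lt ⟨0, hu⟩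

/-- At a time of continuity the left limit is the present configuration. -/
theorem JumpsOnlyAt.left_limit_eq {s s' t u : ℝ≥0} {ζ ζ' : Config N}
    (h : JumpsOnlyAt x (Set.Icc s s') t ζ) (hu : u ∈ Set.Ioc s s') (hut : u ≠ t)
    (hζ' : Tendsto x (𝓝[<] u) (𝓝 ζ')) : ζ' = x u := by
  have := neBot_nhdsLT (lt_of_le_of_lt zero_le hu.1)
  refine tendsto_nhds_unique hζ' (tendsto_const_nhds.congr' ?_)
  rcases lt_or_gt_of_ne hut with hlt | hgt
  · filter_upwards [Ioo_mem_nhdsLT hu.1] with v hv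
    rw [h.before u ⟨hu.1.le, hu.2⟩ hlt, h.before v ⟨hv.1.le, hv.2.le.trans hu.2⟩
      (hv.2.trans hlt)]
  · filter_upwards [Ioo_mem_nhdsLT hu.1, Ioo_mem_nhdsLT hgt] with v hv hv'
    rw [h.after u ⟨hu.1.le, hu.2⟩ hgt.le, h.after v ⟨hv.1.le, hv.2.le.trans hu.2⟩ hv'.1.le]

/-- If at most one jump occurs in `(s, s']`, the jumps of a given type (an admissible move, which
changes the configuration) are read off from the configurations at times `s` and `s'`. -/
theorem JumpsOnlyAt.ncard_jumps {s s' t : ℝ≥0} {ζ : Config N} (hss : s ≤ s')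
    (h : JumpsOnlyAt x (Set.Icc s s') t ζ) (move : Config N → Config N) (ok : Config N → Prop)
    [DecidablePred ok] (hmove : ∀ ζ, ok ζ → move ζ ≠ ζ) :
    {u | s < u ∧ u ≤ s' ∧ ∃ ζ', Tendsto x (𝓝[<] u) (𝓝 ζ') ∧ x u = move ζ' ∧ ok ζ'}.Finite ∧
      {u | s < u ∧ u ≤ s' ∧ ∃ ζ', Tendsto x (𝓝[<] u) (𝓝 ζ') ∧ x u = move ζ' ∧ ok ζ'}.ncard =
        if x s' = move (x s) ∧ ok (x s) then 1 else 0 := by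
  -- a jump can only occur at `t`
  have hsub : ∀ u, s < u → u ≤ s' → ∀ ζ', Tendsto x (𝓝[<] u) (𝓝 ζ') → x u = move ζ' → ok ζ' →
      u = t := by
    intro u h1 h2 ζ' h3 h4 h5
    by_contra hut
    have h6 := h.left_limit_eq ⟨h1, h2⟩ hut h3
    rw [← h6] at h4
    exact hmove ζ' h5 h4.symm
  by_cases ht : t ∈ Set.Ioc s s'
  · have := neBot_nhdsLT (lt_of_le_of_lt zero_le ht.1)
    have hxs : x s = ζ := h.before s ⟨le_rfl, hss⟩ ht.1
    have hxs' : x s' = x t := h.after s' ⟨hss, le_rfl⟩ ht.2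
    by_cases hok : x s' = move (x s) ∧ ok (x s)
    · have e : {u | s < u ∧ u ≤ s' ∧ ∃ ζ', Tendsto x (𝓝[<] u) (𝓝 ζ') ∧ x u = move ζ' ∧ ok ζ'}
          = {t} := by
        ext u
        constructor
        · rintro ⟨h1, h2, ζ', h3, h4, h5⟩
          exact hsub u h1 h2 ζ' h3 h4 h5
        · rintro rfl
          refine ⟨ht.1, ht.2, ζ, h.left_limit, ?_, ?_⟩
          · rw [← hxs', ← hxs]; exact hok.1
          · rw [← hxs]; exact hok.2
      rw [e, if_pos hok]
      exact ⟨Set.finite_singleton t, Set.ncard_singleton t⟩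
    · have e : {u | s < u ∧ u ≤ s' ∧ ∃ ζ', Tendsto x (𝓝[<] u) (𝓝 ζ') ∧ x u = move ζ' ∧ ok ζ'}
          = ∅ := by
        rw [Set.eq_empty_iff_forall_notMem]
        rintro u ⟨h1, h2, ζ', h3, h4, h5⟩
        have hut := hsub u h1 h2 ζ' h3 h4 h5
        subst hut
        have h6 := tendsto_nhds_unique h3 h.left_limit
        rw [h6, ← hxs] at h4 h5
        exact hok ⟨hxs'.trans h4, h5⟩
      rw [e, if_neg hok]
      exact ⟨Set.finite_empty, Set.ncard_empty _⟩
  · have hxx : x s' = x s := by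
      by_cases h1 : t ≤ s
      · rw [h.after s ⟨le_rfl, hss⟩ h1, h.after s' ⟨hss, le_rfl⟩ (h1.trans hss)]
      · have h2 : s' < t := by
          by_contra h3
          exact ht ⟨not_le.1 h1, not_lt.1 h3⟩
        rw [h.before s ⟨le_rfl, hss⟩ (not_le.1 h1), h.before s' ⟨hss, le_rfl⟩ h2]
    have e : {u | s < u ∧ u ≤ s' ∧ ∃ ζ', Tendsto x (𝓝[<] u) (𝓝 ζ') ∧ x u = move ζ' ∧ ok ζ'}
        = ∅ := by
      rw [Set.eq_empty_iff_forall_notMem]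
      rintro u ⟨h1, h2, ζ', h3, h4, h5⟩
      have hut := hsub u h1 h2 ζ' h3 h4 h5
      subst hut
      exact ht ⟨h1, h2⟩
    rw [e, if_neg (fun hh => hmove _ hh.2 (by rw [← hh.1, hxx]))]
    exact ⟨Set.finite_empty, Set.ncard_empty _⟩

/-- The number of events up to a point of the grid is the sum of the numbers in the cells. -/
theorem ncard_jumps_grid {T : ℝ≥0} {n : ℕ} (P : ℝ≥0 → Prop) (c : ℕ → ℕ)
    (h : ∀ k < n, {u | gridTime T n k < u ∧ u ≤ gridTime T n (k + 1) ∧ P u}.Finite ∧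
      {u | gridTime T n k < u ∧ u ≤ gridTime T n (k + 1) ∧ P u}.ncard = c k) :
    ∀ i ≤ n, {u | 0 < u ∧ u ≤ gridTime T n i ∧ P u}.Finite ∧
      {u | 0 < u ∧ u ≤ gridTime T n i ∧ P u}.ncard = ∑ k ∈ Finset.range i, c k := by
  intro i
  induction i with
  | zero =>
    intro _
    have e : {u | 0 < u ∧ u ≤ gridTime T n 0 ∧ P u} = ∅ := by
      rw [Set.eq_empty_iff_forall_notMem]
      rintro u ⟨h1, h2, -⟩
      rw [gridTime_zero] at h2
      exact absurd h1 (not_lt.2 h2)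
    rw [e]
    simp
  | succ i ih =>
    intro hi
    obtain ⟨f1, c1⟩ := ih (by omega)
    obtain ⟨f2, c2⟩ := h i (by omega)
    have hm := gridTime_mono T n (Nat.le_succ i)
    have e : {u | 0 < u ∧ u ≤ gridTime T n (i + 1) ∧ P u} =
        {u | 0 < u ∧ u ≤ gridTime T n i ∧ P u} ∪
          {u | gridTime T n i < u ∧ u ≤ gridTime T n (i + 1) ∧ P u} := by
      ext u
      constructor
      · rintro ⟨h1, h2, h3⟩
        rcases le_or_gt u (gridTime T n i) with h4 | h4
        · exact Or.inl ⟨h1, h4, h3⟩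
        · exact Or.inr ⟨h4, h2, h3⟩
      · rintro (⟨h1, h2, h3⟩ | ⟨h1, h2, h3⟩)
        · exact ⟨h1, h2.trans hm, h3⟩
        · exact ⟨lt_of_le_of_lt zero_le h1, h2, h3⟩
    have hd : Disjoint {u | 0 < u ∧ u ≤ gridTime T n i ∧ P u}
        {u | gridTime T n i < u ∧ u ≤ gridTime T n (i + 1) ∧ P u} := by
      rw [Set.disjoint_left]
      rintro u ⟨-, h2, -⟩ ⟨h1, -, -⟩
      exact absurd h1 (not_lt.2 h2)
    rw [e]
    exact ⟨f1.union f2, by rw [Set.ncard_union_eq hd f1 f2, c1, c2, Finset.sum_range_succ]⟩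

/-- On a sufficiently fine grid the current is exactly the one observed along the grid. -/
theorem IsCadlag.current_eq_gridCurrent (hx : IsCadlag x) (hN : 3 ≤ N) (T : ℝ≥0) :
    ∃ n₀ : ℕ, ∀ n ≥ n₀, ∀ i ≤ n, ∀ j < N,
      current x (gridTime T n i) j = gridCurrent x T n i j := by
  classical
  obtain ⟨δ, hδ, hball⟩ := hx.exists_uniform T
  obtain ⟨n₀, hn₀⟩ := exists_nat_gt ((T : ℝ) / δ)
  refine ⟨n₀ + 1, fun n hn i hi j hj => ?_⟩
  have hn' : (0 : ℝ) < n := by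
    have : 0 < n := by omega
    exact_mod_cast this
  have hmesh : (T : ℝ) / n < δ := by
    rw [div_lt_comm₀ hn' hδ]
    refine hn₀.trans_le ?_
    exact_mod_cast (by omega : n₀ ≤ n)
  have hone : ∀ k < n, ∃ t ζ,
      JumpsOnlyAt x (Set.Icc (gridTime T n k) (gridTime T n (k + 1))) t ζ := by
    intro k hk
    obtain ⟨t, ζ, h⟩ := hball (gridTime T n k) (gridTime_le hk.le)
    refine ⟨t, ζ, h.mono fun u hu => ?_⟩
    rw [Metric.mem_ball, NNReal.dist_eq, abs_of_nonneg (sub_nonneg.2 (by exact_mod_cast hu.1))]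
    have : (u : ℝ) ≤ gridTime T n k + T / n := by
      have := hu.2
      rw [gridTime_succ] at this
      exact_mod_cast this
    linarith
  have hR := ncard_jumps_grid (T := T) (n := n) (fun u => JumpsRight x j u)
    (fun k => if x (gridTime T n (k + 1)) = bondMove j (x (gridTime T n k)) ∧
      CanJumpRight (x (gridTime T n k)) j then 1 else 0)
    (fun k hk => by
      obtain ⟨t, ζ, h⟩ := hone k hk
      exact h.ncard_jumps (gridTime_mono T n (Nat.le_succ k)) (bondMove j)
        (fun ζ => CanJumpRight ζ j) (fun ζ => bondMove_ne_of_canJumpRight hN hj)) i hi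
  have hL := ncard_jumps_grid (T := T) (n := n) (fun u => JumpsLeft x j u)
    (fun k => if x (gridTime T n (k + 1)) = bondMove j (x (gridTime T n k)) ∧
      CanJumpLeft (x (gridTime T n k)) j then 1 else 0)
    (fun k hk => by
      obtain ⟨t, ζ, h⟩ := hone k hk
      exact h.ncard_jumps (gridTime_mono T n (Nat.le_succ k)) (bondMove j)
        (fun ζ => CanJumpLeft ζ j) (fun ζ => bondMove_ne_of_canJumpLeft hN hj)) i hi
  unfold current gridCurrent stepCurrent
  rw [hR.2, hL.2, Finset.sum_sub_distrib]
  push_cast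
  rfl

/-- The configuration and the currents are constant on a short interval to the right of `t`. -/
theorem IsCadlag.eventually_right_const (hx : IsCadlag x) (hN : 3 ≤ N) (t : ℝ≥0) :
    ∃ ε > 0, ∀ s, t ≤ s → s < t + ε → x s = x t ∧ ∀ j < N, current x s j = current x t j := by
  classical
  obtain ⟨ε, hε, ζ, h⟩ := hx.exists_jumpsOnlyAt t
  refine ⟨⟨ε, hε.le⟩, hε, fun s hts hs => ?_⟩
  have hsub : Set.Icc t s ⊆ Metric.ball t ε := by
    intro u hu
    rw [Metric.mem_ball, NNReal.dist_eq, abs_of_nonneg (sub_nonneg.2 (by exact_mod_cast hu.1))]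
    have h1 : (u : ℝ) ≤ s := by exact_mod_cast hu.2
    have h2 : (s : ℝ) < t + ε := by exact_mod_cast hs
    linarith
  have h' := h.mono hsub
  refine ⟨h'.after s ⟨hts, le_rfl⟩ hts, fun j hj => ?_⟩
  have hset : ∀ P : ℝ≥0 → Prop, (∀ u ∈ Set.Ioc t s, ¬ P u) →
      {u | 0 < u ∧ u ≤ s ∧ P u} = {u | 0 < u ∧ u ≤ t ∧ P u} := by
    intro P hP
    ext u
    constructor
    · rintro ⟨h1, h2, h3⟩
      refine ⟨h1, ?_, h3⟩
      by_contra h4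
      exact hP u ⟨not_le.1 h4, h2⟩ h3
    · rintro ⟨h1, h2, h3⟩
      exact ⟨h1, h2.trans hts, h3⟩
  unfold current
  rw [hset (fun u => JumpsRight x j u) ?_, hset (fun u => JumpsLeft x j u) ?_]
  · rintro u hu ⟨ζ', h1, h2, h3⟩
    have h4 := h'.left_limit_eq hu hu.1.ne' h1
    rw [← h4] at h2
    exact bondMove_ne_of_canJumpLeft hN hj h3 h2.symm
  · rintro u hu ⟨ζ', h1, h2, h3⟩
    have h4 := h'.left_limit_eq hu hu.1.ne' h1
    rw [← h4] at h2
    exact bondMove_ne_of_canJumpRight hN hj h3 h2.symm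

/-- Conservation of the number of particles: the variables `ξ` are functions of the present
configuration and of the current through the leftmost bond. -/
theorem xi_eq_coleHopf_grid (E : ℝ) (hN : 3 ≤ N) {T : ℝ≥0} {n i : ℕ}
    (hstep : ∀ k < i, IsStep (x (gridTime T n k)) (x (gridTime T n (k + 1))))
    (hcur : ∀ j < N, current x (gridTime T n i) j = gridCurrent x T n i j) (j : Fin N) :
    xi E x (gridTime T n i) j = coleHopf E (x (gridTime T n i)) (gridCurrent x T n i 0) j := by
  have hmass : mass (x (gridTime T n i)) j - mass (x 0) j =
      gridCurrent x T n i 0 - gridCurrent x T n i j := by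
    have h := Finset.sum_range_sub (fun k => mass (x (gridTime T n k)) j) i
    rw [gridTime_zero] at h
    rw [← h]
    unfold gridCurrent
    push_cast
    rw [← Finset.sum_sub_distrib]
    exact Finset.sum_congr rfl fun k hk => (hstep k (Finset.mem_range.1 hk)).mass_sub hN j.2
  unfold xi coleHopf
  rw [hcur j j.2]
  have e : ∑ k ∈ Finset.Icc 1 (j : ℕ), particle (x 0) k = mass (x 0) j := rfl
  rw [e]
  congr 2
  linarith

/-- The vector of the variables `ξ_t(j)`. -/
noncomputable def xiVec (E : ℝ) (x : ℝ≥0 → Config N) (t : ℝ≥0) : Fin N → ℝ := fun j => xi E x t j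

/-- The trajectory respects conservation of particles at time `t`, and the functional `Φ` of the
fluctuation `ξ_t - l_t` is at most `a`. -/
def IsGoodAt (E : ℝ) (l : ℝ → Fin N → ℝ) (Φ : (Fin N → ℝ) → ℝ) (a : ℝ) (x : ℝ≥0 → Config N)
    (t : ℝ≥0) : Prop :=
  (∃ w : ℤ, xiVec E x t = coleHopf E (x t) w) ∧ Φ (xiVec E x t - l t) ≤ a

/-- The observation of the trajectory along the grid reveals a failure of `IsGoodAt`. -/
def IsBadOnGrid (E : ℝ) (l : ℝ → Fin N → ℝ) (Φ : (Fin N → ℝ) → ℝ) (a : ℝ) (T : ℝ≥0) (n : ℕ)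
    (x : ℝ≥0 → Config N) : Prop :=
  (∃ k < n, ¬ IsStep (x (gridTime T n k)) (x (gridTime T n (k + 1)))) ∨
    ∃ i ≤ n, a < Φ (coleHopf E (x (gridTime T n i)) (gridCurrent x T n i 0) - l (gridTime T n i))

/-- A failure at some time `t ≤ T` is seen along every sufficiently fine grid: the point of the grid
that follows `t` has the same configuration and the same currents, and `l` has moved little. -/
theorem IsCadlag.eventually_isBadOnGrid (hx : IsCadlag x) (hN : 3 ≤ N) {E : ℝ}
    {l : ℝ → Fin N → ℝ} (hl : Continuous l) {Φ : (Fin N → ℝ) → ℝ} (hΦ : Continuous Φ) {a : ℝ}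
    {T : ℝ≥0} (hT : 0 < T) (hbad : ∃ t ≤ T, ¬ IsGoodAt E l Φ a x t) :
    ∃ n₀ : ℕ, ∀ n ≥ n₀, IsBadOnGrid E l Φ a T n x := by
  obtain ⟨t, htT, ht⟩ := hbad
  obtain ⟨n₁, hn₁⟩ := hx.current_eq_gridCurrent hN T
  obtain ⟨ε, hε, hright⟩ := hx.eventually_right_const hN t
  have hxi : ∀ s, t ≤ s → s < t + ε → xiVec E x s = xiVec E x t := by
    intro s h1 h2
    funext j
    unfold xiVec xi
    rw [(hright s h1 h2).2 j j.2]
  have hcont : ContinuousAt (fun s : ℝ≥0 => Φ (xiVec E x t - l s)) t := by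
    have : Continuous fun s : ℝ≥0 => Φ (xiVec E x t - l s) :=
      hΦ.comp (continuous_const.sub (hl.comp NNReal.continuous_coe))
    exact this.continuousAt
  have hΦt : ∃ ε' > 0, ∀ s, t ≤ s → s < t + ε' →
      a < Φ (xiVec E x t - l t) → a < Φ (xiVec E x t - l s) := by
    by_cases h : a < Φ (xiVec E x t - l t)
    · obtain ⟨ε', hε', h'⟩ := Metric.eventually_nhds_iff.1 (hcont.eventually_const_lt h)
      refine ⟨⟨ε', hε'.le⟩, hε', fun s h1 h2 _ => h' ?_⟩
      rw [NNReal.dist_eq, abs_of_nonneg (sub_nonneg.2 (by exact_mod_cast h1))]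
      have : (s : ℝ) < t + ε' := by exact_mod_cast h2
      linarith
    · exact ⟨1, one_pos, fun _ _ _ h' => absurd h' h⟩
  obtain ⟨ε', hε', hΦt⟩ := hΦt
  obtain ⟨n₂, hn₂⟩ := exists_nat_gt (T / min ε ε')
  refine ⟨max n₁ (n₂ + 1), fun n hn => ?_⟩
  have hnn₁ : n₁ ≤ n := (le_max_left _ _).trans hn
  have hnn₂ : n₂ + 1 ≤ n := (le_max_right _ _).trans hn
  have hn0 : 0 < n := by omega
  have hmesh : T / n < min ε ε' := by
    rw [div_lt_comm₀ (by exact_mod_cast hn0) (lt_min hε hε')]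
    refine hn₂.trans_le ?_
    exact_mod_cast (by omega : n₂ ≤ n)
  obtain ⟨i, hi, hti, hit⟩ := exists_gridTime_mem hT htT hn0 hmesh
  have hit1 : gridTime T n i < t + ε := hit.trans_le (by gcongr; exact min_le_left _ _)
  have hit2 : gridTime T n i < t + ε' := hit.trans_le (by gcongr; exact min_le_right _ _)
  by_contra hnot
  unfold IsBadOnGrid at hnot
  push Not at hnot
  obtain ⟨hsteps, hgrid⟩ := hnot
  have hch : xiVec E x (gridTime T n i) =
      coleHopf E (x (gridTime T n i)) (gridCurrent x T n i 0) := by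
    funext j
    exact xi_eq_coleHopf_grid E hN (fun k hk => hsteps k (by omega)) (hn₁ n hnn₁ i hi) j
  refine ht ⟨⟨gridCurrent x T n i 0, ?_⟩, ?_⟩
  · rw [← hxi _ hti hit1, hch, (hright _ hti hit1).1]
  · by_contra hlt
    have h1 := hΦt _ hti hit2 (not_le.1 hlt)
    have h2 := hgrid i hi
    rw [← hch, hxi _ hti hit1] at h2
    exact absurd h1 (not_lt.2 h2)

end Path

/-! ### The Markov property along a grid -/

/-- Functions of a random variable with finitely many values are integrable. -/
theorem integrable_comp_of_finite_range {Ω S : Type*} [MeasurableSpace Ω] [MeasurableSpace S]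
    [DiscreteMeasurableSpace S] {P : Measure Ω} [IsFiniteMeasure P] {X : Ω → S}
    (hX : Measurable X) {F : Finset S} (hF : ∀ ω, X ω ∈ F) (v : S → ℝ) :
    Integrable (fun ω => v (X ω)) P := by
  have hv : Measurable v := .of_discrete
  refine Integrable.of_bound (hv.comp hX).aestronglyMeasurable (∑ x ∈ F, |v x|)
    (Eventually.of_forall fun ω => ?_)
  exact Finset.single_le_sum (f := fun x => |v x|) (fun x _ => abs_nonneg _) (hF ω)

theorem setIntegral_eq_sum_fibers {Ω S : Type*} [MeasurableSpace Ω] {P : Measure Ω} {X : Ω → S}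
    {F : Finset S} (hF : ∀ ω, X ω ∈ F) (hX : ∀ x, MeasurableSet (X ⁻¹' {x})) {A : Set Ω}
    (hA : MeasurableSet A) {f : Ω → ℝ} (hf : Integrable f P) :
    ∫ ω in A, f ω ∂P = ∑ x ∈ F, ∫ ω in A ∩ X ⁻¹' {x}, f ω ∂P := by
  have e : A = ⋃ x ∈ F, A ∩ X ⁻¹' {x} := by
    ext ω
    simp only [Set.mem_iUnion, Set.mem_inter_iff, Set.mem_preimage, Set.mem_singleton_iff,
      exists_prop]
    exact ⟨fun h => ⟨X ω, hF ω, h, rfl⟩, fun ⟨_, _, h, _⟩ => h⟩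
  conv_lhs => rw [e]
  refine integral_biUnion_finset F (fun x _ => hA.inter (hX x)) ?_ (fun x _ => hf.integrableOn)
  intro x _ y _ hxy
  refine Set.disjoint_left.2 ?_
  rintro ω ⟨-, h1⟩ ⟨-, h2⟩
  exact hxy (h1.symm.trans h2)

section

variable {E α β : ℝ} {N : ℕ} {μ : Measure (Config N)} {Ω : Type*} {mΩ : MeasurableSpace Ω}
  {P : Measure Ω} {ℱ : Filtration ℝ≥0 mΩ} {η : ℝ≥0 → Ω → Config N}

theorem IsExclusionProcess.measurable (hη : IsExclusionProcess E α β μ P ℱ η) (t : ℝ≥0) :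
    Measurable (η t) := (hη.adapted t).mono (ℱ.le t) le_rfl

theorem IsExclusionProcess.isCadlag (hη : IsExclusionProcess E α β μ P ℱ η) (ω : Ω) :
    IsCadlag fun t => η t ω := ⟨hη.right_continuous ω, hη.left_limits ω⟩

/-- The Markov property for a function of the past and of the present. -/
theorem IsExclusionProcess.setIntegral_eq [IsFiniteMeasure P]
    (hη : IsExclusionProcess E α β μ P ℱ η)
    {s t : ℝ≥0} (hst : s ≤ t) {S : Type*} [MeasurableSpace S] [DiscreteMeasurableSpace S]
    {X : Ω → S} (hX : Measurable[ℱ s] X) {F : Finset S} (hF : ∀ ω, X ω ∈ F)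
    (g : S → Config N → ℝ) {A : Set Ω} (hA : MeasurableSet[ℱ s] A) :
    ∫ ω in A, g (X ω) (η t ω) ∂P =
      ∫ ω in A, semigroup E α β N (t - s) (g (X ω)) (η s ω) ∂P := by
  have hX' : Measurable X := hX.mono (ℱ.le s) le_rfl
  have hA' : MeasurableSet A := ℱ.le s A hA
  have hpre : ∀ x, MeasurableSet[ℱ s] (X ⁻¹' {x}) := fun x => hX (MeasurableSet.of_discrete)
  have hpre' : ∀ x, MeasurableSet (X ⁻¹' {x}) := fun x => ℱ.le s _ (hpre x)
  classical
  -- `X` takes finitely many values, which reduces the claim to fixed functions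
  have hint : ∀ (u : ℝ≥0) (v : S → Config N → ℝ), Integrable (fun ω => v (X ω) (η u ω)) P := by
    intro u v
    refine Integrable.of_bound (C := ∑ x ∈ F, ‖v x‖) ?_ (Eventually.of_forall fun ω => ?_)
    · have e : (fun ω => v (X ω) (η u ω)) =
          fun ω => ∑ x ∈ F, (X ⁻¹' {x}).indicator (fun ω => v x (η u ω)) ω := by
        funext ω
        rw [Finset.sum_eq_single (X ω)]
        · simp
        · intro y _ hy
          exact Set.indicator_of_notMem (fun h => hy h.symm) _
        · exact fun h => absurd (hF ω) h
      rw [e]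
      refine (Finset.measurable_fun_sum F fun x _ => ?_).aestronglyMeasurable
      have : Measurable (v x) := .of_discrete
      exact (this.comp (hη.measurable u)).indicator (hpre' x)
    · exact (norm_le_pi_norm (v (X ω)) _).trans
        (Finset.single_le_sum (f := fun x => ‖v x‖) (fun x _ => norm_nonneg _) (hF ω))
  rw [setIntegral_eq_sum_fibers hF hpre' hA' (hint t g),
    setIntegral_eq_sum_fibers hF hpre' hA'
      (hint s fun x => semigroup E α β N (t - s) (g x))]
  refine Finset.sum_congr rfl fun x _ => ?_
  have hB : MeasurableSet[ℱ s] (A ∩ X ⁻¹' {x}) := hA.inter (hpre x)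
  have hB' := ℱ.le s _ hB
  have hgx : Integrable (fun ω => g x (η t ω)) P :=
    integrable_comp_of_finite_range (F := Finset.univ) (hη.measurable t)
      (fun _ => Finset.mem_univ _) (g x)
  calc ∫ ω in A ∩ X ⁻¹' {x}, g (X ω) (η t ω) ∂P
      = ∫ ω in A ∩ X ⁻¹' {x}, g x (η t ω) ∂P :=
        setIntegral_congr_fun hB' fun ω hω => by
          have : X ω = x := hω.2
          simp only [this]
    _ = ∫ ω in A ∩ X ⁻¹' {x}, (P[fun ω => g x (η t ω) | ℱ s]) ω ∂P :=
        (setIntegral_condExp (ℱ.le s) hgx hB).symm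
    _ = ∫ ω in A ∩ X ⁻¹' {x}, semigroup E α β N (t - s) (g x) (η s ω) ∂P :=
        setIntegral_congr_ae hB' ((hη.markov (g x) s t hst).mono fun ω h _ => h)
    _ = _ := setIntegral_congr_fun hB' fun ω hω => by
          have : X ω = x := hω.2
          simp only [this]

/-- Maximal inequality for a nonnegative supermartingale in discrete time, with the supermartingale
property stated in integrated form. -/
theorem maximal_ineq_supermartingale [IsProbabilityMeasure P] {m : ℕ → MeasurableSpace Ω}
    (hm : ∀ i, m i ≤ mΩ) {V : ℕ → Ω → ℝ} {n : ℕ} (hmono : Monotone m)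
    (hVm : ∀ i, Measurable[m i] (V i)) (hVi : ∀ i, Integrable (V i) P) (hV0 : ∀ i ω, 0 ≤ V i ω)
    (hstep : ∀ i < n, ∀ A, MeasurableSet[m i] A → ∫ ω in A, V (i + 1) ω ∂P ≤ ∫ ω in A, V i ω ∂P)
    (a : ℝ) : a * P.real {ω | ∃ i ≤ n, a < V i ω} ≤ ∫ ω, V 0 ω ∂P := by
  set B : ℕ → Set Ω := fun i => {ω | ∃ k ≤ i, a < V k ω} with hB
  have hVm' : ∀ i, Measurable (V i) := fun i => (hVm i).mono (hm i) le_rfl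
  have hBm : ∀ i, MeasurableSet[m i] (B i) := by
    intro i
    have e : B i = ⋃ k ∈ Finset.range (i + 1), {ω | a < V k ω} := by
      ext ω
      simp [hB]
    rw [e]
    refine Finset.measurableSet_biUnion _ fun k hk => ?_
    have hk' : k ≤ i := Nat.lt_succ_iff.1 (Finset.mem_range.1 hk)
    exact hmono hk' _ (hVm k measurableSet_Ioi)
  have hBm' : ∀ i, MeasurableSet (B i) := fun i => hm i _ (hBm i)
  have hge : ∀ i, ∀ D : Set Ω, MeasurableSet D → (∀ ω ∈ D, a < V i ω) →
      a * P.real D ≤ ∫ ω in D, V i ω ∂P := by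
    intro i D hD h
    have : ∫ _ω in D, a ∂P ≤ ∫ ω in D, V i ω ∂P :=
      setIntegral_mono_on (integrable_const a).integrableOn (hVi i).integrableOn hD
        fun ω hω => (h ω hω).le
    rw [setIntegral_const, smul_eq_mul, mul_comm] at this
    exact this
  -- `B i` is the event that the level `a` has been passed up to time `i`
  have key : ∀ i ≤ n, a * P.real (B i) + ∫ ω in (B i)ᶜ, V i ω ∂P ≤ ∫ ω, V 0 ω ∂P := by
    intro i
    induction i with
    | zero =>
      intro _
      rw [← integral_add_compl (hBm' 0) (hVi 0)]
      gcongr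
      refine hge 0 _ (hBm' 0) ?_
      rintro ω ⟨k, hk, h⟩
      obtain rfl : k = 0 := by omega
      exact h
    | succ i ih =>
      intro hi
      refine le_trans ?_ (ih (by omega))
      have h1 := hstep i (by omega) (B i)ᶜ (hBm i).compl
      have hsub : B i ⊆ B (i + 1) := fun ω ⟨k, hk, h⟩ => ⟨k, by omega, h⟩
      have h2 := integral_inter_add_sdiff (μ := P) (s := (B i)ᶜ) (f := V (i + 1)) (hBm' (i + 1))
        (hVi (i + 1)).integrableOn
      have h3 : (B i)ᶜ \ B (i + 1) = (B (i + 1))ᶜ := by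
        ext ω
        exact ⟨fun h => h.2, fun h => ⟨fun h' => h (hsub h'), h⟩⟩
      have h4 := hge (i + 1) ((B i)ᶜ ∩ B (i + 1)) ((hBm' i).compl.inter (hBm' (i + 1))) (by
        rintro ω ⟨h5, k, hk, h6⟩
        rcases Nat.lt_or_ge k (i + 1) with h7 | h7
        · exact absurd ⟨k, by omega, h6⟩ h5
        · obtain rfl : k = i + 1 := by omega
          exact h6)
      have h5 : P.real (B (i + 1)) = P.real (B i) + P.real ((B i)ᶜ ∩ B (i + 1)) := by
        rw [← measureReal_inter_add_sdiff (s := B (i + 1)) (hBm' i),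
          Set.inter_eq_self_of_subset_right hsub]
        congr 2
        ext ω
        exact and_comm
      rw [h3] at h2
      rw [h5, mul_add]
      linarith
  refine le_trans ?_ (key n le_rfl)
  have := setIntegral_nonneg (μ := P) (hBm' n).compl (fun ω _ => hV0 n ω)
  have e : P.real {ω | ∃ i ≤ n, a < V i ω} = P.real (B n) := rfl
  rw [e]
  linarith

/-- The pair formed by the configuration and the observed current through `{0, 1}`. -/
noncomputable def gridState (η : ℝ≥0 → Ω → Config N) (T : ℝ≥0) (n i : ℕ) (ω : Ω) : Config N × ℤ :=
  (η (gridTime T n i) ω, gridCurrent (fun t => η t ω) T n i 0)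

theorem gridState_measurable (hη : IsExclusionProcess E α β μ P ℱ η) (T : ℝ≥0) (n i : ℕ) :
    Measurable[ℱ (gridTime T n i)] (gridState η T n i) := by
  have h : ∀ k ≤ i, Measurable[ℱ (gridTime T n i)] (η (gridTime T n k)) := fun k hk =>
    (hη.adapted _).mono (ℱ.mono (gridTime_mono T n hk)) le_rfl
  refine (h i le_rfl).prodMk ?_
  refine Finset.measurable_fun_sum _ fun k hk => ?_
  have hk' := Finset.mem_range.1 hk
  have hs : Measurable fun p : Config N × Config N => stepCurrent p.1 p.2 0 := .of_discrete
  exact hs.comp ((h k hk'.le).prodMk (h (k + 1) hk'))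

theorem abs_gridCurrent_le (x : ℝ≥0 → Config N) (T : ℝ≥0) (n i : ℕ) :
    |gridCurrent x T n i 0| ≤ i := by
  unfold gridCurrent
  refine (Finset.abs_sum_le_sum_abs _ _).trans ?_
  refine (Finset.sum_le_sum fun k _ => abs_stepCurrent_le _ _ 0).trans ?_
  simp

theorem gridState_mem (η : ℝ≥0 → Ω → Config N) (T : ℝ≥0) (n i : ℕ) (ω : Ω) :
    gridState η T n i ω ∈ (Finset.univ : Finset (Config N)) ×ˢ Finset.Icc (-(i : ℤ)) i := by
  rw [Finset.mem_product]
  refine ⟨Finset.mem_univ _, Finset.mem_Icc.2 ?_⟩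
  exact abs_le.1 (abs_gridCurrent_le (fun t => η t ω) T n i)

/-- In a time `h`, the process performs more than one jump with probability `O(h²)`. -/
theorem exists_semigroup_not_isStep_le (E α β : ℝ) (N : ℕ) : ∃ K : ℝ, 0 ≤ K ∧
    ∀ (h : ℝ≥0) (g : Config N → Config N → ℝ), (∀ ζ ζ', IsStep ζ ζ' → g ζ ζ' = 0) →
      (∀ ζ ζ', |g ζ ζ'| ≤ 1) → (h : ℝ) ≤ 1 →
      ∀ ζ, semigroup E α β N h (g ζ) ζ ≤ K * (h : ℝ) ^ 2 := by
  set L := generator E α β N with hL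
  refine ⟨‖L‖ ^ 2 * Real.exp ‖L‖, by positivity, fun h g hg hg1 hh ζ => ?_⟩
  have hn : ‖g ζ‖ ≤ 1 := (pi_norm_le_iff_of_nonneg zero_le_one).2 fun ζ' => hg1 ζ ζ'
  have k := (le_abs_self _).trans
    ((norm_le_pi_norm _ ζ).trans (norm_exp_smul_sub_le L h.2 hh (g ζ)))
  have e : (NormedSpace.exp ((h : ℝ) • L) (g ζ) - g ζ - (h : ℝ) • L (g ζ)) ζ =
        semigroup E α β N h (g ζ) ζ - g ζ ζ - h * L (g ζ) ζ := rfl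
  have e1 : g ζ ζ = 0 := hg ζ ζ (Or.inl rfl)
  -- the generator only sees configurations at one jump from `ζ`
  have e2 : L (g ζ) ζ = 0 := by
    rw [hL, generator_apply, Finset.sum_eq_zero, mul_zero]
    intro j hj
    rw [e1, hg ζ _ (Or.inr ⟨j, Finset.mem_range.1 hj, rfl⟩)]
    ring
  have k' : semigroup E α β N h (g ζ) ζ - g ζ ζ - h * L (g ζ) ζ ≤
      ‖L‖ ^ 2 * Real.exp ‖L‖ * (h : ℝ) ^ 2 * ‖g ζ‖ := k
  rw [e1, e2] at k'
  have : ‖L‖ ^ 2 * Real.exp ‖L‖ * (h : ℝ) ^ 2 * ‖g ζ‖ ≤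
      ‖L‖ ^ 2 * Real.exp ‖L‖ * (h : ℝ) ^ 2 * 1 := by gcongr
  linarith

theorem gridTime_succ_sub (T : ℝ≥0) (n k : ℕ) :
    gridTime T n (k + 1) - gridTime T n k = T / n := by
  rw [gridTime_succ, add_tsub_cancel_left]

/-- The probability that some cell of the grid contains more than one jump is of the order of the
mesh. -/
theorem exists_measureReal_not_isStep_le [IsProbabilityMeasure P]
    (hη : IsExclusionProcess E α β μ P ℱ η) (T : ℝ≥0) :
    ∃ K : ℝ, 0 ≤ K ∧ ∀ n : ℕ, 0 < n → (T : ℝ) / n ≤ 1 →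
      P.real {ω | ∃ k < n, ¬ IsStep (η (gridTime T n k) ω) (η (gridTime T n (k + 1)) ω)} ≤
        K / n := by
  classical
  obtain ⟨K, hK0, hK⟩ := exists_semigroup_not_isStep_le E α β N
  refine ⟨K * T ^ 2, by positivity, fun n hn hTn => ?_⟩
  have hn' : (0 : ℝ) < n := by exact_mod_cast hn
  let g : Config N → Config N → ℝ := fun ζ ζ' => if IsStep ζ ζ' then 0 else 1
  have hone : ∀ k, P.real {ω | ¬ IsStep (η (gridTime T n k) ω) (η (gridTime T n (k + 1)) ω)} ≤
      K * ((T : ℝ) / n) ^ 2 := by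
    intro k
    have hD : MeasurableSet
        {ω | ¬ IsStep (η (gridTime T n k) ω) (η (gridTime T n (k + 1)) ω)} := by
      have h1 := (hη.measurable (gridTime T n k)).prodMk (hη.measurable (gridTime T n (k + 1)))
      have h2 : MeasurableSet {p : Config N × Config N | ¬ IsStep p.1 p.2} := .of_discrete
      exact h1 h2
    have h1 := hη.setIntegral_eq (gridTime_mono T n (Nat.le_succ k))
      (hη.adapted (gridTime T n k)) (F := Finset.univ) (fun _ => Finset.mem_univ _) g
      (A := Set.univ) MeasurableSet.univ
    rw [gridTime_succ_sub, setIntegral_univ, setIntegral_univ] at h1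
    have h2 : ∫ ω, g (η (gridTime T n k) ω) (η (gridTime T n (k + 1)) ω) ∂P =
        P.real {ω | ¬ IsStep (η (gridTime T n k) ω) (η (gridTime T n (k + 1)) ω)} := by
      rw [← integral_indicator_one hD]
      congr 1
      funext ω
      by_cases h : IsStep (η (gridTime T n k) ω) (η (gridTime T n (k + 1)) ω) <;>
        simp [g, h, Set.indicator]
    rw [← h2, h1]
    have h3 : ∀ ω, semigroup E α β N (T / n) (g (η (gridTime T n k) ω)) (η (gridTime T n k) ω) ≤
        K * ((T : ℝ) / n) ^ 2 := by
      intro ω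
      have := hK (T / n) g (fun ζ ζ' h => by simp [g, h])
        (fun ζ ζ' => by by_cases h : IsStep ζ ζ' <;> simp [g, h]) (by simpa using hTn)
        (η (gridTime T n k) ω)
      simpa using this
    calc _ ≤ ∫ _ω, K * ((T : ℝ) / n) ^ 2 ∂P := by
          refine integral_mono ?_ (integrable_const _) h3
          exact integrable_comp_of_finite_range (F := Finset.univ)
            (hη.measurable (gridTime T n k)) (fun _ => Finset.mem_univ _)
            (fun ζ => semigroup E α β N (T / n) (g ζ) ζ)
      _ = _ := by simp
  have e : {ω | ∃ k < n, ¬ IsStep (η (gridTime T n k) ω) (η (gridTime T n (k + 1)) ω)} =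
      ⋃ k ∈ Finset.range n,
        {ω | ¬ IsStep (η (gridTime T n k) ω) (η (gridTime T n (k + 1)) ω)} := by
    ext ω
    simp
  rw [e]
  refine (measureReal_biUnion_finset_le _ _).trans ?_
  refine (Finset.sum_le_sum fun k _ => hone k).trans_eq ?_
  rw [Finset.sum_const, Finset.card_range, nsmul_eq_mul]
  field_simp

end

/-! ### Control of the resolvent form uniformly in time -/

/-- Semigroup property of `λ`. -/
theorem lamVec_add (E α β : ℝ) (ρ₀ : ℝ → ℝ) (N : ℕ) (s h : ℝ) :
    lamVec E α β ρ₀ N (s + h) =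
      NormedSpace.exp (h • Omega E α β N) (lamVec E α β ρ₀ N s) := by
  unfold lamVec
  have hc : Commute (h • Omega E α β N) (s • Omega E α β N) :=
    ((Commute.refl (Omega E α β N)).smul_right s).smul_left h
  let _ : NormedAlgebra ℚ ((Fin N → ℝ) →L[ℝ] (Fin N → ℝ)) :=
    NormedAlgebra.restrictScalars ℚ ℝ _
  rw [add_comm s h, add_smul, NormedSpace.exp_add_of_commute hc]
  rfl

/-- An upper bound of `λ` on `[0,T]`. -/
noncomputable def lamBound (E L : ℝ) (T : ℝ≥0) : ℝ := Real.exp (E + lamRate E L * T)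

section

variable {E α β κ L : ℝ} {N : ℕ} {ρ₀ : ℝ → ℝ} {μ : Measure (Config N)} {Ω : Type*}
  {mΩ : MeasurableSpace Ω} {P : Measure Ω} {ℱ : Filtration ℝ≥0 mΩ} {η : ℝ≥0 → Ω → Config N}
  {G : (Fin N → ℝ) →L[ℝ] (Fin N → ℝ)} {T : ℝ≥0}

theorem norm_lamVec_le (hE : 0 < E) (hα : α ∈ Set.Ioo (0 : ℝ) 1)
    (hβ : β ∈ Set.Ioo (0 : ℝ) 1) (hρ : IsProfile α β ρ₀ L) (hN : 2 ≤ N) {t : ℝ≥0} (ht : t ≤ T) :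
    ‖lamVec E α β ρ₀ N t‖ ≤ lamBound E L T := by
  rw [pi_norm_le_iff_of_nonneg (show 0 ≤ lamBound E L T from (Real.exp_pos _).le)]
  intro j
  have h := lamVec_bounds hE hα hβ hρ hN t.coe_nonneg (show (t : ℝ) ≤ T by exact_mod_cast ht) j
  rw [Real.norm_of_nonneg ((Real.exp_pos _).le.trans h.1)]
  exact h.2

/-- The resolvent form as a functional on functions on `Λ_N`. -/
noncomputable def resolventForm (E : ℝ) (N : ℕ) (G : (Fin N → ℝ) →L[ℝ] (Fin N → ℝ))
    (f : Fin N → ℝ) : ℝ := innerW E N f (G f)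

theorem continuous_resolventForm (E : ℝ) (N : ℕ) (G : (Fin N → ℝ) →L[ℝ] (Fin N → ℝ)) :
    Continuous (resolventForm E N G) := by
  unfold resolventForm innerW
  fun_prop

theorem continuous_lamVec (E α β : ℝ) (ρ₀ : ℝ → ℝ) (N : ℕ) :
    Continuous (lamVec E α β ρ₀ N) :=
  continuous_iff_continuousAt.2 fun t => (hasDerivAt_lamVec E α β ρ₀ N t).continuousAt

/-- The resolvent form is controlled along a fine grid, by the maximal inequality. -/
theorem measureReal_grid_form_le [IsProbabilityMeasure P]
    (hη : IsExclusionProcess E α β μ P ℱ η) (hG : IsResolvent E α β N κ G) (hE : 0 < E)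
    (hα : α ∈ Set.Ioo (0 : ℝ) 1) (hβ : β ∈ Set.Ioo (0 : ℝ) 1) (hρ : IsProfile α β ρ₀ L)
    (hN : 3 ≤ N) (hκ : IsAdmissible E N κ) {a : ℝ} (ha : 0 < a) :
    ∃ h₀ > 0, ∀ n : ℕ, 0 < n → (T : ℝ) / n ≤ h₀ →
      P.real {ω | ∃ i ≤ n, a < resolventForm E N G
        (coleHopf E (gridState η T n i ω).1 (gridState η T n i ω).2
          - lamVec E α β ρ₀ N (gridTime T n i))} ≤
      Real.exp (2 * formRate E (lamBound E L T) * T) *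
        (∫ ω, resolventForm E N G (coleHopf E (η 0 ω) 0 - lamInit E ρ₀ N) ∂P
          + 1 / (√κ * N)) / a := by
  have hN2 : 2 ≤ N := by omega
  have hΛ : 0 ≤ lamBound E L T := (Real.exp_pos _).le
  obtain ⟨h₀, hh₀, hone⟩ := hG.semigroup_form_le hE hα hβ hN hκ hΛ
  refine ⟨h₀, hh₀, fun n hn hTn => ?_⟩
  have hn' : (0 : ℝ) < n := by exact_mod_cast hn
  set Λ := lamBound E L T
  set C := formRate E Λ with hC
  have hC0 : 0 < C := formRate_pos hE Λ
  set b : ℝ := 1 / (√κ * N) with hb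
  have hb0 : 0 < b := by
    have : 0 < √κ := Real.sqrt_pos.2 (by linarith [hκ.one_le])
    positivity
  set h : ℝ≥0 := T / n with hh
  have hcoe : (h : ℝ) = T / n := by simp [hh]
  set r : ℝ := 1 + 2 * C * h with hr
  have hr1 : 1 ≤ r := by
    have : 0 ≤ 2 * C * (h : ℝ) := by positivity
    linarith
  have hr0 : 0 < r := by linarith
  let φ : ℕ → Config N × ℤ → ℝ := fun i p =>
    resolventForm E N G (coleHopf E p.1 p.2 - lamVec E α β ρ₀ N (gridTime T n i))
  have hφ0 : ∀ i p, 0 ≤ φ i p := fun i p => hG.nonneg hE hα.1 hβ.2 hN2 hκ.growth_le _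
  -- `V` is a nonnegative supermartingale: one step of the grid multiplies `Φ + b` by at most `r`
  let V : ℕ → Ω → ℝ := fun i ω => (φ i (gridState η T n i ω) + b) / r ^ i
  have hstate : ∀ i, Measurable (gridState η T n i) := fun i =>
    (gridState_measurable hη T n i).mono (ℱ.le _) le_rfl
  have hφi : ∀ i, Integrable (fun ω => φ i (gridState η T n i ω)) P := fun i =>
    integrable_comp_of_finite_range (hstate i) (gridState_mem η T n i) (φ i)
  have hVi : ∀ i, Integrable (V i) P := fun i =>
    ((hφi i).add (integrable_const b)).div_const _
  have hstep : ∀ i < n, ∀ A, MeasurableSet[ℱ (gridTime T n i)] A →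
      ∫ ω in A, V (i + 1) ω ∂P ≤ ∫ ω in A, V i ω ∂P := by
    intro i hi A hA
    let g : Config N × ℤ → Config N → ℝ := fun p ζ' =>
      φ (i + 1) (ζ', p.2 + stepCurrent p.1 ζ' 0)
    have hsucc : ∀ ω, φ (i + 1) (gridState η T n (i + 1) ω) =
        g (gridState η T n i ω) (η (gridTime T n (i + 1)) ω) := by
      intro ω
      simp only [g, gridState, gridCurrent, Finset.sum_range_succ]
    have hmk := hη.setIntegral_eq (gridTime_mono T n (Nat.le_succ i))
      (gridState_measurable hη T n i) (gridState_mem η T n i) g hA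
    rw [gridTime_succ_sub, ← hh] at hmk
    have hpt : ∀ ω, semigroup E α β N h (g (gridState η T n i ω)) (η (gridTime T n i) ω) + b ≤
        r * (φ i (gridState η T n i ω) + b) := by
      intro ω
      have hl : lamVec E α β ρ₀ N (gridTime T n (i + 1)) =
          NormedSpace.exp ((h : ℝ) • Omega E α β N) (lamVec E α β ρ₀ N (gridTime T n i)) := by
        rw [← lamVec_add, gridTime_succ]
        rfl
      have := hone h (η (gridTime T n i) ω) (gridState η T n i ω).2
        (lamVec E α β ρ₀ N (gridTime T n i)) (by rw [hcoe]; exact hTn)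
        (lamVec_mem_ratioCone hE hα hβ hρ hN2 (gridTime T n i).2)
        (norm_lamVec_le hE hα hβ hρ hN2 (gridTime_le hi.le))
        (by rw [← hl]; exact norm_lamVec_le hE hα hβ hρ hN2 (gridTime_le hi))
      rw [← hl] at this
      exact this
    have hsgi : Integrable (fun ω => semigroup E α β N h (g (gridState η T n i ω))
        (η (gridTime T n i) ω)) P :=
      integrable_comp_of_finite_range (hstate i) (gridState_mem η T n i)
        (fun p => semigroup E α β N h (g p) p.1)
    have hA' : MeasurableSet A := ℱ.le _ A hA
    have e1 : ∫ ω in A, (φ (i + 1) (gridState η T n (i + 1) ω) + b) ∂P =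
        ∫ ω in A, (semigroup E α β N h (g (gridState η T n i ω)) (η (gridTime T n i) ω) + b)
          ∂P := by
      rw [integral_add (hφi (i + 1)).integrableOn (integrable_const b).integrableOn,
        integral_add hsgi.integrableOn (integrable_const b).integrableOn, ← hmk]
      simp only [hsucc]
    have e2 : ∫ ω in A, (φ (i + 1) (gridState η T n (i + 1) ω) + b) ∂P ≤
        r * ∫ ω in A, (φ i (gridState η T n i ω) + b) ∂P := by
      rw [e1, ← integral_const_mul]
      exact setIntegral_mono (hsgi.add (integrable_const b)).integrableOn
        (((hφi i).add (integrable_const b)).const_mul r).integrableOn hpt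
    simp only [V]
    rw [integral_div, integral_div, div_le_div_iff₀ (by positivity) (by positivity), pow_succ]
    calc _ ≤ (r * ∫ ω in A, (φ i (gridState η T n i ω) + b) ∂P) * r ^ i := by gcongr
      _ = _ := by ring
  have hmax := maximal_ineq_supermartingale (P := P) (n := n) (m := fun i => ℱ (gridTime T n i))
    (fun i => ℱ.le _) (fun i j hij => ℱ.mono (gridTime_mono T n hij)) (V := V)
    (fun i => by
      have hv : Measurable fun p : Config N × ℤ => (φ i p + b) / r ^ i := .of_discrete
      exact hv.comp (gridState_measurable hη T n i))
    hVi (fun i ω => by have := hφ0 i (gridState η T n i ω); positivity) hstep (a / r ^ n)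
  have hsub : {ω | ∃ i ≤ n, a < φ i (gridState η T n i ω)} ⊆
      {ω | ∃ i ≤ n, a / r ^ n < V i ω} := by
    rintro ω ⟨i, hi, h⟩
    refine ⟨i, hi, ?_⟩
    have hp : r ^ i ≤ r ^ n := pow_le_pow_right₀ hr1 hi
    calc a / r ^ n ≤ a / r ^ i := by gcongr
      _ < V i ω := by
        simp only [V]
        gcongr
        linarith
  have hmono := measureReal_mono (μ := P) hsub
  have hV0 : ∫ ω, V 0 ω ∂P =
      ∫ ω, resolventForm E N G (coleHopf E (η 0 ω) 0 - lamInit E ρ₀ N) ∂P + b := by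
    have : ∀ ω, V 0 ω = resolventForm E N G (coleHopf E (η 0 ω) 0 - lamInit E ρ₀ N) + b := by
      intro ω
      simp [V, φ, gridState, gridTime_zero, gridCurrent, lamVec_zero]
    simp only [this]
    rw [integral_add _ (integrable_const b)]
    · simp
    · exact integrable_comp_of_finite_range (F := Finset.univ) (hη.measurable 0)
        (fun _ => Finset.mem_univ _)
        (fun ζ => resolventForm E N G (coleHopf E ζ 0 - lamInit E ρ₀ N))
  rw [hV0] at hmax
  have hI0 : 0 ≤ ∫ ω, resolventForm E N G (coleHopf E (η 0 ω) 0 - lamInit E ρ₀ N) ∂P :=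
    integral_nonneg fun ω => hG.nonneg hE hα.1 hβ.2 hN2 hκ.growth_le _
  generalize ∫ ω, resolventForm E N G (coleHopf E (η 0 ω) 0 - lamInit E ρ₀ N) ∂P = I₀ at *
  have hrn : r ^ n ≤ Real.exp (2 * C * T) := by
    calc r ^ n ≤ (Real.exp (2 * C * h)) ^ n := by
          gcongr
          rw [hr, add_comm]
          exact Real.add_one_le_exp _
      _ = Real.exp (2 * C * T) := by
          rw [← Real.exp_nat_mul, hcoe]
          congr 1
          field_simp
  have hp : P.real {ω | ∃ i ≤ n, a < φ i (gridState η T n i ω)} ≤ r ^ n * (I₀ + b) / a := by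
    rw [le_div_iff₀ ha]
    have h1 := mul_le_mul_of_nonneg_left hmono (show 0 ≤ a / r ^ n by positivity)
    have h2 := h1.trans hmax
    have h3 := mul_le_mul_of_nonneg_left h2 (show 0 ≤ r ^ n by positivity)
    calc _ = r ^ n * (a / r ^ n * P.real {ω | ∃ i ≤ n, a < φ i (gridState η T n i ω)}) := by
          field_simp
      _ ≤ _ := h3
  exact hp.trans (by gcongr)

/-- The resolvent form is controlled uniformly on `[0,T]`, and the variables `ξ` respect the
conservation of particles, up to an event of small outer probability. -/
theorem measure_not_isGoodAt_le [IsProbabilityMeasure P]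
    (hη : IsExclusionProcess E α β μ P ℱ η) (hG : IsResolvent E α β N κ G) (hE : 0 < E)
    (hα : α ∈ Set.Ioo (0 : ℝ) 1) (hβ : β ∈ Set.Ioo (0 : ℝ) 1) (hρ : IsProfile α β ρ₀ L)
    (hN : 3 ≤ N) (hκ : IsAdmissible E N κ) (hT : 0 < T) {a : ℝ} (ha : 0 < a) :
    P {ω | ∃ t ≤ T, ¬ IsGoodAt E (lamVec E α β ρ₀ N) (resolventForm E N G) a
        (fun s => η s ω) t} ≤
      ENNReal.ofReal (Real.exp (2 * formRate E (lamBound E L T) * T) *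
        (∫ ω, resolventForm E N G (coleHopf E (η 0 ω) 0 - lamInit E ρ₀ N) ∂P
          + 1 / (√κ * N)) / a) := by
  obtain ⟨K, hK0, hK⟩ := exists_measureReal_not_isStep_le hη T
  obtain ⟨h₀, hh₀, hgrid⟩ := measureReal_grid_form_le (T := T) hη hG hE hα hβ hρ hN hκ ha
  set c := Real.exp (2 * formRate E (lamBound E L T) * T) *
        (∫ ω, resolventForm E N G (coleHopf E (η 0 ω) 0 - lamInit E ρ₀ N) ∂P
          + 1 / (√κ * N)) / a with hc
  set D : ℕ → Set Ω := fun n => {ω | IsBadOnGrid E (lamVec E α β ρ₀ N) (resolventForm E N G) a T n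
    (fun s => η s ω)} with hD
  obtain ⟨n₁, hn₁⟩ := exists_nat_gt ((T : ℝ) / min 1 h₀)
  have hDn : ∀ n ≥ n₁ + 1, P (D n) ≤ ENNReal.ofReal (K / n + c) := by
    intro n hn
    have hn0 : 0 < n := by omega
    have hmesh : (T : ℝ) / n ≤ min 1 h₀ := by
      rw [div_le_comm₀ (by exact_mod_cast hn0) (lt_min one_pos hh₀)]
      refine hn₁.le.trans ?_
      exact_mod_cast (by omega : n₁ ≤ n)
    rw [← ofReal_measureReal]
    refine ENNReal.ofReal_le_ofReal ?_
    refine (measureReal_union_le _ _).trans (add_le_add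
      (hK n hn0 (hmesh.trans (min_le_left _ _))) (hgrid n hn0 (hmesh.trans (min_le_right _ _))))
  -- the failure set need not be measurable; it is covered by `liminf D n`, and the bounds on
  -- `P (D n)` pass to the limit since the sets `⋂ n ≥ m, D n` increase with `m`
  have hsub : {ω | ∃ t ≤ T, ¬ IsGoodAt E (lamVec E α β ρ₀ N) (resolventForm E N G) a
      (fun s => η s ω) t} ⊆ ⋃ m, ⋂ n ≥ m, D n := by
    intro ω hω
    obtain ⟨n₀, h⟩ := (hη.isCadlag ω).eventually_isBadOnGrid hN
      (continuous_lamVec E α β ρ₀ N) (continuous_resolventForm E N G) hT hω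
    exact Set.mem_iUnion.2 ⟨n₀, Set.mem_iInter₂.2 fun n hn => h n hn⟩
  refine (measure_mono hsub).trans ?_
  have hmono : Monotone fun m => ⋂ n ≥ m, D n := by
    intro m m' hm
    exact Set.biInter_subset_biInter_left fun n hn => le_trans hm hn
  rw [hmono.measure_iUnion]
  refine iSup_le fun m => ?_
  have hlim : Tendsto (fun n : ℕ => ENNReal.ofReal (K / n + c)) atTop (𝓝 (ENNReal.ofReal c)) := by
    refine ENNReal.tendsto_ofReal ?_
    simpa using (tendsto_const_div_atTop_nhds_zero_nat K).add_const c
  refine ge_of_tendsto hlim ?_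
  filter_upwards [eventually_ge_atTop (max m (n₁ + 1))] with n hn
  refine le_trans (measure_mono ?_) (hDn n ((le_max_right _ _).trans hn))
  exact Set.biInter_subset_of_mem (show n ≥ m from (le_max_left _ _).trans hn)

/-! ### The initial fluctuation -/

/-- Lipschitz bound for the exponential on a half line. -/
theorem abs_exp_mul_sub_exp_mul_le {c x y R : ℝ} (hc : 0 ≤ c) (hx : c * x ≤ R) (hy : c * y ≤ R) :
    |Real.exp (c * x) - Real.exp (c * y)| ≤ Real.exp R * (c * |x - y|) := by
  have key : ∀ u v : ℝ, u ≤ R → Real.exp u - Real.exp v ≤ Real.exp R * |u - v| := by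
    intro u v hu
    have h1 : Real.exp u - Real.exp v = Real.exp u * (1 - Real.exp (v - u)) := by
      rw [mul_sub, ← Real.exp_add, mul_one]; congr 2; ring
    have h2 : 1 - Real.exp (v - u) ≤ |u - v| := by
      have := Real.add_one_le_exp (v - u)
      have := le_abs_self (u - v)
      linarith
    rw [h1]
    calc Real.exp u * (1 - Real.exp (v - u)) ≤ Real.exp u * |u - v| := by gcongr
      _ ≤ Real.exp R * |u - v| := by gcongr
  have e : c * |x - y| = |c * x - c * y| := by rw [← mul_sub, abs_mul, abs_of_nonneg hc]
  rw [e, abs_le]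
  have k1 := key (c * x) (c * y) hx
  have k2 := key (c * y) (c * x) hy
  rw [abs_sub_comm (c * y)] at k2
  constructor <;> linarith

/-- At time `0` the fluctuation `ξ - λ` is of the order of `E/N` times the partial sums of
`η₀ - ρ₀`. -/
theorem coleHopf_zero_sub_lamInit_sq_le (hE : 0 < E) (hρ : IsProfile α β ρ₀ L) (hN : 2 ≤ N)
    (ζ : Config N) (j : Fin N) :
    (coleHopf E ζ 0 - lamInit E ρ₀ N) j ^ 2 ≤ E ^ 2 * Real.exp (2 * E) / N *
      (1 + (1 / √(N : ℝ) * ∑ k ∈ Finset.Icc 1 (j : ℕ),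
        (particle ζ k - ρ₀ ((k : ℝ) / N))) ^ 4) := by
  have hN' : (0 : ℝ) < N := by positivity
  set c := Real.log (1 + E / N) with hc
  have hc0 : 0 ≤ c := log_ratio_nonneg hE N
  have hcE : c ≤ E / N := log_ratio_le hE N
  set s := ∑ k ∈ Finset.Icc 1 (j : ℕ), (particle ζ k - ρ₀ ((k : ℝ) / N)) with hs
  set ρs := ∑ k ∈ Finset.Icc 1 (j : ℕ), ρ₀ ((k : ℝ) / N) with hρs
  have hse : s = mass ζ j - ρs := by rw [hs, Finset.sum_sub_distrib]; rfl
  have hjN : ((j : ℕ) : ℝ) ≤ N := by exact_mod_cast j.2.le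
  have hmass : mass ζ j ≤ N := by
    refine le_trans ?_ hjN
    unfold mass
    calc ∑ k ∈ Finset.Icc 1 (j : ℕ), particle ζ k ≤ ∑ _k ∈ Finset.Icc 1 (j : ℕ), (1 : ℝ) :=
          Finset.sum_le_sum fun k _ => (particle_mem ζ k).2
      _ = (j : ℕ) := by simp
  have hcN : ∀ y : ℝ, y ≤ N → c * y ≤ E := by
    intro y hy
    calc c * y ≤ c * N := by gcongr
      _ ≤ E / N * N := by gcongr
      _ = E := by field_simp
  have e1 : coleHopf E ζ 0 j = Real.exp (c * mass ζ j) := by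
    unfold coleHopf
    rw [hc, ← neg_gam_div hN]
    congr 1
    push_cast
    ring
  have e2 : lamInit E ρ₀ N j = Real.exp (c * ρs) := by
    rw [← extend_coe (lamInit E ρ₀ N) j, extend_lamInit hN j.2]
  have h1 : |(coleHopf E ζ 0 - lamInit E ρ₀ N) j| ≤ Real.exp E * (E / N * |s|) := by
    rw [Pi.sub_apply, e1, e2, hse]
    refine (abs_exp_mul_sub_exp_mul_le hc0 (hcN _ hmass)
      (hcN _ ((sum_profile_mem hρ j.2.le).2.trans hjN))).trans ?_
    gcongr
  have h2 : (1 / √(N : ℝ) * s) ^ 2 = s ^ 2 / N := by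
    rw [mul_pow, div_pow, Real.sq_sqrt hN'.le]; ring
  -- `u ≤ 1 + u²` passes from second to fourth moments
  have h3 : s ^ 2 / N ≤ 1 + (1 / √(N : ℝ) * s) ^ 4 := by
    have : (1 / √(N : ℝ) * s) ^ 4 = (s ^ 2 / N) ^ 2 := by rw [← h2]; ring
    rw [this]
    nlinarith [sq_nonneg (s ^ 2 / N - 1 / 2)]
  calc (coleHopf E ζ 0 - lamInit E ρ₀ N) j ^ 2
      = |(coleHopf E ζ 0 - lamInit E ρ₀ N) j| ^ 2 := (sq_abs _).symm
    _ ≤ (Real.exp E * (E / N * |s|)) ^ 2 := by gcongr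
    _ = E ^ 2 * Real.exp (2 * E) / N * (s ^ 2 / N) := by
        rw [mul_pow, mul_pow, sq_abs, show 2 * E = E + E by ring, Real.exp_add]
        field_simp
    _ ≤ _ := by gcongr

/-- The resolvent form at time `0` is of order `1/(κ N)`, by the moment assumption on the initial
distribution. -/
theorem integral_resolventForm_init_le [IsProbabilityMeasure μ]
    (hη : IsExclusionProcess E α β μ P ℱ η) (hG : IsResolvent E α β N κ G) (hE : 0 < E)
    (hα : α ∈ Set.Ioo (0 : ℝ) 1) (hβ : β ∈ Set.Ioo (0 : ℝ) 1) (hρ : IsProfile α β ρ₀ L)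
    (hN : 3 ≤ N) (hκ : IsAdmissible E N κ) {A : ℝ}
    (hA : ∀ k ∈ Finset.Icc 1 (N - 1), ∫ ζ, (1 / √(N : ℝ) * ∑ j ∈ Finset.Icc 1 k,
        (particle ζ j - ρ₀ ((j : ℝ) / N))) ^ 4 ∂μ ≤ A) :
    ∫ ω, resolventForm E N G (coleHopf E (η 0 ω) 0 - lamInit E ρ₀ N) ∂P ≤
      2 / κ * (E ^ 2 * Real.exp (2 * E) / N * (1 + A)) := by
  have hN2 : 2 ≤ N := by omega
  have hN' : (0 : ℝ) < N := by positivity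
  have hκ0 : 0 < κ := by linarith [hκ.one_le]
  set c := E ^ 2 * Real.exp (2 * E) / N with hc
  have hc0 : 0 ≤ c := by positivity
  have hint : ∀ f : Config N → ℝ, Integrable f μ := fun f =>
    integrable_comp_of_finite_range (X := id) (F := Finset.univ) measurable_id
      (fun _ => Finset.mem_univ _) f
  have hA0 : 0 ≤ A := by
    refine le_trans ?_ (hA 1 (Finset.mem_Icc.2 ⟨le_rfl, by omega⟩))
    exact integral_nonneg fun ζ => by positivity
  have hY : ∀ j : Fin N, ∫ ζ, (1 + (1 / √(N : ℝ) * ∑ k ∈ Finset.Icc 1 (j : ℕ),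
        (particle ζ k - ρ₀ ((k : ℝ) / N))) ^ 4) ∂μ ≤ 1 + A := by
    intro j
    rw [integral_add (hint _) (hint _)]
    have h1 : ∫ _ζ : Config N, (1 : ℝ) ∂μ = 1 := by simp
    rw [h1]
    gcongr
    by_cases hj : (j : ℕ) = 0
    · simp [hj, hA0]
    · exact hA j (Finset.mem_Icc.2 ⟨by omega, by have := j.2; omega⟩)
  have hmap : ∫ ω, resolventForm E N G (coleHopf E (η 0 ω) 0 - lamInit E ρ₀ N) ∂P =
      ∫ ζ, resolventForm E N G (coleHopf E ζ 0 - lamInit E ρ₀ N) ∂μ := by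
    rw [← hη.initial]
    have hf : Measurable fun ζ : Config N =>
        resolventForm E N G (coleHopf E ζ 0 - lamInit E ρ₀ N) := .of_discrete
    rw [integral_map (hη.measurable 0).aemeasurable hf.aestronglyMeasurable]
  rw [hmap]
  have hpt : ∀ ζ : Config N, resolventForm E N G (coleHopf E ζ 0 - lamInit E ρ₀ N) ≤
      2 / κ * (1 / N * ∑ j : Fin N, c * (1 + (1 / √(N : ℝ) * ∑ k ∈ Finset.Icc 1 (j : ℕ),
        (particle ζ k - ρ₀ ((k : ℝ) / N))) ^ 4)) := by
    intro ζ
    refine (hG.form_le hE hα.1 hβ.2 hN2 hκ.growth_le _).trans ?_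
    refine mul_le_mul_of_nonneg_left ((innerW_self_le hE _).trans ?_) (by positivity)
    unfold meanSq
    refine mul_le_mul_of_nonneg_left (Finset.sum_le_sum fun j _ => ?_) (by positivity)
    exact coleHopf_zero_sub_lamInit_sq_le hE hρ hN2 ζ j
  refine (integral_mono (hint _) (hint _) hpt).trans ?_
  rw [integral_const_mul, integral_const_mul, integral_finsetSum _ fun j _ => hint _]
  simp only [integral_const_mul]
  refine mul_le_mul_of_nonneg_left ?_ (by positivity)
  calc 1 / (N : ℝ) * ∑ j : Fin N, c * ∫ ζ, (1 + (1 / √(N : ℝ) * ∑ k ∈ Finset.Icc 1 (j : ℕ),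
        (particle ζ k - ρ₀ ((k : ℝ) / N))) ^ 4) ∂μ
      ≤ 1 / N * ∑ _j : Fin N, c * (1 + A) := by
        refine mul_le_mul_of_nonneg_left (Finset.sum_le_sum fun j _ => ?_) (by positivity)
        exact mul_le_mul_of_nonneg_left (hY j) hc0
    _ = c * (1 + A) := by simp; field_simp

end

/-! ### The fields along a fixed trajectory -/

section

variable {E α β L : ℝ} {N : ℕ} {ρ₀ : ℝ → ℝ} {x : ℝ≥0 → Config N} {t T : ℝ≥0}

theorem gam_neg (hE : 0 < E) (hN : 2 ≤ N) : gam E N < 0 := by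
  have hN' : (0 : ℝ) < N := by positivity
  have : 0 < Real.log (1 + E / N) := Real.log_pos (by have : 0 < E / N := by positivity
                                                      linarith)
  unfold gam
  nlinarith

theorem abs_inv_gam_le (hE : 0 < E) (hN : 2 ≤ N) : |1 / gam E N| ≤ (1 + E) / E := by
  have hN' : (2 : ℝ) ≤ N := by exact_mod_cast hN
  have hq : 0 < 1 + E / N := by positivity
  have h1 := Real.one_sub_inv_le_log_of_pos hq
  have h2 : E / (1 + E) ≤ N * (1 - (1 + E / N)⁻¹) := by
    have e : (N : ℝ) * (1 - (1 + E / N)⁻¹) = E * N / (N + E) := by field_simp; ring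
    rw [e, div_le_div_iff₀ (by positivity) (by positivity)]
    nlinarith [mul_pos hE hE]
  have h3 : E / (1 + E) ≤ -gam E N := by
    unfold gam
    nlinarith [mul_le_mul_of_nonneg_left h1 (show (0 : ℝ) ≤ N by linarith)]
  rw [abs_div, abs_one, abs_of_neg (gam_neg hE hN)]
  calc 1 / -gam E N ≤ 1 / (E / (1 + E)) := one_div_le_one_div_of_le (by positivity) h3
    _ = (1 + E) / E := by rw [one_div_div]

theorem abs_log_add_one_sub_le {y : ℝ} (hy : |y - 1| ≤ 1 / 2) :
    |Real.log y + 1 - y| ≤ 2 * (y - 1) ^ 2 := by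
  have hy' := abs_le.1 hy
  have hy0 : 1 / 2 ≤ y := by linarith
  have h1 := Real.log_le_sub_one_of_pos (show 0 < y by linarith)
  have h2 := Real.one_sub_inv_le_log_of_pos (show 0 < y by linarith)
  have h3 : y⁻¹ + y - 2 ≤ 2 * (y - 1) ^ 2 := by
    have e : y⁻¹ + y - 2 = y⁻¹ * (y - 1) ^ 2 := by
      have : y ≠ 0 := by linarith
      field_simp
      ring
    have h4 : y⁻¹ ≤ 2 := by
      rw [inv_le_comm₀ (by linarith) (by norm_num)]
      linarith
    rw [e]
    gcongr
  rw [abs_le]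
  constructor
  · linarith
  · nlinarith [sq_nonneg (y - 1)]

/-- The remainder is quadratic in the fluctuation `ξ - λ`. -/
theorem abs_remainder_le (hE : 0 < E) (hN : 2 ≤ N) {c C : ℝ} (hc : 0 < c)
    (hl : ∀ j < N, c ≤ lam E α β ρ₀ N t j) {g : ℕ → ℝ}
    (hC : ∀ j < N, |gradPlus N g j| / lam E α β ρ₀ N t j ≤ C)
    (hξ : ∀ j < N, |xi E x t j - lam E α β ρ₀ N t j| ≤ c / 2) :
    |remainder E α β ρ₀ x t g| ≤ C * ((1 + E) / E) * (2 / c) *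
      (√(N : ℝ) * meanSq N (xiVec E x t - lamVec E α β ρ₀ N t)) := by
  have hN' : (0 : ℝ) < N := by positivity
  have hl0 : ∀ j < N, 0 < lam E α β ρ₀ N t j := fun j hj => hc.trans_le (hl j hj)
  have hC0 : 0 ≤ C := le_trans (div_nonneg (abs_nonneg _) (hl0 0 (by omega)).le)
    (hC 0 (by omega))
  have hterm : ∀ j ∈ Finset.range N, |1 / gam E N * gradPlus N g j *
      (Real.log (xi E x t j / lam E α β ρ₀ N t j) + 1 - xi E x t j / lam E α β ρ₀ N t j)| ≤
      C * ((1 + E) / E) * (2 / c) * (xi E x t j - lam E α β ρ₀ N t j) ^ 2 := by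
    intro j hj
    have hj := Finset.mem_range.1 hj
    have h0 := hl0 j hj
    have hcl := hl j hj
    have hCj := (div_le_iff₀ h0).1 (hC j hj)
    have hxi := hξ j hj
    set l := lam E α β ρ₀ N t j
    set z := xi E x t j
    have hzl : z / l - 1 = (z - l) / l := by field_simp
    have h1 : |z / l - 1| ≤ 1 / 2 := by
      rw [hzl, abs_div, abs_of_pos h0, div_le_iff₀ h0]
      linarith
    rw [abs_mul, abs_mul]
    calc |1 / gam E N| * |gradPlus N g j| * |Real.log (z / l) + 1 - z / l|
        ≤ (1 + E) / E * (C * l) * (2 * (z / l - 1) ^ 2) := by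
          gcongr
          · exact abs_inv_gam_le hE hN
          · exact abs_log_add_one_sub_le h1
      _ = C * ((1 + E) / E) * (2 / l) * (z - l) ^ 2 := by
          rw [hzl]
          field_simp
      _ ≤ _ := by gcongr
  unfold remainder
  rw [abs_mul, abs_of_pos (by positivity : (0 : ℝ) < 1 / √(N : ℝ))]
  have hsum : meanSq N (xiVec E x t - lamVec E α β ρ₀ N t) =
      1 / N * ∑ j ∈ Finset.range N, (xi E x t j - lam E α β ρ₀ N t j) ^ 2 := by
    unfold meanSq
    rw [Finset.sum_range]
    congr 1
    exact Finset.sum_congr rfl fun j _ => by simp [xiVec, lam, extend_coe]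
  have hs : (N : ℝ) = √(N : ℝ) * √(N : ℝ) := (Real.mul_self_sqrt hN'.le).symm
  calc 1 / √(N : ℝ) * |∑ j ∈ Finset.range N, 1 / gam E N * gradPlus N g j *
      (Real.log (xi E x t j / lam E α β ρ₀ N t j) + 1 - xi E x t j / lam E α β ρ₀ N t j)|
      ≤ 1 / √(N : ℝ) * (C * ((1 + E) / E) * (2 / c) *
          ∑ j ∈ Finset.range N, (xi E x t j - lam E α β ρ₀ N t j) ^ 2) := by
        rw [Finset.mul_sum]
        gcongr
        exact (Finset.abs_sum_le_sum_abs _ _).trans (Finset.sum_le_sum hterm)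
    _ = _ := by
        rw [hsum]
        have : √(N : ℝ) / N = 1 / √(N : ℝ) := by
          rw [div_eq_div_iff hN'.ne' (Real.sqrt_pos.2 hN').ne', one_mul, ← hs]
        rw [← this]
        ring

theorem sum_range_by_parts (g F : ℕ → ℝ) (m : ℕ) :
    ∑ j ∈ Finset.range (m + 1), (g (j + 1) - g j) * F j =
      g (m + 1) * F m - g 0 * F 0 - ∑ j ∈ Finset.Ico 1 (m + 1), g j * (F j - F (j - 1)) := by
  induction m with
  | zero => simp; ring
  | succ m ih =>
    rw [Finset.sum_range_succ, ih, Finset.sum_Ico_succ_top (by omega : 1 ≤ m + 1)]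
    simp only [Nat.add_sub_cancel]
    ring

/-- Conservation of particles expresses the density through the Cole-Hopf variables, so that the
density field and the current field differ by the remainder exactly. -/
theorem density_sub_current_eq_remainder (hE : 0 < E) (hN : 2 ≤ N) {w : ℤ}
    (hx : xiVec E x t = coleHopf E (x t) w) (hl : ∀ j < N, 0 < lam E α β ρ₀ N t j) {g : ℕ → ℝ}
    (h0 : g 0 = 0) (h1 : g N = 0) :
    modifiedDensityField E α β ρ₀ x t g - currentField E α β ρ₀ x t g =
      remainder E α β ρ₀ x t g := by
  have hN' : (N : ℝ) ≠ 0 := by positivity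
  have hγ : gam E N ≠ 0 := (gam_neg hE hN).ne
  set F : ℕ → ℝ := fun j => Real.log (xi E x t j / lam E α β ρ₀ N t j) with hF
  have hlog : ∀ j < N, Real.log (xi E x t j) = gam E N / N * (w - mass (x t) j) := by
    intro j hj
    have := congrFun hx ⟨j, hj⟩
    simp only [xiVec, coleHopf] at this
    rw [this, Real.log_exp]
  have hFj : ∀ j < N, F j = gam E N / N * (w - mass (x t) j) -
      Real.log (lam E α β ρ₀ N t j) := by
    intro j hj
    simp only [hF]
    rw [Real.log_div (by unfold xi; positivity) (hl j hj).ne', hlog j hj]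
  have hd : ∀ j ∈ Finset.Ico 1 N, particle (x t) j - rProfile E α β ρ₀ N t j =
      -(N / gam E N) * (F j - F (j - 1)) := by
    intro j hj
    obtain ⟨hj1, hj2⟩ := Finset.mem_Ico.1 hj
    obtain ⟨i, rfl⟩ : ∃ i, j = i + 1 := ⟨j - 1, by omega⟩
    rw [Nat.add_sub_cancel, hFj _ hj2, hFj i (by omega), mass_succ]
    unfold rProfile gradMinus
    rw [Nat.add_sub_cancel]
    field_simp
    ring
  have hY : modifiedDensityField E α β ρ₀ x t g =
      1 / √(N : ℝ) * ∑ j ∈ Finset.range N, 1 / gam E N * gradPlus N g j * F j := by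
    unfold modifiedDensityField gradPlus
    congr 1
    obtain ⟨m, rfl⟩ : ∃ m, N = m + 1 := ⟨N - 1, by omega⟩
    have hp := sum_range_by_parts g F m
    rw [h0, h1] at hp
    have e1 : ∑ j ∈ Finset.range (m + 1),
        1 / gam E (m + 1) * (((m + 1 : ℕ) : ℝ) * (g (j + 1) - g j)) * F j =
        (m + 1 : ℕ) / gam E (m + 1) *
          ∑ j ∈ Finset.range (m + 1), (g (j + 1) - g j) * F j := by
      rw [Finset.mul_sum]
      exact Finset.sum_congr rfl fun j _ => by ring
    rw [e1, hp, zero_mul, zero_mul, sub_zero, zero_sub, mul_neg, ← neg_mul, Finset.mul_sum]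
    refine Finset.sum_congr rfl fun j hj => ?_
    rw [hd j hj]
    ring
  rw [hY]
  unfold currentField remainder
  rw [← mul_sub, ← Finset.sum_sub_distrib]
  congr 1
  refine Finset.sum_congr rfl fun j hj => ?_
  have := (hl j (Finset.mem_range.1 hj)).ne'
  simp only [hF]
  field_simp
  ring

/-- The trajectory respects conservation of particles at time `t`, and the mean square of the
fluctuation `ξ_t - λ_t` is at most `δ / √N`. -/
def IsClose (E α β : ℝ) (ρ₀ : ℝ → ℝ) (δ : ℝ) (x : ℝ≥0 → Config N) (t : ℝ≥0) : Prop :=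
  (∃ w : ℤ, xiVec E x t = coleHopf E (x t) w) ∧
    √(N : ℝ) * meanSq N (xiVec E x t - lamVec E α β ρ₀ N t) ≤ δ

theorem le_lam (hE : 0 < E) (hα : α ∈ Set.Ioo (0 : ℝ) 1)
    (hβ : β ∈ Set.Ioo (0 : ℝ) 1) (hρ : IsProfile α β ρ₀ L) (hN : 2 ≤ N) (ht : t ≤ T) {j : ℕ}
    (hj : j < N) : Real.exp (-(lamRate E L * T)) ≤ lam E α β ρ₀ N t j := by
  have h := (lamVec_bounds hE hα hβ hρ hN t.coe_nonneg (show (t : ℝ) ≤ T by exact_mod_cast ht)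
    ⟨j, hj⟩).1
  unfold lam extend
  rw [dif_pos hj]
  exact h

/-- The Sobolev inequality turns closeness in mean square into uniform closeness. -/
theorem IsClose.abs_xi_sub_lam_sq_le {δ : ℝ} (h : IsClose E α β ρ₀ δ x t) (hE : 0 < E)
    (hα : α ∈ Set.Ioo (0 : ℝ) 1)
    (hβ : β ∈ Set.Ioo (0 : ℝ) 1) (hρ : IsProfile α β ρ₀ L) (hN : 2 ≤ N) (ht : t ≤ T) {s : ℝ}
    (hs : 0 < s) {j : ℕ} (hj : j < N) :
    (xi E x t j - lam E α β ρ₀ N t j) ^ 2 ≤ (1 + s) * (δ / √(N : ℝ)) +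
      6 * E ^ 2 * (δ / √(N : ℝ) + lamBound E L T ^ 2) / s := by
  obtain ⟨⟨w, hw⟩, hm⟩ := h
  have hN' : (0 : ℝ) < N := by positivity
  have hsN : 0 < √(N : ℝ) := Real.sqrt_pos.2 hN'
  have hm' : meanSq N (xiVec E x t - lamVec E α β ρ₀ N t) ≤ δ / √(N : ℝ) := by
    rw [le_div_iff₀ hsN, mul_comm]; exact hm
  have hcone : xiVec E x t ∈ ratioCone E N := hw ▸ coleHopf_mem_ratioCone hE hN _ _
  have hΛ : ∀ j, |lamVec E α β ρ₀ N t j| ≤ lamBound E L T := fun j =>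
    (norm_le_pi_norm (lamVec E α β ρ₀ N t) j).trans (norm_lamVec_le hE hα hβ hρ hN ht)
  have he := energy_sub_le_of_mem_ratioCone hE hN hcone
    (lamVec_mem_ratioCone hE hα hβ hρ hN t.coe_nonneg) hΛ
  have hS := sq_le_sobolev (by omega) (xiVec E x t - lamVec E α β ρ₀ N t) hs hj
  have e : extend (xiVec E x t - lamVec E α β ρ₀ N t) j = xi E x t j - lam E α β ρ₀ N t j := by
    simp [lam, extend, hj, xiVec]
  rw [e] at hS
  exact hS.trans (add_le_add (mul_le_mul_of_nonneg_left hm' (by positivity))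
    (div_le_div_of_nonneg_right (he.trans (mul_le_mul_of_nonneg_left
      (by linarith) (by positivity))) hs.le))

end

/-! ### Convergence in probability -/

section

variable {E α β L : ℝ} {ρ₀ : ℝ → ℝ} {T : ℝ≥0}

theorem tendsto_sqrt_sqrt_sqrt_natCast :
    Tendsto (fun N : ℕ => √√√(N : ℝ)) atTop atTop :=
  Real.tendsto_sqrt_atTop.comp (Real.tendsto_sqrt_atTop.comp
    (Real.tendsto_sqrt_atTop.comp tendsto_natCast_atTop_atTop))

theorem sqrt_natCast_eq_pow (N : ℕ) : √(N : ℝ) = √√√(N : ℝ) ^ 4 := by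
  rw [show (4 : ℕ) = 2 * 2 from rfl, pow_mul, Real.sq_sqrt (Real.sqrt_nonneg _),
    Real.sq_sqrt (Real.sqrt_nonneg _)]

theorem natCast_eq_pow (N : ℕ) : (N : ℝ) = √√√(N : ℝ) ^ 8 := by
  rw [show (8 : ℕ) = 4 * 2 from rfl, pow_mul, ← sqrt_natCast_eq_pow,
    Real.sq_sqrt (Nat.cast_nonneg _)]

/-- On trajectories close to `λ`, the remainder is small once `N` is large. -/
theorem eventually_abs_remainder_le (hE : 0 < E) (hα : α ∈ Set.Ioo (0 : ℝ) 1)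
    (hβ : β ∈ Set.Ioo (0 : ℝ) 1) (hρ : IsProfile α β ρ₀ L) (δ C : ℝ) :
    ∀ᶠ N : ℕ in atTop, ∀ (x : ℝ≥0 → Config N), ∀ t ≤ T, IsClose E α β ρ₀ δ x t →
      ∀ g : ℕ → ℝ, (∀ j < N, |gradPlus N g j| / lam E α β ρ₀ N t j ≤ C) →
        |remainder E α β ρ₀ x t g| ≤
          C * ((1 + E) / E) * (2 / Real.exp (-(lamRate E L * T))) * δ := by
  set c := Real.exp (-(lamRate E L * T)) with hc
  have hc0 : 0 < c := Real.exp_pos _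
  have hy := tendsto_sqrt_sqrt_sqrt_natCast
  have hinv : Tendsto (fun N : ℕ => (√√√(N : ℝ))⁻¹) atTop (𝓝 0) := tendsto_inv_atTop_zero.comp hy
  -- bound of `(ξ - λ)²` given by the Sobolev inequality with `s = N^{1/8}`
  have hlim : Tendsto (fun N : ℕ => δ * (√√√(N : ℝ))⁻¹ ^ 4 + δ * (√√√(N : ℝ))⁻¹ ^ 3 +
      6 * E ^ 2 * (δ * (√√√(N : ℝ))⁻¹ ^ 4 + lamBound E L T ^ 2) * (√√√(N : ℝ))⁻¹)
      atTop (𝓝 0) := by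
    have := (((hinv.pow 4).const_mul δ).add ((hinv.pow 3).const_mul δ)).add
      (((((hinv.pow 4).const_mul δ).add_const (lamBound E L T ^ 2)).const_mul (6 * E ^ 2)).mul
        hinv)
    simpa using this
  filter_upwards [hlim.eventually_le_const (show 0 < (c / 2) ^ 2 by positivity),
    eventually_ge_atTop 2] with N hNs hN x t ht hcl g hg
  have hN' : (0 : ℝ) < N := by positivity
  have hy0 : 0 < √√√(N : ℝ) := by positivity
  have hlam : ∀ j < N, c ≤ lam E α β ρ₀ N t j := fun j hj => le_lam hE hα hβ hρ hN ht hj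
  have hC0 : 0 ≤ C := le_trans (div_nonneg (abs_nonneg _) (hc0.trans_le (hlam 0 (by omega))).le)
    (hg 0 (by omega))
  refine (abs_remainder_le hE hN hc0 hlam hg fun j hj => ?_).trans ?_
  · refine abs_le_of_sq_le_sq ?_ (by positivity)
    refine (hcl.abs_xi_sub_lam_sq_le hE hα hβ hρ hN ht hy0 hj).trans (le_trans (le_of_eq ?_) hNs)
    have hsq := sqrt_natCast_eq_pow N
    generalize √√√(N : ℝ) = y at *
    rw [hsq]
    field_simp
  · refine mul_le_mul_of_nonneg_left hcl.2 (by positivity)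

theorem exists_lipschitz_bound (hρ : ContDiffOn ℝ 1 ρ₀ (Set.Icc 0 1)) :
    ∃ L : ℝ, ∀ x ∈ Set.Icc (0 : ℝ) 1, ∀ y ∈ Set.Icc (0 : ℝ) 1, |ρ₀ y - ρ₀ x| ≤ L * |y - x| := by
  have hc : ContinuousOn (derivWithin ρ₀ (Set.Icc 0 1)) (Set.Icc 0 1) :=
    hρ.continuousOn_derivWithin (uniqueDiffOn_Icc zero_lt_one) le_rfl
  obtain ⟨L, hL⟩ := isCompact_Icc.exists_bound_of_continuousOn hc
  exact ⟨L, fun x hx y hy => (convex_Icc (0 : ℝ) 1).norm_image_sub_le_of_norm_derivWithin_le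
    (hρ.differentiableOn one_ne_zero) hL hx hy⟩

variable {μ : ∀ N : ℕ, Measure (Config N)} {Ω : ℕ → Type*} {mΩ : ∀ N, MeasurableSpace (Ω N)}
  {P : ∀ N, Measure (Ω N)} {ℱ : ∀ N, Filtration ℝ≥0 (mΩ N)} {η : ∀ N, ℝ≥0 → Ω N → Config N}

/-- With `κ = N^{3/4}`, the resolvent form stays below a small multiple of `N^{-5/4}` on `[0,T]`
with probability close to one, and this forces the mean square of `ξ - λ` to be small compared to
`N^{-1/2}`. -/
theorem tendsto_measure_not_isClose (hE : 0 < E) (hα : α ∈ Set.Ioo (0 : ℝ) 1)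
    (hβ : β ∈ Set.Ioo (0 : ℝ) 1) (hρ : IsProfile α β ρ₀ L)
    (hμ : ∀ N, IsProbabilityMeasure (μ N)) {A : ℝ}
    (hA : ∀ N : ℕ, 2 ≤ N → ∀ k ∈ Finset.Icc 1 (N - 1),
      ∫ ζ, (1 / √(N : ℝ) * ∑ j ∈ Finset.Icc 1 k,
        (particle ζ j - ρ₀ ((j : ℝ) / N))) ^ 4 ∂(μ N) ≤ A)
    (hη : ∀ N, 2 ≤ N → IsExclusionProcess E α β (μ N) (P N) (ℱ N) (η N))
    (hT : 0 < T) {δ : ℝ} (hδ : 0 < δ) :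
    Tendsto (fun N => P N {ω | ∃ t ≤ T, ¬ IsClose E α β ρ₀ δ (fun s => η N s ω) t})
      atTop (𝓝 0) := by
  -- the level `ε / y¹⁰`, where `y = N^{1/8}` and `κ = y⁶`, is `ε / (κ √N)`
  set ε := δ / (4 * Real.exp E) with hε
  have hε0 : 0 < ε := by positivity
  set Λ := lamBound E L T with hΛ
  set K := Real.exp (2 * formRate E Λ * T) with hK
  set B := 2 * (E ^ 2 * Real.exp (2 * E) * (1 + A)) with hB
  have hy := tendsto_sqrt_sqrt_sqrt_natCast
  have hinv : Tendsto (fun N : ℕ => (√√√(N : ℝ))⁻¹) atTop (𝓝 0) := tendsto_inv_atTop_zero.comp hy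
  have hlim : Tendsto (fun N : ℕ => ENNReal.ofReal
      (K * (B * (√√√(N : ℝ))⁻¹ ^ 4 + (√√√(N : ℝ))⁻¹) / ε)) atTop (𝓝 0) := by
    have := ENNReal.tendsto_ofReal
      (((((hinv.pow 4).const_mul B).add hinv).const_mul K).div_const ε)
    simpa using this
  have hsmall : Tendsto (fun N : ℕ => Real.exp E * (2 * dirichletConst E * Λ ^ 2) *
      (√√√(N : ℝ))⁻¹ ^ 2) atTop (𝓝 0) := by
    simpa using (hinv.pow 2).const_mul (Real.exp E * (2 * dirichletConst E * Λ ^ 2))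
  have hκlim : Tendsto (fun N : ℕ => √√√(N : ℝ) ^ 6) atTop atTop :=
    (tendsto_pow_atTop (by norm_num)).comp hy
  refine tendsto_of_tendsto_of_tendsto_of_le_of_le' tendsto_const_nhds hlim
    (Eventually.of_forall fun _ => zero_le) ?_
  filter_upwards [hsmall.eventually_le_const (show 0 < δ / 2 by positivity),
    eventually_ge_atTop 3, hκlim.eventually_ge_atTop (2 * growth E),
    hy.eventually_ge_atTop 1,
    hκlim.eventually_ge_atTop (2 * (dirichletConst E * Real.exp E))] with N hs hN3 hg hy1 hd
  have hN : 2 ≤ N := by omega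
  have hN' : (0 : ℝ) < N := by positivity
  have hsq := sqrt_natCast_eq_pow N
  have hNp := natCast_eq_pow N
  set y := √√√(N : ℝ) with hydef
  have hy0 : 0 < y := by linarith
  have hκ : IsAdmissible E N (y ^ 6) := by
    refine ⟨hg, one_le_pow₀ hy1, hd, ?_⟩
    rw [hNp]
    exact pow_le_pow_right₀ hy1 (by norm_num)
  have hsκ : √(y ^ 6) = y ^ 3 := by
    rw [show y ^ 6 = (y ^ 3) ^ 2 by ring, Real.sqrt_sq (by positivity)]
  have := hμ N
  have : IsProbabilityMeasure (P N) := by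
    have h := (hη N hN).initial
    refine ⟨?_⟩
    rw [← measure_univ (μ := μ N), ← h,
      Measure.map_apply ((hη N hN).measurable 0) MeasurableSet.univ, Set.preimage_univ]
  obtain ⟨G, hG⟩ := exists_resolvent (α := α) (β := β) hE hα.1 hβ.2 hN hκ.growth_le
  have ha : 0 < ε / y ^ 10 := by positivity
  have hbad := measure_not_isGoodAt_le (T := T) (hη N hN) hG hE hα hβ hρ hN3 hκ hT ha
  have hinit := integral_resolventForm_init_le (hη N hN) hG hE hα hβ hρ hN3 hκ (hA N hN)
  have hsub : {ω | ∃ t ≤ T, ¬ IsClose E α β ρ₀ δ (fun s => η N s ω) t} ⊆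
      {ω | ∃ t ≤ T, ¬ IsGoodAt E (lamVec E α β ρ₀ N) (resolventForm E N G) (ε / y ^ 10)
        (fun s => η N s ω) t} := by
    rintro ω ⟨t, ht, hn⟩
    refine ⟨t, ht, fun hgood => hn ⟨hgood.1, ?_⟩⟩
    obtain ⟨⟨w, hw⟩, hform⟩ := hgood
    have hΛj : ∀ j, |lamVec E α β ρ₀ N t j| ≤ Λ := fun j =>
      (norm_le_pi_norm (lamVec E α β ρ₀ N t) j).trans (norm_lamVec_le hE hα hβ hρ hN ht)
    have hm := hG.meanSq_le hE hα hβ hN hκ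
      (show xiVec E (fun s => η N s ω) t ∈ ratioCone E N from
        hw ▸ coleHopf_mem_ratioCone hE hN _ _)
      (lamVec_mem_ratioCone hE hα hβ hρ hN t.coe_nonneg) hΛj
    rw [hsq]
    unfold resolventForm at hform
    calc y ^ 4 * meanSq N (xiVec E (fun s => η N s ω) t - lamVec E α β ρ₀ N t)
        ≤ y ^ 4 * (Real.exp E * (2 * y ^ 6 * (ε / y ^ 10) +
            2 * dirichletConst E * Λ ^ 2 / y ^ 6)) := by
          refine mul_le_mul_of_nonneg_left (hm.trans ?_) (by positivity)
          gcongr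
      _ = δ / 2 + Real.exp E * (2 * dirichletConst E * Λ ^ 2) * y⁻¹ ^ 2 := by
          rw [hε]
          field_simp
          ring
      _ ≤ δ := by linarith
  refine (measure_mono hsub).trans (hbad.trans (ENNReal.ofReal_le_ofReal ?_))
  rw [hsκ]
  calc _ ≤ K * (2 / y ^ 6 * (E ^ 2 * Real.exp (2 * E) / N * (1 + A)) + 1 / (y ^ 3 * N)) /
        (ε / y ^ 10) := by gcongr
    _ = K * (B * y⁻¹ ^ 4 + y⁻¹) / ε := by
        rw [hNp, hB]
        field_simp

/-- A functional which is small on trajectories close to `λ` is uniformly small in time with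
probability tending to one. -/
theorem tendsto_measure_iSup_of_isClose (hE : 0 < E) (hα : α ∈ Set.Ioo (0 : ℝ) 1)
    (hβ : β ∈ Set.Ioo (0 : ℝ) 1) (hρ : IsProfile α β ρ₀ L)
    (hμ : ∀ N, IsProbabilityMeasure (μ N)) {A : ℝ}
    (hA : ∀ N : ℕ, 2 ≤ N → ∀ k ∈ Finset.Icc 1 (N - 1),
      ∫ ζ, (1 / √(N : ℝ) * ∑ j ∈ Finset.Icc 1 k,
        (particle ζ j - ρ₀ ((j : ℝ) / N))) ^ 4 ∂(μ N) ≤ A)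
    (hη : ∀ N, 2 ≤ N → IsExclusionProcess E α β (μ N) (P N) (ℱ N) (η N))
    (hT : 0 < T) {δ ε : ℝ} (hε : 0 < ε) (F : ∀ N : ℕ, (ℝ≥0 → Config N) → ℝ≥0 → ℝ)
    (hF : ∀ᶠ N : ℕ in atTop, ∀ x : ℝ≥0 → Config N, ∀ t ≤ T,
      IsClose E α β ρ₀ ε x t → |F N x t| ≤ δ) :
    Tendsto (fun N => P N {ω | ENNReal.ofReal δ < ⨆ (t : ℝ≥0) (_ : t ≤ T),
      ENNReal.ofReal |F N (fun s => η N s ω) t|}) atTop (𝓝 0) := by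
  refine tendsto_of_tendsto_of_tendsto_of_le_of_le' tendsto_const_nhds
    (tendsto_measure_not_isClose hE hα hβ hρ hμ hA hη hT hε)
    (Eventually.of_forall fun _ => zero_le) ?_
  filter_upwards [hF] with N hN
  refine measure_mono fun ω hω => ?_
  by_contra hcon
  have hcon : ∀ t ≤ T, IsClose E α β ρ₀ ε (fun s => η N s ω) t := fun t ht => by
    by_contra h
    exact hcon ⟨t, ht, h⟩
  refine (show ¬ (ENNReal.ofReal δ < _) from not_lt.2 (iSup₂_le fun t ht => ?_)) hω
  exact ENNReal.ofReal_le_ofReal (hN _ t ht (hcon t ht))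

theorem exists_eventually_remainder_le (hE : 0 < E) (hα : α ∈ Set.Ioo (0 : ℝ) 1)
    (hβ : β ∈ Set.Ioo (0 : ℝ) 1) (hρ : IsProfile α β ρ₀ L) (T : ℝ≥0) (C : ℝ) {δ : ℝ}
    (hδ : 0 < δ) :
    ∃ ε > 0, ∀ᶠ N : ℕ in atTop, ∀ (x : ℝ≥0 → Config N), ∀ t ≤ T, IsClose E α β ρ₀ ε x t →
      ∀ g : ℕ → ℝ, (∀ j < N, |gradPlus N g j| / lam E α β ρ₀ N t j ≤ C) →
        |remainder E α β ρ₀ x t g| ≤ δ := by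
  set D := C * ((1 + E) / E) * (2 / Real.exp (-(lamRate E L * T))) with hD
  refine ⟨δ / (|D| + 1), by positivity, ?_⟩
  filter_upwards [eventually_abs_remainder_le (T := T) hE hα hβ hρ (δ / (|D| + 1)) C] with
    N hN x t ht hcl g hg
  refine (hN x t ht hcl g hg).trans ?_
  rw [← hD, ← mul_div_assoc, div_le_iff₀ (by positivity), mul_comm]
  gcongr
  linarith [le_abs_self D]

end

end WASEP

theorem mainTheorem5
    (E α β : ℝ) (hE : 0 < E) (hα : α ∈ Set.Ioo (0 : ℝ) 1) (hβ : β ∈ Set.Ioo (0 : ℝ) 1)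
    (ρ₀ : ℝ → ℝ) (hρ : ContDiffOn ℝ 4 ρ₀ (Set.Icc 0 1))
    (hρ_mem : ∀ x ∈ Set.Icc (0 : ℝ) 1, ρ₀ x ∈ Set.Icc (0 : ℝ) 1)
    (hρ_zero : ρ₀ 0 = α) (hρ_one : ρ₀ 1 = β)
    (μ : ∀ N : ℕ, Measure (WASEP.Config N)) (hμ : ∀ N, IsProbabilityMeasure (μ N))
    (hμ_init : ∃ A : ℝ, ∀ N : ℕ, 2 ≤ N → ∀ k ∈ Finset.Icc 1 (N - 1),
      ∫ ζ, (1 / √(N : ℝ) * ∑ j ∈ Finset.Icc 1 k,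
        (WASEP.particle ζ j - ρ₀ ((j : ℝ) / N))) ^ 4 ∂(μ N) ≤ A)
    {Ω : ℕ → Type*} {mΩ : ∀ N, MeasurableSpace (Ω N)} (P : ∀ N, Measure (Ω N))
    (ℱ : ∀ N, Filtration ℝ≥0 (mΩ N)) (η : ∀ N, ℝ≥0 → Ω N → WASEP.Config N)
    (hη : ∀ N, 2 ≤ N → WASEP.IsExclusionProcess E α β (μ N) (P N) (ℱ N) (η N))
    (T : ℝ≥0) (hT : 0 < T) :
    (∀ φ : ℕ → ℝ≥0 → ℕ → ℝ,
      (∃ C : ℝ, ∀ N : ℕ, 2 ≤ N → ∀ t ≤ T, ∀ j < N,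
        |WASEP.gradPlus N (φ N t) j| / WASEP.lam E α β ρ₀ N t j ≤ C) →
      (∀ δ : ℝ, 0 < δ →
        Tendsto (fun N => P N {ω | ENNReal.ofReal δ < ⨆ (t : ℝ≥0) (_ : t ≤ T),
          ENNReal.ofReal |WASEP.remainder E α β ρ₀ (fun s => η N s ω) t (φ N t)|})
          atTop (𝓝 0)) ∧
      ((∀ N : ℕ, 2 ≤ N → ∀ t ≤ T, φ N t 0 = 0 ∧ φ N t N = 0) →
        ∀ δ : ℝ, 0 < δ →
          Tendsto (fun N => P N {ω | ENNReal.ofReal δ < ⨆ (t : ℝ≥0) (_ : t ≤ T),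
            ENNReal.ofReal |WASEP.modifiedDensityField E α β ρ₀ (fun s => η N s ω) t (φ N t)
              - WASEP.currentField E α β ρ₀ (fun s => η N s ω) t (φ N t)|})
            atTop (𝓝 0))) ∧
    (∀ G : ℝ → ℝ, ContDiffOn ℝ 1 G (Set.Icc 0 1) → G 0 = 0 → G 1 = 0 →
      ∀ δ : ℝ, 0 < δ →
        Tendsto (fun N => P N {ω | ENNReal.ofReal δ < ⨆ (t : ℝ≥0) (_ : t ≤ T),
          ENNReal.ofReal
            |WASEP.modifiedDensityField E α β ρ₀ (fun s => η N s ω) t (fun j => G ((j : ℝ) / N))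
              - WASEP.currentField E α β ρ₀ (fun s => η N s ω) t (fun j => G ((j : ℝ) / N))|})
          atTop (𝓝 0)) := by
  obtain ⟨L, hL⟩ := WASEP.exists_lipschitz_bound (hρ.of_le (by norm_num))
  have hprof : WASEP.IsProfile α β ρ₀ L := ⟨hρ_mem, hρ_zero, hρ_one, hL⟩
  obtain ⟨A, hA⟩ := hμ_init
  have hsnd : ∀ φ : ℕ → ℝ≥0 → ℕ → ℝ,
      (∃ C : ℝ, ∀ N : ℕ, 2 ≤ N → ∀ t ≤ T, ∀ j < N,
        |WASEP.gradPlus N (φ N t) j| / WASEP.lam E α β ρ₀ N t j ≤ C) →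
      (∀ N : ℕ, 2 ≤ N → ∀ t ≤ T, φ N t 0 = 0 ∧ φ N t N = 0) →
        ∀ δ : ℝ, 0 < δ →
          Tendsto (fun N => P N {ω | ENNReal.ofReal δ < ⨆ (t : ℝ≥0) (_ : t ≤ T),
            ENNReal.ofReal |WASEP.modifiedDensityField E α β ρ₀ (fun s => η N s ω) t (φ N t)
              - WASEP.currentField E α β ρ₀ (fun s => η N s ω) t (φ N t)|})
            atTop (𝓝 0) := by
    rintro φ ⟨C, hC⟩ hφ δ hδ
    obtain ⟨ε, hε, hrem⟩ := WASEP.exists_eventually_remainder_le hE hα hβ hprof T C hδ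
    refine WASEP.tendsto_measure_iSup_of_isClose hE hα hβ hprof hμ hA hη hT hε
      (fun N x t => WASEP.modifiedDensityField E α β ρ₀ x t (φ N t)
        - WASEP.currentField E α β ρ₀ x t (φ N t)) ?_
    filter_upwards [hrem, eventually_ge_atTop 2] with N hN h2 x t ht hcl
    obtain ⟨w, hw⟩ := hcl.1
    rw [WASEP.density_sub_current_eq_remainder hE h2 hw
      (fun j hj => (Real.exp_pos _).trans_le (WASEP.le_lam hE hα hβ hprof h2 ht hj))
      (hφ N h2 t ht).1 (hφ N h2 t ht).2]
    exact hN x t ht hcl _ (hC N h2 t ht)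
  refine ⟨fun φ hφ => ⟨fun δ hδ => ?_, hsnd φ hφ⟩, fun G hG hG0 hG1 => ?_⟩
  · obtain ⟨C, hC⟩ := hφ
    obtain ⟨ε, hε, hrem⟩ := WASEP.exists_eventually_remainder_le hE hα hβ hprof T C hδ
    refine WASEP.tendsto_measure_iSup_of_isClose hE hα hβ hprof hμ hA hη hT hε
      (fun N x t => WASEP.remainder E α β ρ₀ x t (φ N t)) ?_
    filter_upwards [hrem, eventually_ge_atTop 2] with N hN h2 x t ht hcl
    exact hN x t ht hcl _ (hC N h2 t ht)
  · refine hsnd (fun N _ j => G ((j : ℝ) / N)) ?_ ?_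
    · obtain ⟨M, hM⟩ := WASEP.exists_lipschitz_bound hG
      refine ⟨M / Real.exp (-(WASEP.lamRate E L * T)), fun N hN t ht j hj => ?_⟩
      have hN' : (0 : ℝ) < N := by positivity
      have h := hM _ (WASEP.div_mem_Icc hj.le) _ (WASEP.div_mem_Icc (show j + 1 ≤ N by omega))
      have e : ((j + 1 : ℕ) : ℝ) / N - j / N = 1 / N := by push_cast; ring
      rw [e, abs_of_pos (by positivity : (0 : ℝ) < 1 / N), mul_one_div, le_div_iff₀ hN'] at h
      have h' : |WASEP.gradPlus N (fun j => G ((j : ℝ) / N)) j| ≤ M := by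
        unfold WASEP.gradPlus
        rw [abs_mul, Nat.abs_cast, mul_comm]
        exact h
      have hlam := WASEP.le_lam hE hα hβ hprof hN ht hj
      exact div_le_div₀ ((abs_nonneg _).trans h') h' (Real.exp_pos _) hlam
    · intro N hN t ht
      have : (N : ℝ) ≠ 0 := by positivity
      simp [hG0, hG1, this]
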